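/- For a finite simple undirected graph $G=(V,E)$, a set $D\subseteq V$ is a *connected dominating set* if every vertex outside $D$ has a neighbour in $D$ and the induced subgraph $G[D]$ is connected (has exactly one connected component, so $D\neq\emptyset$); it is *minimal* if no proper subset of $D$ is a connected dominating set of $G$. (1) There is an algorithm that, given an arbitrary graph $G$ with $n$ vertices (by its adjacency matrix), outputs all minimal connected dominating sets of $G$, each exactly once, in time $\mathcal{O}(1.9896^n)$ and using only polynomial space. More precisely, there are a single word-RAM program, a constant $C$ and a polynomial $p$ such that, for every $n$ and every graph $G$ on $n$ vertices, the program halts on input $G$ after at most $C\cdot 1.9896^n$ elementary steps, having appended to its write-only output stream (which does not count as working space) the characteristic vectors of the minimal connected dominating sets of $G$, each exactly once, while it uses only constantly many registers and arrays, with only addresses and values below $p(n)$. (2) Consequently, there is a constant $C'$ such that every graph with $n$ vertices has at most $C'\cdot 1.9896^n$ minimal connected dominating sets. -/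

import Mathlib

/-! ### Connected dominating sets -/

/-- `D` is a dominating set of `G`: every vertex is in `D` or adjacent to a vertex of `D`. -/
def IsDominatingSet {V : Type*} (G : SimpleGraph V) (D : Finset V) : Prop :=
  ∀ v, v ∈ D ∨ ∃ u ∈ D, G.Adj u v

/-- `D` is a connected dominating set of `G`: it dominates `G` and `G[D]` is connected
(it has exactly one connected component; in particular `D` is not empty). -/
def IsCDS {V : Type*} (G : SimpleGraph V) (D : Finset V) : Prop :=
  IsDominatingSet G D ∧ (G.induce (D : Set V)).Connected

/-- `D` is an inclusion-minimal connected dominating set of `G`. -/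
def IsMinimalCDS {V : Type*} (G : SimpleGraph V) (D : Finset V) : Prop :=
  Minimal (IsCDS G) D

/-! ### A word RAM with a write-only output stream

A program uses finitely many registers and finitely many named arrays, with indirect
access to the arrays.  The machine with parameter `W` has arrays of `W` cells and words that hold
the numbers below `W`; a run in which a larger number would be computed, or a cell outside an
array would be addressed, does not exist.  Hence a run of a fixed program on the machine with
parameter `W` takes place within `O(W)` words of `O(log W)` bits.  As usual for
enumeration problems, the output stream can only be appended to, and is not part of
the working space. -/

namespace WordRAM

/-- Contents of the registers `reg x`, of the arrays `mem a`, and the output written so far. -/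
structure State where
  reg : ℕ → ℕ
  mem : ℕ → ℕ → ℕ
  out : List ℕ

/-- Expressions: constants, registers, array cells, addition, truncated subtraction,
multiplication, and the comparisons `<` and `=` (with value `1` if true and `0` if false). -/
inductive Expr where
  | const (k : ℕ)
  | reg (x : ℕ)
  | read (a : ℕ) (i : Expr)
  | add (e f : Expr)
  | sub (e f : Expr)
  | mul (e f : Expr)
  | lt (e f : Expr)
  | eq (e f : Expr)

namespace Expr

/-- The value of an expression. -/
def eval (s : State) : Expr → ℕ
  | const k => k
  | reg x => s.reg x
  | read a i => s.mem a (i.eval s)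
  | add e f => e.eval s + f.eval s
  | sub e f => e.eval s - f.eval s
  | mul e f => e.eval s * f.eval s
  | lt e f => if e.eval s < f.eval s then 1 else 0
  | eq e f => if e.eval s = f.eval s then 1 else 0

/-- The evaluation of the expression is possible on the machine with parameter `W`: the values
of all its subexpressions, and hence all addresses of cells that are read, are below `W`. -/
def Fits (W : ℕ) (s : State) : Expr → Prop
  | const k => k < W
  | reg x => s.reg x < W
  | read a i => i.Fits W s ∧ s.mem a (i.eval s) < W
  | add e f => e.Fits W s ∧ f.Fits W s ∧ e.eval s + f.eval s < W
  | sub e f => e.Fits W s ∧ f.Fits W s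
  | mul e f => e.Fits W s ∧ f.Fits W s ∧ e.eval s * f.eval s < W
  | lt e f => e.Fits W s ∧ f.Fits W s ∧ 1 < W
  | eq e f => e.Fits W s ∧ f.Fits W s ∧ 1 < W

/-- The time for the evaluation of an expression: one unit for every operation, register access,
constant and cell access. -/
def cost : Expr → ℕ
  | const _ => 1
  | reg _ => 1
  | read _ i => i.cost + 1
  | add e f => e.cost + f.cost + 1
  | sub e f => e.cost + f.cost + 1
  | mul e f => e.cost + f.cost + 1
  | lt e f => e.cost + f.cost + 1
  | eq e f => e.cost + f.cost + 1

end Expr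

/-- Programs. A condition counts as true if its value is not `0`. -/
inductive Cmd where
  | skip
  | assign (x : ℕ) (e : Expr)
  | store (a : ℕ) (i e : Expr)
  | output (e : Expr)
  | seq (c d : Cmd)
  | ite (e : Expr) (c d : Cmd)
  | while (e : Expr) (c : Cmd)

/-- `Exec W c s t s'`: on the machine with parameter `W`, the program `c` started in state `s`
halts after exactly `t` time units in state `s'`. -/
inductive Exec (W : ℕ) : Cmd → State → ℕ → State → Prop
  | skip (s : State) : Exec W .skip s 1 s
  | assign (x : ℕ) (e : Expr) (s : State) (he : e.Fits W s) :
      Exec W (.assign x e) s (e.cost + 1)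
        { s with reg := Function.update s.reg x (e.eval s) }
  | store (a : ℕ) (i e : Expr) (s : State) (hi : i.Fits W s) (he : e.Fits W s) :
      Exec W (.store a i e) s (i.cost + e.cost + 1)
        { s with
          mem := Function.update s.mem a (Function.update (s.mem a) (i.eval s) (e.eval s)) }
  | output (e : Expr) (s : State) (he : e.Fits W s) :
      Exec W (.output e) s (e.cost + 1) { s with out := s.out ++ [e.eval s] }
  | seq (c d : Cmd) (s s₁ s₂ : State) (t₁ t₂ : ℕ)
      (hc : Exec W c s t₁ s₁) (hd : Exec W d s₁ t₂ s₂) :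
      Exec W (.seq c d) s (t₁ + t₂) s₂
  | iteTrue (e : Expr) (c d : Cmd) (s s₁ : State) (t : ℕ) (he : e.Fits W s)
      (h : e.eval s ≠ 0) (hc : Exec W c s t s₁) :
      Exec W (.ite e c d) s (e.cost + 1 + t) s₁
  | iteFalse (e : Expr) (c d : Cmd) (s s₁ : State) (t : ℕ) (he : e.Fits W s)
      (h : e.eval s = 0) (hd : Exec W d s t s₁) :
      Exec W (.ite e c d) s (e.cost + 1 + t) s₁
  | whileTrue (e : Expr) (c : Cmd) (s s₁ s₂ : State) (t₁ t₂ : ℕ) (he : e.Fits W s)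
      (h : e.eval s ≠ 0) (hc : Exec W c s t₁ s₁) (hw : Exec W (.while e c) s₁ t₂ s₂) :
      Exec W (.while e c) s (e.cost + 1 + t₁ + t₂) s₂
  | whileFalse (e : Expr) (c : Cmd) (s : State) (he : e.Fits W s) (h : e.eval s = 0) :
      Exec W (.while e c) s (e.cost + 1) s

open Classical in
/-- The initial state on input `G`: register `0` holds the number `n` of vertices, array `0`
holds the adjacency matrix of `G` row by row, everything else is `0`, and the output is empty. -/
noncomputable def inputState {n : ℕ} (G : SimpleGraph (Fin n)) : State where
  reg x := if x = 0 then n else 0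
  mem a k := if a = 0 ∧ ∃ i j : Fin n, k = (i : ℕ) * n + j ∧ G.Adj i j then 1 else 0
  out := []

end WordRAM

/-- The characteristic vector of a vertex set. -/
def charVector {n : ℕ} (D : Finset (Fin n)) : List ℕ :=
  List.ofFn fun i : Fin n => if i ∈ D then 1 else 0

/-- The output `out` is an enumeration of the minimal connected dominating sets of `G`: it is
the concatenation of their characteristic vectors, in some order, each of them exactly once. -/
def IsMinimalCDSEnumeration {n : ℕ} (G : SimpleGraph (Fin n)) (out : List ℕ) : Prop :=
  ∃ L : List (Finset (Fin n)), L.Nodup ∧ (∀ D, D ∈ L ↔ IsMinimalCDS G D) ∧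
    out = L.flatMap charVector

/-! The search grows a connected set `D` from a root and keeps a set `X` of dominated vertices that
are excluded for good. It branches on an undecided dominated vertex, a frontier vertex, which is
either included or excluded. If some vertex of `D` can be dropped without losing connectivity or
domination, then no minimal set contains `D` (`not_isMinimalCDS_of_redundant`), so such inclusions
are pruned. Conversely, a connected dominating set with no such vertex is minimal
(`isMinimalCDS_of_not_redundant`). Hence the tree from a root finds exactly the minimal sets
containing that root, each once (`found_spec`). Running all roots and keeping a set only at its
smallest vertex gives the enumeration.

The leaves are counted by a multiplicative measure `meas`, a product of vertex weights. A frontier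
vertex is weighted by its gain, the number of vertices it would newly dominate, and an undominated
vertex by its number of available neighbours. No weight exceeds 1.9884. `allBounds` proves by
induction on the depth that the number of leaves is at most the measure. Vertices whose inclusion is
redundant are taken first and only excluded; otherwise the gain is maximal and positive. For gain at
least three, one branching suffices and leaves slack.

For gain one and two a single branching is not enough, and the proof uses what happens one level
deeper; the extra fields of `Bound` carry this information. Suppose `v` has gain one, its new vertex
`w` has no other frontier neighbour, and `w` would dominate at least two more vertices. After `v` is
included, `w` is the next real branching vertex. If `w` is then excluded, any later inclusion of a
neighbour of `w` makes `v` superfluous: these neighbours become `Blocked` and their weight drops.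
For gain two, either the two new vertices both have gain at least three, which gives the slack of
`large_two`, or excluding `v` lowers the weight of one with few available neighbours.

The algorithm is an explicit program, verified with triples `Run` (time bound and postcondition) and
`Loop` for the traversal. The depth is at most `n + 1`, so the number of moves is linear in `n`
times the number of leaves (`steps_le`). Each move takes polynomial time, and the gap between 1.9884
and 1.9896 absorbs all polynomial factors. Finally, each output symbol costs a time unit, so the
running time also bounds the number of minimal sets (`ncard_le_time`); an isomorphism carries this
to arbitrary finite vertex types. -/

namespace CDSEnum

/-! ### Connectivity in terms of cuts -/

/-- `D` is nonempty and has no nonempty proper subset without edges to the rest of `D`. -/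
def CutConnected {V : Type*} (G : SimpleGraph V) (D : Finset V) : Prop :=
  D.Nonempty ∧ ∀ C ⊆ D, C.Nonempty → (∀ a ∈ C, ∀ b ∈ D, G.Adj a b → b ∈ C) → D ⊆ C

section Graph

variable {V : Type*} [DecidableEq V] {G : SimpleGraph V}

/-- Cuts avoid walks in induced subgraphs: inserting and erasing vertices becomes an argument about
closed subsets of one `Finset`. -/
theorem cutConnected_iff {D : Finset V} :
    CutConnected G D ↔ (G.induce (D : Set V)).Connected := by
  classical
  constructor
  · rintro ⟨⟨x, hx⟩, h⟩
    have : Nonempty (D : Set V) := ⟨⟨x, hx⟩⟩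
    refine ⟨fun a b => ?_⟩
    let C : Finset V := D.filter fun v => ∃ hv : v ∈ D,
      (G.induce (D : Set V)).Reachable a ⟨v, hv⟩
    have hC : D ⊆ C := by
      refine h C (Finset.filter_subset _ _) ⟨a, ?_⟩ ?_
      · exact Finset.mem_filter.2 ⟨a.2, a.2, SimpleGraph.Reachable.refl _⟩
      · intro u hu w hw huw
        obtain ⟨huD, hu', hr⟩ := Finset.mem_filter.1 hu
        refine Finset.mem_filter.2 ⟨hw, hw, hr.trans (SimpleGraph.Adj.reachable ?_)⟩
        simpa using huw
    obtain ⟨_, hb, hr⟩ := Finset.mem_filter.1 (hC b.2)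
    exact hr
  · intro h
    obtain ⟨⟨x, hx⟩⟩ := h.nonempty
    refine ⟨⟨x, hx⟩, fun C hCD hC hcl => ?_⟩
    obtain ⟨c, hc⟩ := hC
    intro y hy
    obtain ⟨p⟩ := h.preconnected ⟨c, hCD hc⟩ ⟨y, hy⟩
    have key : ∀ (a b : (D : Set V)) (_ : (G.induce (D : Set V)).Walk a b),
        (a : V) ∈ C → (b : V) ∈ C := by
      intro a b p
      induction p with
      | nil => exact id
      | @cons u v w huv _ ih => exact fun hu => ih (hcl u hu v v.2 (by simpa using huv))
    exact key _ _ p hc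

theorem CutConnected.insert {D : Finset V} (hD : CutConnected G D) {x y : V} (hy : y ∈ D)
    (hxy : G.Adj y x) : CutConnected G (insert x D) := by
  refine ⟨⟨x, by simp⟩, fun C hCD hC hcl => ?_⟩
  have hDC : D ⊆ C := by
    have hne : (C ∩ D).Nonempty := by
      obtain ⟨c, hc⟩ := hC
      rcases Finset.mem_insert.1 (hCD hc) with rfl | h
      · exact ⟨y, Finset.mem_inter.2 ⟨hcl _ hc _ (by simp [hy]) hxy.symm, hy⟩⟩
      · exact ⟨c, Finset.mem_inter.2 ⟨hc, h⟩⟩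
    intro z hz
    refine (Finset.mem_inter.1 (hD.2 (C ∩ D) Finset.inter_subset_right hne ?_ hz)).1
    intro a ha b hb hab
    exact Finset.mem_inter.2
      ⟨hcl a (Finset.mem_inter.1 ha).1 b (by simp [hb]) hab, hb⟩
  intro z hz
  rcases Finset.mem_insert.1 hz with rfl | h
  · exact hcl y (hDC hy) _ (by simp) hxy
  · exact hDC h

/-! ### Domination and redundancy -/

variable [Fintype V] [DecidableRel G.Adj]

variable (G) in
/-- The closed neighbourhood of a set. -/
def cl (D : Finset V) : Finset V := Finset.univ.filter fun v => v ∈ D ∨ ∃ u ∈ D, G.Adj u v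

theorem mem_cl {D : Finset V} {v : V} : v ∈ cl G D ↔ v ∈ D ∨ ∃ u ∈ D, G.Adj u v := by
  simp [cl]

theorem subset_cl (D : Finset V) : D ⊆ cl G D := fun _ h => mem_cl.2 (Or.inl h)

theorem mem_cl_of_adj {D : Finset V} {u v : V} (hu : u ∈ D) (h : G.Adj u v) : v ∈ cl G D :=
  mem_cl.2 (Or.inr ⟨u, hu, h⟩)

theorem cl_mono {D E : Finset V} (h : D ⊆ E) : cl G D ⊆ cl G E := by
  intro v hv
  rcases mem_cl.1 hv with hv | ⟨u, hu, huv⟩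
  · exact mem_cl.2 (Or.inl (h hv))
  · exact mem_cl_of_adj (h hu) huv

theorem mem_cl_insert {D : Finset V} {v w : V} :
    w ∈ cl G (insert v D) ↔ w ∈ cl G D ∨ w = v ∨ G.Adj v w := by
  simp only [mem_cl, Finset.mem_insert, exists_eq_or_imp]
  grind

theorem exists_adj_of_mem_cl {D : Finset V} {v : V} (h : v ∈ cl G D) (hv : v ∉ D) :
    ∃ u ∈ D, G.Adj u v := (mem_cl.1 h).resolve_left hv

theorem isDominatingSet_iff {D : Finset V} : IsDominatingSet G D ↔ ∀ v, v ∈ cl G D := by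
  simp [IsDominatingSet, mem_cl]

theorem isCDS_iff {D : Finset V} :
    IsCDS G D ↔ (∀ v, v ∈ cl G D) ∧ CutConnected G D := by
  rw [IsCDS, isDominatingSet_iff, cutConnected_iff]

theorem CutConnected.insert_of_mem_cl {D : Finset V} (hD : CutConnected G D) {x : V}
    (hx : x ∈ cl G D) : CutConnected G (Insert.insert x D) := by
  rcases mem_cl.1 hx with h | ⟨u, hu, h⟩
  · rwa [Finset.insert_eq_of_mem h]
  · exact hD.insert hu h

variable (G) in
/-- Some vertex of `S` can be removed without losing connectivity or dominated vertices. -/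
def Redundant (S : Finset V) : Prop :=
  ∃ v ∈ S, CutConnected G (S.erase v) ∧ ∀ w, w = v ∨ G.Adj v w → w ∈ cl G (S.erase v)

/-- A vertex that is redundant in `S` stays redundant in every connected superset. -/
theorem cutConnected_erase {S E : Finset V} {v : V} (hSE : S.erase v ⊆ E)
    (hv : v ∈ E) (hS : CutConnected G (S.erase v))
    (hcl : ∀ w ∈ E, w = v ∨ G.Adj v w → w ∈ cl G (S.erase v)) (hE : CutConnected G E) :
    CutConnected G (E.erase v) := by
  have hSE' : S.erase v ⊆ E.erase v := fun x hx =>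
    Finset.mem_erase.2 ⟨Finset.ne_of_mem_erase hx, hSE hx⟩
  refine ⟨hS.1.mono hSE', fun C hCE hC hclosed => ?_⟩
  have hvC : v ∉ C := fun h => by simpa using hCE h
  -- The connected set `S.erase v` takes over the role of `v`. If `C` meets it, `C` contains it and
  -- hence every neighbour of `v` in `E`, so `insert v C` is closed in `E`. If not, no vertex of `C`
  -- is adjacent to `v`, so `C` is closed in `E` and would have to contain `v`.
  by_cases hne : (C ∩ S.erase v).Nonempty
  · have hSC : S.erase v ⊆ C := by
      intro z hz
      refine (Finset.mem_inter.1 (hS.2 _ Finset.inter_subset_right hne ?_ hz)).1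
      intro a ha b hb hab
      exact Finset.mem_inter.2 ⟨hclosed a (Finset.mem_inter.1 ha).1 b (hSE' hb) hab, hb⟩
    have hall : E ⊆ insert v C := by
      refine hE.2 _ ?_ ⟨v, by simp⟩ ?_
      · intro x hx
        rcases Finset.mem_insert.1 hx with rfl | hx
        · exact hv
        · exact Finset.mem_of_mem_erase (hCE hx)
      · intro a ha b hb hab
        by_cases hbv : b = v
        · simp [hbv]
        have hbE : b ∈ E.erase v := Finset.mem_erase.2 ⟨hbv, hb⟩
        refine Finset.mem_insert_of_mem ?_
        rcases Finset.mem_insert.1 ha with rfl | ha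
        · rcases mem_cl.1 (hcl b hb (Or.inr hab)) with h | ⟨u, hu, hub⟩
          · exact hSC h
          · exact hclosed u (hSC hu) b hbE hub
        · exact hclosed a ha b hbE hab
    intro x hx
    obtain ⟨h1, h2⟩ := Finset.mem_erase.1 hx
    exact (Finset.mem_insert.1 (hall h2)).resolve_left h1
  · exfalso
    apply hvC
    refine hE.2 C (fun x hx => Finset.mem_of_mem_erase (hCE hx)) hC ?_ hv
    intro a ha b hb hab
    have haE := Finset.mem_of_mem_erase (hCE ha)
    by_cases hbv : b = v
    · subst hbv
      exfalso
      apply hne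
      rcases mem_cl.1 (hcl a haE (Or.inr hab.symm)) with h | ⟨u, hu, hua⟩
      · exact ⟨a, Finset.mem_inter.2 ⟨ha, h⟩⟩
      · exact ⟨u, Finset.mem_inter.2 ⟨hclosed a ha u (hSE' hu) hua.symm, hu⟩⟩
    · exact hclosed a ha b (Finset.mem_erase.2 ⟨hbv, hb⟩) hab

/-- This justifies pruning. The vertex that can be dropped from `S` can also be dropped from `D`:
the rest of `S` dominates its closed neighbourhood, and every other vertex keeps its dominator. -/
theorem not_isMinimalCDS_of_redundant {S D : Finset V} (hS : Redundant G S) (hSD : S ⊆ D) :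
    ¬ IsMinimalCDS G D := by
  rintro ⟨hD, hmin⟩
  obtain ⟨v, hv, hc, hcl⟩ := hS
  rw [isCDS_iff] at hD
  have hsub : S.erase v ⊆ D.erase v := Finset.erase_subset_erase v hSD
  have h1 : CutConnected G (D.erase v) :=
    cutConnected_erase ((Finset.erase_subset v S).trans hSD) (hSD hv) hc
      (fun w _ h => hcl w h) hD.2
  have h2 : ∀ w, w ∈ cl G (D.erase v) := by
    intro w
    by_cases hw : w = v ∨ G.Adj v w
    · exact cl_mono hsub (hcl w hw)
    · push Not at hw
      rcases mem_cl.1 (hD.1 w) with h | ⟨u, hu, huw⟩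
      · exact subset_cl _ (Finset.mem_erase.2 ⟨hw.1, h⟩)
      · refine mem_cl_of_adj (Finset.mem_erase.2 ⟨?_, hu⟩) huw
        rintro rfl
        exact hw.2 huw
  have := hmin (isCDS_iff.2 ⟨h2, h1⟩) (Finset.erase_subset v D) (hSD hv)
  simp at this

/-- A connected dominating set without redundant vertices is minimal. -/
theorem isMinimalCDS_of_not_redundant {D : Finset V} (hD : IsCDS G D) (h : ¬ Redundant G D) :
    IsMinimalCDS G D := by
  refine ⟨hD, fun E hE hED => ?_⟩
  by_contra hne
  obtain ⟨v, hvD, hvE⟩ := Finset.not_subset.1 hne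
  rw [isCDS_iff] at hE
  have hED' : E ⊆ D.erase v := fun x hx =>
    Finset.mem_erase.2 ⟨fun h => hvE (h ▸ hx), hED hx⟩
  -- `E` dominates every vertex, so any vertices may be added to it one at a time. In this way
  -- `D.erase v` is rebuilt from `E`.
  have hmono : ∀ E' : Finset V, CutConnected G (E ∪ E') := by
    intro E'
    induction E' using Finset.induction_on with
    | empty => simpa using hE.2
    | insert a s _ ih =>
      rw [Finset.union_insert]
      exact ih.insert_of_mem_cl (cl_mono Finset.subset_union_left (hE.1 a))
  refine h ⟨v, hvD, ?_, fun w _ => cl_mono hED' (hE.1 w)⟩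
  have := hmono (D.erase v)
  rwa [Finset.union_eq_right.2 hED'] at this

/-! ### The search tree -/

variable (G) in
/-- The vertices that are not dominated by `D`. -/
def und (D : Finset V) : Finset V := Finset.univ \ cl G D

variable (G) in
/-- The undecided vertices dominated by `D`, where the vertices of `X` are excluded. -/
def fr (D X : Finset V) : Finset V := (cl G D \ D) \ X

variable (G) in
/-- The number of vertices that `v` would newly dominate. -/
def gain (D : Finset V) (v : V) : ℕ := ((und G D).filter (G.Adj v)).card

variable (G) in
/-- The number of neighbours of `w` that are not excluded. -/
def dg (X : Finset V) (w : V) : ℕ := (Finset.univ.filter fun u => G.Adj w u ∧ u ∉ X).card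

variable (G) in
/-- Some vertex can no longer be dominated. -/
def Dead (D X : Finset V) : Prop := ∃ w ∈ und G D, ∀ u, G.Adj w u → u ∈ X

theorem mem_und {D : Finset V} {v : V} : v ∈ und G D ↔ v ∉ cl G D := by simp [und]

theorem mem_fr {D X : Finset V} {v : V} : v ∈ fr G D X ↔ v ∈ cl G D ∧ v ∉ D ∧ v ∉ X := by
  simp [fr, and_assoc]

variable (G) in
/-- A rule that selects a frontier vertex: one whose inclusion makes the set redundant if there
is any, and otherwise one that dominates as many new vertices as possible. -/
def IsChoice (ch : Finset V → Finset V → V) : Prop :=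
  ∀ D X, (fr G D X).Nonempty → ch D X ∈ fr G D X ∧
    (Redundant G (insert (ch D X) D) ∨
      ((∀ u ∈ fr G D X, ¬ Redundant G (insert u D)) ∧
        ∀ u ∈ fr G D X, gain G D u ≤ gain G D (ch D X)))

open Classical in
variable (G) in
/-- The number of leaves of the search tree below the state `(D, X)`, up to depth `m`; a live
node without live children counts as a leaf. -/
noncomputable def leaves (ch : Finset V → Finset V → V) : ℕ → Finset V → Finset V → ℕ
  | 0, _, _ => 0
  | m + 1, D, X =>
    if Dead G D X then 0
    else if fr G D X = ∅ then 1
    else max 1 ((if Redundant G (insert (ch D X) D) then 0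
      else leaves ch m (insert (ch D X) D) X) + leaves ch m D (insert (ch D X) X))

open Classical in
variable (G) in
/-- The sets found by the search below the state `(D, X)`. -/
noncomputable def found (ch : Finset V → Finset V → V) :
    ℕ → Finset V → Finset V → List (Finset V)
  | 0, _, _ => []
  | m + 1, D, X =>
    if Dead G D X then []
    else if fr G D X = ∅ then (if und G D = ∅ then [D] else [])
    else (if Redundant G (insert (ch D X) D) then []
      else found ch m (insert (ch D X) D) X) ++ found ch m D (insert (ch D X) X)

open Classical in
variable (G) in
/-- The number of steps of a traversal of the search tree. -/
noncomputable def steps (ch : Finset V → Finset V → V) : ℕ → Finset V → Finset V → ℕ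
  | 0, _, _ => 0
  | m + 1, D, X =>
    if Dead G D X then 1
    else if fr G D X = ∅ then 1
    else 1 + (if Redundant G (insert (ch D X) D) then 0
      else steps ch m (insert (ch D X) D) X + 1) + steps ch m D (insert (ch D X) X) + 1

/-- Dead nodes are not leaves, but each costs one step, paid by the summand `1`. A live node adds at
most four steps beyond its children's leaf terms, and its leaf count is at least one. -/
theorem steps_le (ch : Finset V → Finset V → V) (m : ℕ) (D X : Finset V) :
    steps G ch m D X ≤ 4 * m * leaves G ch m D X + 1 := by
  induction m generalizing D X with
  | zero => simp [steps]
  | succ m ih =>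
    rw [steps, leaves]
    split_ifs with h1 h2 h3
    · simp
    · simp
    · have := ih D (insert (ch D X) X)
      set t := leaves G ch m D (insert (ch D X) X)
      have h4 : 4 * m * t ≤ 4 * m * max 1 (0 + t) := by gcongr; simp
      have h5 : 1 ≤ max 1 (0 + t) := le_max_left _ _
      nlinarith
    · have ha := ih D (insert (ch D X) X)
      have hb := ih (insert (ch D X) D) X
      set t := leaves G ch m D (insert (ch D X) X)
      set t' := leaves G ch m (insert (ch D X) D) X
      have h4 : 4 * m * (t' + t) ≤ 4 * m * max 1 (t' + t) := by gcongr; simp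
      have h5 : 1 ≤ max 1 (t' + t) := le_max_left _ _
      nlinarith

/-! ### Correctness of the search -/

variable (G) in
/-- The invariant of the search. -/
structure Inv (D X : Finset V) : Prop where
  conn : CutConnected G D
  sub : X ⊆ cl G D
  disj : Disjoint D X

theorem Inv.ins {D X : Finset V} (h : Inv G D X) {v : V} (hv : v ∈ fr G D X) :
    Inv G (insert v D) X := by
  obtain ⟨h1, _, h3⟩ := mem_fr.1 hv
  refine ⟨h.conn.insert_of_mem_cl h1, h.sub.trans (cl_mono (Finset.subset_insert _ _)), ?_⟩
  exact Finset.disjoint_insert_left.2 ⟨h3, h.disj⟩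

theorem Inv.del {D X : Finset V} (h : Inv G D X) {v : V} (hv : v ∈ fr G D X) :
    Inv G D (insert v X) := by
  obtain ⟨h1, h2, _⟩ := mem_fr.1 hv
  refine ⟨h.conn, Finset.insert_subset h1 h.sub, ?_⟩
  exact Finset.disjoint_insert_right.2 ⟨h2, h.disj⟩

/-- A witness of deadness could only be dominated by belonging to `E` itself, where it would be
isolated. Connectivity then forces `E` to be that single vertex, which leaves no room for the
nonempty `D`. -/
theorem not_dead_of_subset {D X E : Finset V} (h : Inv G D X) (hDE : D ⊆ E)
    (hE : IsMinimalCDS G E) (hX : Disjoint E X) : ¬ Dead G D X := by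
  rintro ⟨w, hw, hwX⟩
  rw [mem_und] at hw
  have hcds := isCDS_iff.1 hE.1
  have hno : ∀ u ∈ E, ¬ G.Adj w u := fun u hu hwu =>
    Finset.disjoint_left.1 hX hu (hwX u hwu)
  have hwE : w ∈ E := by
    rcases mem_cl.1 (hcds.1 w) with h | ⟨u, hu, huw⟩
    · exact h
    · exact absurd huw.symm (hno u hu)
  have hsub := hcds.2.2 {w} (by simpa using hwE) ⟨w, by simp⟩ (by
    intro a ha b hb hab
    rw [Finset.mem_singleton] at ha
    subst ha
    exact absurd hab (hno b hb))
  obtain ⟨d, hd⟩ := h.conn.1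
  have := hsub (hDE hd)
  rw [Finset.mem_singleton] at this
  subst this
  exact hw (subset_cl _ hd)

theorem card_compl_insert_left {D X : Finset V} {v : V} (hv : v ∈ fr G D X) :
    (Finset.univ \ (insert v D ∪ X)).card + 1 = (Finset.univ \ (D ∪ X)).card := by
  obtain ⟨_, h2, h3⟩ := mem_fr.1 hv
  have : Finset.univ \ (insert v D ∪ X) = (Finset.univ \ (D ∪ X)).erase v := by
    ext x; simp
  rw [this, Finset.card_erase_add_one]
  simp [h2, h3]

theorem card_compl_insert_right {D X : Finset V} {v : V} (hv : v ∈ fr G D X) :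
    (Finset.univ \ (D ∪ insert v X)).card + 1 = (Finset.univ \ (D ∪ X)).card := by
  rw [← card_compl_insert_left hv]
  congr 3
  ext x; simp

/-- The two children split the target sets according to whether they contain the chosen vertex, so
no set is repeated. The condition on `m` ensures that the depth suffices, since each branching
decides one vertex. -/
theorem found_spec {ch : Finset V → Finset V → V} (hch : IsChoice G ch) (m : ℕ)
    (D X : Finset V) (hI : Inv G D X) (hD : ¬ Redundant G D)
    (hm : (Finset.univ \ (D ∪ X)).card < m) :
    (found G ch m D X).Nodup ∧
      ∀ E, E ∈ found G ch m D X ↔ IsMinimalCDS G E ∧ D ⊆ E ∧ Disjoint E X := by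
  induction m generalizing D X with
  | zero => simp at hm
  | succ m ih =>
    rw [found]
    split_ifs with h1 h2 h3 h4
    · refine ⟨List.nodup_nil, fun E => ⟨by simp, fun ⟨a, b, c⟩ => ?_⟩⟩
      exact absurd h1 (not_dead_of_subset hI b a c)
    · have hall : ∀ v, v ∈ cl G D := fun v => by
        by_contra hv
        simpa [h3] using (mem_und (G := G)).2 hv
      refine ⟨List.nodup_singleton _, fun E => ?_⟩
      rw [List.mem_singleton]
      constructor
      · rintro rfl
        exact ⟨isMinimalCDS_of_not_redundant (isCDS_iff.2 ⟨hall, hI.conn⟩) hD,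
          subset_rfl, hI.disj⟩
      · rintro ⟨hE, hDE, -⟩
        exact Finset.Subset.antisymm (hE.2 (isCDS_iff.2 ⟨hall, hI.conn⟩) hDE) hDE
    · refine ⟨List.nodup_nil, fun E => ⟨by simp, fun ⟨a, b, c⟩ => ?_⟩⟩
      exfalso
      obtain ⟨w, hw⟩ := Finset.nonempty_iff_ne_empty.2 h3
      have hcds := isCDS_iff.1 a.1
      have hDne := hI.conn.1
      -- With an empty frontier, every neighbour of `D` outside `D` is excluded, so a connected `E`
      -- cannot leave `D`.
      have hED : E ⊆ D := by
        refine hcds.2.2 D b hDne ?_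
        intro x hx y hy hxy
        by_contra hyD
        have : y ∈ fr G D X := mem_fr.2
          ⟨mem_cl_of_adj hx hxy, hyD, Finset.disjoint_left.1 c hy⟩
        simp [h2] at this
      exact mem_und.1 hw (cl_mono hED (hcds.1 w))
    all_goals
      have hne := Finset.nonempty_iff_ne_empty.2 h2
      obtain ⟨hv, -⟩ := hch D X hne
      set v := ch D X with hvdef
      have c1 := card_compl_insert_left hv
      have c2 := card_compl_insert_right hv
      have ih2 := ih D (insert v X) (hI.del hv) hD (by omega)
      obtain ⟨hv1, hv2, hv3⟩ := mem_fr.1 hv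
    · refine ⟨by simpa using ih2.1, fun E => ?_⟩
      rw [List.nil_append, ih2.2]
      refine and_congr_right fun hE => and_congr_right fun hDE => ?_
      rw [Finset.disjoint_insert_right]
      refine ⟨fun h => h.2, fun h => ⟨fun hvE => ?_, h⟩⟩
      exact not_isMinimalCDS_of_redundant h4 (Finset.insert_subset hvE hDE) hE
    · have ih1 := ih (insert v D) X (hI.ins hv) h4 (by omega)
      constructor
      · rw [List.nodup_append']
        refine ⟨ih1.1, ih2.1, fun E h5 h6 => ?_⟩
        have h7 := ((ih1.2 E).1 h5).2.1
        have h8 := ((ih2.2 E).1 h6).2.2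
        exact Finset.disjoint_left.1 h8 (h7 (Finset.mem_insert_self v D))
          (Finset.mem_insert_self v X)
      · intro E
        rw [List.mem_append, ih1.2, ih2.2, Finset.insert_subset_iff,
          Finset.disjoint_insert_right]
        tauto

theorem not_redundant_singleton (x : V) : ¬ Redundant G {x} := by
  rintro ⟨v, hv, hc, -⟩
  rw [Finset.mem_singleton] at hv
  subst hv
  simpa using hc.1

theorem inv_singleton (x : V) : Inv G {x} ∅ := by
  refine ⟨⟨⟨x, by simp⟩, fun C hC hne _ => ?_⟩, by simp, by simp⟩
  obtain ⟨c, hc⟩ := hne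
  have := hC hc
  rw [Finset.mem_singleton] at this
  subst this
  simpa using hc

end Graph

end CDSEnum

namespace CDSEnum

/-! ### Weights -/

/-- The weight of a frontier vertex that would newly dominate `k` vertices. -/
noncomputable def yk : ℕ → ℝ
  | 0 => 1
  | 1 => 1.7275
  | 2 => 1.8095
  | _ + 3 => 1.8277

/-- The weight of an undominated vertex with `d` neighbours that are not excluded. -/
noncomputable def bd : ℕ → ℝ
  | 0 => 1.49
  | 1 => 1.49
  | 2 => 1.8794
  | 3 => 1.9686
  | _ + 4 => 1.9884

theorem yk_mono : Monotone yk := by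
  refine monotone_nat_of_le_succ fun n => ?_
  match n with
  | 0 => norm_num [yk]
  | 1 => norm_num [yk]
  | 2 => norm_num [yk]
  | _ + 3 => norm_num [yk]

theorem bd_mono : Monotone bd := by
  refine monotone_nat_of_le_succ fun n => ?_
  match n with
  | 0 => norm_num [bd]
  | 1 => norm_num [bd]
  | 2 => norm_num [bd]
  | 3 => norm_num [bd]
  | _ + 4 => norm_num [bd]

theorem one_le_yk (k : ℕ) : 1 ≤ yk k := by
  have := yk_mono (Nat.zero_le k)
  simpa [yk] using this

theorem yk_le (k : ℕ) : yk k ≤ 1.8277 := by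
  have := yk_mono (Nat.le_add_right k 3)
  simpa [yk] using this

theorem yk_of_three_le {k : ℕ} (h : 3 ≤ k) : yk k = 1.8277 := by
  obtain ⟨j, rfl⟩ := Nat.exists_eq_add_of_le' h
  rfl

theorem le_bd (d : ℕ) : 1.49 ≤ bd d := by
  have := bd_mono (Nat.zero_le d)
  simpa [bd] using this

theorem bd_le (d : ℕ) : bd d ≤ 1.9884 := by
  have := bd_mono (Nat.le_add_right d 4)
  simpa [bd] using this

theorem bd_of_four_le {k : ℕ} (h : 4 ≤ k) : bd k = 1.9884 := by
  obtain ⟨j, rfl⟩ := Nat.exists_eq_add_of_le' h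
  rfl

/-- For positive gains the weights are tuned so that `yk k / bd (k + 1)` is nearly constant, just
below 0.9192. This is the saving on each vertex that becomes dominated. -/
theorem yk_le_bd {k d : ℕ} (h : k + 1 ≤ d) : yk k ≤ 0.9192 * bd d := by
  refine le_trans ?_ (mul_le_mul_of_nonneg_left (bd_mono h) (by norm_num))
  match k with
  | 0 => norm_num [yk, bd]
  | 1 => norm_num [yk, bd]
  | 2 => norm_num [yk, bd]
  | _ + 3 => norm_num [yk, bd]

/-- Every measure estimate has this shape: all weights weakly decrease, and on a few selected
vertices they decrease by known factors. -/
theorem prod_le_mul_prod {ι : Type*} [Fintype ι] [DecidableEq ι] (S : Finset ι)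
    {f g c : ι → ℝ} (hf : ∀ u, 0 ≤ f u) (hS : ∀ u ∈ S, f u ≤ c u * g u)
    (h : ∀ u ∉ S, f u ≤ g u) : ∏ u, f u ≤ (∏ u ∈ S, c u) * ∏ u, g u := by
  have : (∏ u ∈ S, c u) * ∏ u, g u = ∏ u, ((if u ∈ S then c u else 1) * g u) := by
    rw [Finset.prod_mul_distrib, Finset.prod_ite_mem, Finset.univ_inter]
  rw [this]
  refine Finset.prod_le_prod (fun u _ => hf u) fun u _ => ?_
  split_ifs with hu
  · exact hS u hu
  · simpa using h u hu

/-! ### Blocked vertices and the measure -/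

section Measure

variable {V : Type*} [DecidableEq V] [Fintype V] {G : SimpleGraph V} [DecidableRel G.Adj]

variable (G) in
/-- Including `u`, now or later, makes some vertex of `D` redundant. -/
def Blocked (D X : Finset V) (u : V) : Prop :=
  ∃ v ∈ D, CutConnected G (D.erase v) ∧
    (∀ w, w = v ∨ G.Adj v w → w ∈ cl G (insert u (D.erase v))) ∧
    ∀ w, w ∉ X → G.Adj v w → w ∈ cl G (D.erase v)

/-- The last clause of `Blocked` keeps `u` attached to `D.erase v` even if its known dominator was
`v`, because `u` is not excluded. -/
theorem Blocked.redundant {D X : Finset V} {u : V} (h : Blocked G D X u) (hu : u ∈ fr G D X) :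
    Redundant G (insert u D) := by
  obtain ⟨v, hv, hc, h1, h2⟩ := h
  obtain ⟨hu1, hu2, hu3⟩ := mem_fr.1 hu
  have hne : u ≠ v := fun h => hu2 (h ▸ hv)
  have he : (insert u D).erase v = insert u (D.erase v) := Finset.erase_insert_of_ne hne
  refine ⟨v, by simp [hv], ?_, ?_⟩
  · rw [he]
    refine hc.insert_of_mem_cl ?_
    obtain ⟨x, hx, hxu⟩ := exists_adj_of_mem_cl hu1 hu2
    by_cases hxv : x = v
    · exact h2 u hu3 (hxv ▸ hxu)
    · exact mem_cl_of_adj (Finset.mem_erase.2 ⟨hxv, hx⟩) hxu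
  · rw [he]
    exact h1

theorem Blocked.mono_right {D X Y : Finset V} {u : V} (h : Blocked G D X u) (hXY : X ⊆ Y) :
    Blocked G D Y u := by
  obtain ⟨v, hv, hc, h1, h2⟩ := h
  exact ⟨v, hv, hc, h1, fun w hw => h2 w fun h => hw (hXY h)⟩

/-- The witness `v` survives: an included vertex is not excluded, so the last clause attaches it to
the rest without `v`. With monotonicity in `X`, blocked vertices stay blocked down the tree. -/
theorem Blocked.ins {D X : Finset V} {u x : V} (h : Blocked G D X u) (hx : x ∈ fr G D X) :
    Blocked G (insert x D) X u := by
  obtain ⟨v, hv, hc, h1, h2⟩ := h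
  obtain ⟨hx1, hx2, hx3⟩ := mem_fr.1 hx
  have hne : x ≠ v := fun h => hx2 (h ▸ hv)
  have he : (insert x D).erase v = insert x (D.erase v) := Finset.erase_insert_of_ne hne
  refine ⟨v, by simp [hv], ?_, ?_, ?_⟩
  · rw [he]
    refine hc.insert_of_mem_cl ?_
    obtain ⟨z, hz, hzx⟩ := exists_adj_of_mem_cl hx1 hx2
    by_cases hzv : z = v
    · exact h2 x hx3 (hzv ▸ hzx)
    · exact mem_cl_of_adj (Finset.mem_erase.2 ⟨hzv, hz⟩) hzx
  · intro w hw
    rw [he]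
    refine cl_mono ?_ (h1 w hw)
    exact Finset.insert_subset_insert _ (Finset.subset_insert _ _)
  · intro w hw hvw
    rw [he]
    exact cl_mono (Finset.subset_insert _ _) (h2 w hw hvw)

variable (G) in
/-- The weight of a vertex in the state `(D, X)`, where the vertices of `B` are blocked. -/
noncomputable def wt (D X B : Finset V) (u : V) : ℝ :=
  if u ∈ D ∪ X then 1
  else if u ∈ cl G D then (if u ∈ B then 1 else yk (gain G D u))
  else if u ∈ B then 1.49 else bd (dg G X u)

variable (G) in
/-- The measure of the state `(D, X)`, where the vertices of `B` are blocked. -/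
noncomputable def meas (D X B : Finset V) : ℝ := ∏ u, wt G D X B u

theorem one_le_wt (D X B : Finset V) (u : V) : 1 ≤ wt G D X B u := by
  unfold wt
  split_ifs
  · exact le_rfl
  · exact le_rfl
  · exact one_le_yk _
  · norm_num
  · exact le_trans (by norm_num) (le_bd _)

theorem wt_nonneg (D X B : Finset V) (u : V) : 0 ≤ wt G D X B u :=
  zero_le_one.trans (one_le_wt D X B u)

theorem one_le_meas (D X B : Finset V) : 1 ≤ meas G D X B := by
  unfold meas
  calc (1 : ℝ) = ∏ _u : V, (1 : ℝ) := by simp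
    _ ≤ _ := Finset.prod_le_prod (fun _ _ => zero_le_one) fun u _ => one_le_wt D X B u

theorem meas_le (D X B : Finset V) : meas G D X B ≤ 1.9884 ^ Fintype.card V := by
  unfold meas
  calc _ ≤ ∏ _u : V, (1.9884 : ℝ) := by
        refine Finset.prod_le_prod (fun u _ => wt_nonneg D X B u) fun u _ => ?_
        unfold wt
        split_ifs
        · norm_num
        · norm_num
        · exact (yk_le _).trans (by norm_num)
        · norm_num
        · exact bd_le _
    _ = _ := by simp [Finset.card_univ]

theorem wt_fr {D X B : Finset V} {v : V} (hv : v ∈ fr G D X) (hB : v ∉ B) :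
    wt G D X B v = yk (gain G D v) := by
  obtain ⟨h1, h2, h3⟩ := mem_fr.1 hv
  simp [wt, h1, h2, h3, hB]

theorem not_mem_of_mem_und {D X : Finset V} (hI : Inv G D X) {w : V} (hw : w ∈ und G D) :
    w ∉ D ∧ w ∉ X := by
  rw [mem_und] at hw
  exact ⟨fun h => hw (subset_cl _ h), fun h => hw (hI.sub h)⟩

theorem wt_und {D X B : Finset V} (hI : Inv G D X) {w : V} (hw : w ∈ und G D) (hB : w ∉ B) :
    wt G D X B w = bd (dg G X w) := by
  obtain ⟨h1, h2⟩ := not_mem_of_mem_und hI hw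
  rw [mem_und] at hw
  simp [wt, h1, h2, hB, hw]

theorem wt_und_blocked {D X B : Finset V} (hI : Inv G D X) {w : V} (hw : w ∈ und G D)
    (hB : w ∈ B) : wt G D X B w = 1.49 := by
  obtain ⟨h1, h2⟩ := not_mem_of_mem_und hI hw
  rw [mem_und] at hw
  simp [wt, h1, h2, hB, hw]

theorem und_insert {D : Finset V} {v : V} (hv : v ∈ cl G D) :
    und G (insert v D) = (und G D).filter fun w => ¬ G.Adj v w := by
  ext w
  simp only [mem_und, mem_cl_insert, Finset.mem_filter]
  have : w = v → w ∈ cl G D := fun h => h ▸ hv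
  tauto

theorem gain_insert_le {D : Finset V} {v w : V} (hv : v ∈ cl G D) :
    gain G (insert v D) w ≤ gain G D w := by
  unfold gain
  rw [und_insert hv]
  exact Finset.card_le_card (Finset.filter_subset_filter _ (Finset.filter_subset _ _))

theorem gain_insert_lt {D : Finset V} {v w x : V} (hv : v ∈ cl G D) (hw : w ∈ und G D)
    (hvw : G.Adj v w) (hxw : G.Adj x w) : gain G (insert v D) x + 1 ≤ gain G D x := by
  unfold gain
  rw [und_insert hv, Nat.succ_le_iff]
  refine Finset.card_lt_card ((Finset.ssubset_iff_of_subset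
    (Finset.filter_subset_filter _ (Finset.filter_subset _ _))).2 ⟨w, ?_, ?_⟩)
  · simp [hw, hxw]
  · simp [hvw]

theorem dg_insert_le {X : Finset V} {v w : V} : dg G (insert v X) w ≤ dg G X w := by
  unfold dg
  refine Finset.card_le_card fun u => ?_
  simp only [Finset.mem_filter, Finset.mem_insert]
  tauto

theorem dg_insert {X : Finset V} {v w : V} (hv : v ∉ X) (h : G.Adj w v) :
    dg G (insert v X) w + 1 = dg G X w := by
  unfold dg
  have : (Finset.univ.filter fun u => G.Adj w u ∧ u ∉ insert v X) =
      (Finset.univ.filter fun u => G.Adj w u ∧ u ∉ X).erase v := by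
    ext u
    simp only [Finset.mem_filter, Finset.mem_insert, Finset.mem_erase]
    tauto
  rw [this, Finset.card_erase_add_one]
  simp [hv, h]

/-- The vertices newly dominated by `w` are available neighbours of `w`, and `v` is one more
available neighbour that is not among them. This links the two weight scales when `w` becomes
dominated. -/
theorem gain_lt_dg {D X : Finset V} (hI : Inv G D X) {v w : V} (hv : v ∈ fr G D X)
    (hvw : G.Adj v w) : gain G (insert v D) w + 1 ≤ dg G X w := by
  obtain ⟨h1, _, h3⟩ := mem_fr.1 hv
  rw [← dg_insert h3 hvw.symm]
  refine Nat.succ_le_succ (Finset.card_le_card fun u => ?_)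
  simp only [Finset.mem_filter, Finset.mem_univ, true_and, Finset.mem_insert]
  rintro ⟨hu, hwu⟩
  refine ⟨hwu, ?_⟩
  rintro (rfl | h)
  · rw [mem_und] at hu
    exact hu (subset_cl _ (by simp))
  · exact (not_mem_of_mem_und (hI.ins hv) hu).2 h

theorem wt_ins_le {D X B : Finset V} (hI : Inv G D X) {v : V} (hv : v ∈ fr G D X) (u : V) :
    wt G (insert v D) X B u ≤ wt G D X B u := by
  obtain ⟨h1, h2, h3⟩ := mem_fr.1 hv
  by_cases hu : u ∈ insert v D ∪ X
  · rw [wt, if_pos hu]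
    exact one_le_wt _ _ _ _
  have hu' : u ∉ D ∪ X := fun h => hu (by
    simp only [Finset.mem_union, Finset.mem_insert] at h ⊢; tauto)
  rw [wt, wt, if_neg hu, if_neg hu']
  by_cases hc : u ∈ cl G D
  · rw [if_pos hc, if_pos (cl_mono (Finset.subset_insert _ _) hc)]
    split_ifs
    · exact le_rfl
    · exact yk_mono (gain_insert_le h1)
  · rw [if_neg hc]
    by_cases hc' : u ∈ cl G (insert v D)
    · rw [if_pos hc']
      split_ifs
      · norm_num
      · have hvu : G.Adj v u := by
          rcases mem_cl_insert.1 hc' with h | rfl | h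
          · exact absurd h hc
          · exact absurd h1 hc
          · exact h
        refine (yk_le_bd (gain_lt_dg hI hv hvu)).trans ?_
        have := le_bd (dg G X u)
        linarith
    · rw [if_neg hc']

theorem wt_del_le {D X B B' : Finset V} (hB : B ⊆ B') {v : V} (u : V) :
    wt G D (insert v X) B' u ≤ wt G D X B u := by
  by_cases hu : u ∈ D ∪ insert v X
  · rw [wt, if_pos hu]
    exact one_le_wt _ _ _ _
  have hu' : u ∉ D ∪ X := fun h => hu (by
    simp only [Finset.mem_union, Finset.mem_insert] at h ⊢; tauto)
  rw [wt, wt, if_neg hu, if_neg hu']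
  by_cases hc : u ∈ cl G D
  · rw [if_pos hc, if_pos hc]
    split_ifs with h1 h2 h2
    · exact le_rfl
    · exact one_le_yk _
    · exact absurd (hB h2) h1
    · exact le_rfl
  · rw [if_neg hc, if_neg hc]
    split_ifs with h1 h2 h2
    · exact le_rfl
    · exact le_bd _
    · exact absurd (hB h2) h1
    · exact bd_mono dg_insert_le

theorem wt_ins_self (D X B : Finset V) (v : V) : wt G (insert v D) X B v = 1 := by
  simp [wt]

theorem wt_del_self (D X B : Finset V) (v : V) : wt G D (insert v X) B v = 1 := by
  simp [wt]

theorem fr_insert_of_und {D X : Finset V} (hI : Inv G D X) {v w : V}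
    (hw : w ∈ und G D) (hvw : G.Adj v w) : w ∈ fr G (insert v D) X := by
  obtain ⟨h1, h2⟩ := not_mem_of_mem_und hI hw
  refine mem_fr.2 ⟨mem_cl_of_adj (by simp) hvw, ?_, h2⟩
  simp only [Finset.mem_insert, not_or]
  exact ⟨hvw.ne', h1⟩

theorem wt_ins_und {D X B : Finset V} (hI : Inv G D X) {v w : V} (hv : v ∈ fr G D X)
    (hw : w ∈ und G D) (hvw : G.Adj v w) :
    wt G (insert v D) X B w ≤ 0.9192 * wt G D X B w := by
  have hf := fr_insert_of_und hI hw hvw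
  by_cases hB : w ∈ B
  · rw [wt_und_blocked hI hw hB]
    obtain ⟨h1, h2, h3⟩ := mem_fr.1 hf
    rw [wt, if_neg (by simp only [Finset.mem_union]; tauto), if_pos h1, if_pos hB]
    norm_num
  · rw [wt_und hI hw hB, wt_fr hf hB]
    exact yk_le_bd (gain_lt_dg hI hv hvw)

theorem wt_ins_blocked {D X B : Finset V} (hI : Inv G D X) {v w : V}
    (hw : w ∈ und G D) (hvw : G.Adj v w) (hB : w ∈ B) :
    wt G (insert v D) X B w ≤ 0.6712 * wt G D X B w := by
  have hf := fr_insert_of_und hI hw hvw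
  rw [wt_und_blocked hI hw hB]
  obtain ⟨h1, h2, h3⟩ := mem_fr.1 hf
  rw [wt, if_neg (by simp only [Finset.mem_union]; tauto), if_pos h1, if_pos hB]
  norm_num

theorem meas_le_one {D X B D' X' B' : Finset V} {a : V} {ca : ℝ}
    (h : ∀ u, wt G D' X' B' u ≤ wt G D X B u)
    (ha : wt G D' X' B' a ≤ ca * wt G D X B a) :
    meas G D' X' B' ≤ ca * meas G D X B := by
  have := prod_le_mul_prod {a} (f := wt G D' X' B') (g := wt G D X B) (c := fun _ => ca)
    (wt_nonneg _ _ _) (by simpa using ha) (fun u _ => h u)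
  simpa [meas] using this

theorem meas_le_two {D X B D' X' B' : Finset V} {a b : V} {ca cb : ℝ}
    (h : ∀ u, wt G D' X' B' u ≤ wt G D X B u) (hab : a ≠ b)
    (ha : wt G D' X' B' a ≤ ca * wt G D X B a) (hb : wt G D' X' B' b ≤ cb * wt G D X B b) :
    meas G D' X' B' ≤ ca * cb * meas G D X B := by
  have := prod_le_mul_prod {a, b} (f := wt G D' X' B') (g := wt G D X B)
    (c := fun u => if u = a then ca else cb) (wt_nonneg _ _ _)
    (by
      intro u hu
      simp only [Finset.mem_insert, Finset.mem_singleton] at hu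
      rcases hu with rfl | rfl
      · simpa using ha
      · simpa [hab.symm] using hb) (fun u _ => h u)
  simpa [meas, Finset.prod_pair hab, hab.symm] using this

theorem meas_le_three {D X B D' X' B' : Finset V} {a b c : V} {ca cb cc : ℝ}
    (h : ∀ u, wt G D' X' B' u ≤ wt G D X B u) (hab : a ≠ b) (hac : a ≠ c) (hbc : b ≠ c)
    (ha : wt G D' X' B' a ≤ ca * wt G D X B a) (hb : wt G D' X' B' b ≤ cb * wt G D X B b)
    (hc : wt G D' X' B' c ≤ cc * wt G D X B c) :
    meas G D' X' B' ≤ ca * cb * cc * meas G D X B := by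
  have := prod_le_mul_prod {a, b, c} (f := wt G D' X' B') (g := wt G D X B)
    (c := fun u => if u = a then ca else if u = b then cb else cc) (wt_nonneg _ _ _)
    (by
      intro u hu
      simp only [Finset.mem_insert, Finset.mem_singleton] at hu
      rcases hu with rfl | rfl | rfl
      · simpa using ha
      · simpa [hab.symm] using hb
      · simpa [hac.symm, hbc.symm] using hc) (fun u _ => h u)
  rw [Finset.prod_insert (by simp [hab, hac]), Finset.prod_pair hbc] at this
  simpa [meas, hab.symm, hac.symm, hbc.symm, mul_assoc] using this

theorem meas_le_four {D X B D' X' B' : Finset V} {a b c d : V} {ca cb cc cd : ℝ}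
    (h : ∀ u, wt G D' X' B' u ≤ wt G D X B u) (hab : a ≠ b) (hac : a ≠ c) (had : a ≠ d)
    (hbc : b ≠ c) (hbd : b ≠ d) (hcd : c ≠ d)
    (ha : wt G D' X' B' a ≤ ca * wt G D X B a) (hb : wt G D' X' B' b ≤ cb * wt G D X B b)
    (hc : wt G D' X' B' c ≤ cc * wt G D X B c) (hd : wt G D' X' B' d ≤ cd * wt G D X B d) :
    meas G D' X' B' ≤ ca * cb * cc * cd * meas G D X B := by
  have := prod_le_mul_prod {a, b, c, d} (f := wt G D' X' B') (g := wt G D X B)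
    (c := fun u => if u = a then ca else if u = b then cb else if u = c then cc else cd)
    (wt_nonneg _ _ _)
    (by
      intro u hu
      simp only [Finset.mem_insert, Finset.mem_singleton] at hu
      rcases hu with rfl | rfl | rfl | rfl
      · simpa using ha
      · simpa [hab.symm] using hb
      · simpa [hac.symm, hbc.symm] using hc
      · simpa [had.symm, hbd.symm, hcd.symm] using hd) (fun u _ => h u)
  rw [Finset.prod_insert (by simp [hab, hac, had]), Finset.prod_insert (by simp [hbc, hbd]),
    Finset.prod_pair hcd] at this
  simpa [meas, hab.symm, hac.symm, hbc.symm, had.symm, hbd.symm, hcd.symm, mul_assoc] using this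

end Measure

end CDSEnum

/-! ### Leaf bounds for the induction -/

namespace CDSEnum

section Measure

variable {V : Type*} [DecidableEq V] [Fintype V] {G : SimpleGraph V} [DecidableRel G.Adj]

theorem wt_le_meas (D X B : Finset V) (u : V) : wt G D X B u ≤ meas G D X B := by
  unfold meas
  rw [← Finset.mul_prod_erase Finset.univ _ (Finset.mem_univ u)]
  refine le_mul_of_one_le_right (wt_nonneg _ _ _ _) ?_
  calc (1 : ℝ) = ∏ _u ∈ Finset.univ.erase u, (1 : ℝ) := by simp
    _ ≤ _ := Finset.prod_le_prod (fun _ _ => zero_le_one) fun u _ => one_le_wt D X B u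

theorem leaves_of_dead {ch : Finset V → Finset V → V} {m : ℕ} {D X : Finset V}
    (h : Dead G D X) : leaves G ch m D X = 0 := by
  cases m with
  | zero => rfl
  | succ m => rw [leaves, if_pos h]

/-- The premise `1 ≤ c * M` pays for the `max 1` in `leaves`, that is, for a live node without live
children. The bound on the including child is needed only if that child is not pruned. -/
theorem leaves_le_of_children {ch : Finset V → Finset V → V} {m : ℕ} {D X : Finset V}
    {ci co c M : ℝ} (hfr : (fr G D X).Nonempty)
    (hin : ¬ Redundant G (insert (ch D X) D) →
      (leaves G ch m (insert (ch D X) D) X : ℝ) ≤ ci * M)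
    (hout : (leaves G ch m D (insert (ch D X) X) : ℝ) ≤ co * M)
    (hci : 0 ≤ ci) (hM : 0 ≤ M) (hc : ci + co ≤ c) (h1 : 1 ≤ c * M) :
    (leaves G ch (m + 1) D X : ℝ) ≤ c * M := by
  have h0 : 0 ≤ ci * M := mul_nonneg hci hM
  have h2 : ci * M + co * M ≤ c * M := by
    rw [← add_mul]
    exact mul_le_mul_of_nonneg_right hc hM
  rw [leaves]
  split_ifs with hd he hr
  · simpa using zero_le_one.trans h1
  · exact absurd he (Finset.nonempty_iff_ne_empty.1 hfr)
  · rw [zero_add]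
    push_cast
    exact max_le h1 (by linarith)
  · push_cast
    exact max_le h1 (by linarith [hin hr])

theorem redundant_of_gain_eq_zero {D X : Finset V} (hI : Inv G D X) {v : V}
    (hv : v ∈ fr G D X) (h : gain G D v = 0) : Redundant G (insert v D) := by
  obtain ⟨h1, h2, h3⟩ := mem_fr.1 hv
  refine ⟨v, by simp, ?_⟩
  rw [Finset.erase_insert h2]
  refine ⟨hI.conn, ?_⟩
  rintro w (rfl | hw)
  · exact h1
  · by_contra hwc
    have : w ∈ (und G D).filter (G.Adj v) := Finset.mem_filter.2 ⟨mem_und.2 hwc, hw⟩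
    rw [Finset.card_eq_zero.1 h] at this
    simp at this

theorem dead_of_dg_eq_zero {D X : Finset V} {w : V} (hw : w ∈ und G D) (h : dg G X w = 0) :
    Dead G D X := by
  refine ⟨w, hw, fun u hu => ?_⟩
  by_contra hX
  have : u ∈ Finset.univ.filter fun u => G.Adj w u ∧ u ∉ X := by simp [hu, hX]
  rw [Finset.card_eq_zero.1 h] at this
  simp at this

/-- An available neighbour of `w` is either undominated or in the frontier, since a neighbour in `D`
would dominate `w`. By `honly`, only `v` is of the second kind. -/
theorem dg_eq_gain_add_one {D X : Finset V} (hI : Inv G D X) {v w : V} (hv : v ∈ fr G D X)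
    (hw : w ∈ und G D) (hvw : G.Adj v w) (honly : ∀ x ∈ fr G D X, G.Adj x w → x = v) :
    dg G X w = gain G D w + 1 := by
  obtain ⟨h1, h2, h3⟩ := mem_fr.1 hv
  have : (Finset.univ.filter fun u => G.Adj w u ∧ u ∉ X) =
      insert v ((und G D).filter (G.Adj w)) := by
    ext u
    simp only [Finset.mem_filter, Finset.mem_univ, true_and, Finset.mem_insert]
    constructor
    · rintro ⟨hwu, huX⟩
      by_cases hu : u ∈ cl G D
      · left
        refine honly u (mem_fr.2 ⟨hu, fun huD => ?_, huX⟩) hwu.symm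
        exact mem_und.1 hw (mem_cl_of_adj huD hwu.symm)
      · exact Or.inr ⟨mem_und.2 hu, hwu⟩
    · rintro (rfl | ⟨hu, hwu⟩)
      · exact ⟨hvw.symm, h3⟩
      · exact ⟨hwu, (not_mem_of_mem_und hI hu).2⟩
  rw [dg, this, Finset.card_insert_of_notMem, gain]
  simp [mem_und, h1]

theorem wt_self_coeff {D X B : Finset V} {v : V} (hv : v ∈ fr G D X) (hB : v ∉ B) :
    (1 : ℝ) ≤ (yk (gain G D v))⁻¹ * wt G D X B v := by
  rw [wt_fr hv hB, inv_mul_cancel₀]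
  linarith [one_le_yk (gain G D v)]

theorem meas_del_le {D X B : Finset V} {v : V} (hv : v ∈ fr G D X)
    (hB : v ∉ B) : meas G D (insert v X) B ≤ (yk (gain G D v))⁻¹ * meas G D X B := by
  refine meas_le_one (a := v) (wt_del_le subset_rfl) ?_
  rw [wt_del_self]
  exact wt_self_coeff hv hB

theorem meas_del_le_self {D X B : Finset V} {v : V} :
    meas G D (insert v X) B ≤ meas G D X B :=
  Finset.prod_le_prod (fun u _ => wt_nonneg _ _ _ u) fun u _ => wt_del_le subset_rfl u

/-- If at least three vertices become dominated, each of them lowers the measure. -/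
theorem meas_ins_le_of_three_le {D X B : Finset V} (hI : Inv G D X) {v : V}
    (hv : v ∈ fr G D X) (hB : v ∉ B) (h3 : 3 ≤ gain G D v) :
    meas G (insert v D) X B ≤ 1.8277⁻¹ * 0.9192 ^ 3 * meas G D X B := by
  obtain ⟨S, hS, hcard⟩ := Finset.exists_subset_card_eq h3
  have hSu : ∀ u ∈ S, u ∈ und G D ∧ G.Adj v u := fun u hu => Finset.mem_filter.1 (hS hu)
  have hvS : v ∉ S := fun h => (hSu v h).2.ne rfl
  have := prod_le_mul_prod (insert v S) (f := wt G (insert v D) X B) (g := wt G D X B)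
    (c := fun u => if u = v then 1.8277⁻¹ else 0.9192) (wt_nonneg _ _ _)
    (by
      intro u hu
      rcases Finset.mem_insert.1 hu with rfl | hu
      · have := wt_self_coeff hv hB
        rw [yk_of_three_le h3] at this
        simpa [wt_ins_self] using this
      · have hne : u ≠ v := fun h => hvS (h ▸ hu)
        simpa [hne] using wt_ins_und hI hv (hSu u hu).1 (hSu u hu).2)
    (fun u _ => wt_ins_le hI hv u)
  rw [Finset.prod_insert hvS] at this
  have h2 : ∏ u ∈ S, (if u = v then (1.8277⁻¹ : ℝ) else 0.9192) = 0.9192 ^ 3 := by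
    rw [← hcard, ← Finset.prod_const]
    refine Finset.prod_congr rfl fun u hu => ?_
    rw [if_neg fun h : u = v => hvS (h ▸ hu)]
  rw [h2, if_pos rfl] at this
  exact this

variable (G) in
/-- The bounds on the number of leaves that are proved by induction. -/
structure Bound (ch : Finset V → Finset V → V) (m : ℕ) (D X B : Finset V) : Prop where
  basic : (leaves G ch m D X : ℝ) ≤ meas G D X B
  large : ∀ w ∈ fr G D X, w ∉ B → 3 ≤ gain G D w →
    (leaves G ch m D X : ℝ) ≤ 0.9721 * meas G D X B
  large_two : ∀ w ∈ fr G D X, ∀ w' ∈ fr G D X, w ≠ w' → w ∉ B → w' ∉ B → 3 ≤ gain G D w →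
    3 ≤ gain G D w' → (leaves G ch m D X : ℝ) ≤ 0.9569 * meas G D X B
  unique : ∀ w ∈ fr G D X, w ∉ B → 2 ≤ gain G D w →
    (∀ x ∈ fr G D X, x ≠ w → gain G D x ≤ 1) →
    (∀ u ∈ und G D, G.Adj w u → Blocked G D (insert w X) u) →
    (leaves G ch m D X : ℝ) * yk (gain G D w) ≤
      (0.9192 ^ ((und G D).filter fun u => G.Adj w u ∧ u ∉ B).card *
        0.6712 ^ ((und G D).filter fun u => G.Adj w u ∧ u ∈ B).card +
        0.7929 ^ ((und G D).filter fun u => G.Adj w u ∧ u ∉ B).card) * meas G D X B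

theorem Bound.of_leaves_eq_zero {ch : Finset V → Finset V → V} {m : ℕ} {D X B : Finset V}
    (h : leaves G ch m D X = 0) : Bound G ch m D X B := by
  have hM := zero_le_one.trans (one_le_meas (G := G) D X B)
  constructor
  · simpa [h] using hM
  · intros; rw [h]; push_cast; positivity
  · intros; rw [h]; push_cast; positivity
  · intros; rw [h]; simp only [Nat.cast_zero, zero_mul]; positivity

variable (G) in
/-- The induction hypothesis. -/
def AllBounds (ch : Finset V → Finset V → V) (m : ℕ) : Prop :=
  ∀ D X B, Inv G D X → (∀ u ∈ B, Blocked G D X u) → Bound G ch m D X B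

variable {ch : Finset V → Finset V → V} {m : ℕ} {D X B : Finset V}

theorem AllBounds.ins (h : AllBounds G ch m) (hI : Inv G D X)
    (hB : ∀ u ∈ B, Blocked G D X u) {v : V} (hv : v ∈ fr G D X) :
    Bound G ch m (insert v D) X B :=
  h _ _ _ (hI.ins hv) fun u hu => (hB u hu).ins hv

theorem AllBounds.del (h : AllBounds G ch m) (hI : Inv G D X)
    (hB : ∀ u ∈ B, Blocked G D X u) {v : V} (hv : v ∈ fr G D X) :
    Bound G ch m D (insert v X) B :=
  h _ _ _ (hI.del hv) fun u hu => (hB u hu).mono_right (Finset.subset_insert _ _)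

theorem meas_nonneg (D X B : Finset V) : 0 ≤ meas G D X B :=
  zero_le_one.trans (one_le_meas D X B)

/-- The constant is `(1 + 0.9192 ^ 3) / 1.8277`, rounded up. -/
theorem leaves_large (h : AllBounds G ch m) (hI : Inv G D X)
    (hB : ∀ u ∈ B, Blocked G D X u) (hv : ch D X ∈ fr G D X) (hvB : ch D X ∉ B)
    (h3 : 3 ≤ gain G D (ch D X)) :
    (leaves G ch (m + 1) D X : ℝ) ≤ 0.9721 * meas G D X B := by
  have hin := meas_ins_le_of_three_le (X := X) hI hv hvB h3
  have hout := meas_del_le hv hvB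
  rw [yk_of_three_le h3] at hout
  have h1 := wt_le_meas (G := G) D X B (ch D X)
  rw [wt_fr hv hvB, yk_of_three_le h3] at h1
  refine leaves_le_of_children (ci := 1.8277⁻¹ * 0.9192 ^ 3) (co := 1.8277⁻¹) ⟨_, hv⟩
    (fun _ => ((h.ins hI hB hv).basic).trans hin) (((h.del hI hB hv).basic).trans hout)
    (by norm_num) (meas_nonneg _ _ _) (by norm_num) (by linarith)

/-- The second large vertex stays in the frontier when the chosen one is excluded, so that child
also gains the factor 0.9721. The constant rounds up `(0.9721 + 0.9192 ^ 3) / 1.8277`. -/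
theorem leaves_large_two (h : AllBounds G ch m) (hI : Inv G D X)
    (hB : ∀ u ∈ B, Blocked G D X u) (hv : ch D X ∈ fr G D X) (hvB : ch D X ∉ B)
    (h3 : 3 ≤ gain G D (ch D X)) {w : V} (hw : w ∈ fr G D X) (hwv : w ≠ ch D X)
    (hwB : w ∉ B) (hw3 : 3 ≤ gain G D w) :
    (leaves G ch (m + 1) D X : ℝ) ≤ 0.9569 * meas G D X B := by
  have hin := meas_ins_le_of_three_le (X := X) hI hv hvB h3
  have hout := meas_del_le hv hvB
  rw [yk_of_three_le h3] at hout
  have h1 := wt_le_meas (G := G) D X B (ch D X)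
  rw [wt_fr hv hvB, yk_of_three_le h3] at h1
  obtain ⟨hw1, hw2, hw4⟩ := mem_fr.1 hw
  have hw' : w ∈ fr G D (insert (ch D X) X) := mem_fr.2 ⟨hw1, hw2, by simp [hwv, hw4]⟩
  have hl := (h.del hI hB hv).large w hw' hwB hw3
  refine leaves_le_of_children (ci := 1.8277⁻¹ * 0.9192 ^ 3) (co := 0.9721 * 1.8277⁻¹) ⟨_, hv⟩
    (fun _ => ((h.ins hI hB hv).basic).trans hin) (hl.trans ?_)
    (by norm_num) (meas_nonneg _ _ _) (by norm_num) (by linarith)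
  rw [mul_assoc]
  exact mul_le_mul_of_nonneg_left hout (by norm_num)

theorem meas_ins_le_pow (hI : Inv G D X) {v : V} (hv : v ∈ fr G D X) (hvB : v ∉ B) :
    meas G (insert v D) X B ≤ (yk (gain G D v))⁻¹ *
      (0.9192 ^ ((und G D).filter fun u => G.Adj v u ∧ u ∉ B).card *
        0.6712 ^ ((und G D).filter fun u => G.Adj v u ∧ u ∈ B).card) * meas G D X B := by
  have hv1 : v ∉ und G D := fun h => mem_und.1 h (mem_fr.1 hv).1
  set S := (und G D).filter fun u => G.Adj v u ∧ u ∉ B with hS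
  set S' := (und G D).filter fun u => G.Adj v u ∧ u ∈ B with hS'
  have hdis : Disjoint S S' := by
    rw [Finset.disjoint_left]
    intro u hu hu'
    exact (Finset.mem_filter.1 hu).2.2 (Finset.mem_filter.1 hu').2.2
  have hvS : v ∉ S ∪ S' := by
    simp only [Finset.mem_union, hS, hS', Finset.mem_filter]
    tauto
  have := prod_le_mul_prod (insert v (S ∪ S')) (f := wt G (insert v D) X B) (g := wt G D X B)
    (c := fun u => if u = v then (yk (gain G D v))⁻¹ else if u ∈ B then 0.6712 else 0.9192)
    (wt_nonneg _ _ _)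
    (by
      intro u hu
      rcases Finset.mem_insert.1 hu with rfl | hu
      · simpa [wt_ins_self] using wt_self_coeff hv hvB
      · have hne : u ≠ v := fun h => hvS (h ▸ hu)
        rcases Finset.mem_union.1 hu with hu | hu
        · obtain ⟨h1, h2, h3⟩ := Finset.mem_filter.1 hu
          simpa [hne, h3] using wt_ins_und hI hv h1 h2
        · obtain ⟨h1, h2, h3⟩ := Finset.mem_filter.1 hu
          simpa [hne, h3] using wt_ins_blocked hI h1 h2 h3)
    (fun u _ => wt_ins_le hI hv u)
  rw [Finset.prod_insert hvS, Finset.prod_union hdis] at this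
  have h2 : ∏ u ∈ S, (if u = v then (yk (gain G D v))⁻¹ else if u ∈ B then (0.6712 : ℝ)
      else 0.9192) = 0.9192 ^ S.card := by
    rw [← Finset.prod_const]
    refine Finset.prod_congr rfl fun u hu => ?_
    rw [if_neg fun h : u = v => hvS (h ▸ Finset.mem_union_left _ hu),
      if_neg (Finset.mem_filter.1 hu).2.2]
  have h3 : ∏ u ∈ S', (if u = v then (yk (gain G D v))⁻¹ else if u ∈ B then (0.6712 : ℝ)
      else 0.9192) = 0.6712 ^ S'.card := by
    rw [← Finset.prod_const]
    refine Finset.prod_congr rfl fun u hu => ?_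
    rw [if_neg fun h : u = v => hvS (h ▸ Finset.mem_union_right _ hu),
      if_pos (Finset.mem_filter.1 hu).2.2]
  rw [h2, h3, if_pos rfl] at this
  exact this

/-- Excluding `v` blocks its undominated neighbours, so the child is measured with an enlarged set
of blocked vertices. This is why the induction hypothesis allows any `B` consisting of blocked
vertices. -/
theorem leaves_del_blocking (h : AllBounds G ch m) (hI : Inv G D X)
    (hB : ∀ u ∈ B, Blocked G D X u) {v : V} (hv : v ∈ fr G D X) (hvB : v ∉ B)
    (hbl : ∀ u ∈ und G D, G.Adj v u → Blocked G D (insert v X) u) :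
    (leaves G ch m D (insert v X) : ℝ) ≤ (yk (gain G D v))⁻¹ *
      0.7929 ^ ((und G D).filter fun u => G.Adj v u ∧ u ∉ B).card * meas G D X B := by
  have hv1 : v ∉ und G D := fun h => mem_und.1 h (mem_fr.1 hv).1
  have hvX := (mem_fr.1 hv).2.2
  have hy := one_le_yk (gain G D v)
  have hM := meas_nonneg (G := G) D X B
  by_cases hd : Dead G D (insert v X)
  · rw [leaves_of_dead hd]
    push_cast
    positivity
  set S := (und G D).filter fun u => G.Adj v u ∧ u ∉ B with hS
  have hvS : v ∉ S := fun h => hv1 (Finset.mem_filter.1 h).1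
  have hb := (h D (insert v X) (B ∪ S) (hI.del hv) (by
    intro u hu
    rcases Finset.mem_union.1 hu with hu | hu
    · exact (hB u hu).mono_right (Finset.subset_insert _ _)
    · obtain ⟨h1, h2, -⟩ := Finset.mem_filter.1 hu
      exact hbl u h1 h2)).basic
  refine hb.trans ?_
  have := prod_le_mul_prod (insert v S) (f := wt G D (insert v X) (B ∪ S)) (g := wt G D X B)
    (c := fun u => if u = v then (yk (gain G D v))⁻¹ else 0.7929)
    (wt_nonneg _ _ _)
    (by
      intro u hu
      rcases Finset.mem_insert.1 hu with rfl | hu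
      · simpa [wt_del_self] using wt_self_coeff hv hvB
      · have hne : u ≠ v := fun h => hvS (h ▸ hu)
        obtain ⟨h1, h2, h3⟩ := Finset.mem_filter.1 hu
        have hdg := dg_insert hvX h2.symm
        have h0 : dg G (insert v X) u ≠ 0 := fun h => hd (dead_of_dg_eq_zero h1 h)
        -- The child is not dead, so `u` keeps an available neighbour after losing `v` and had at
        -- least two before. The factor 0.7929 comes from `1.49 / 1.8794`.
        have h4 : bd 2 ≤ bd (dg G X u) := bd_mono (by omega)
        rw [if_neg hne, wt_und hI h1 h3,
          wt_und_blocked (hI.del hv) h1 (Finset.mem_union_right _ hu)]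
        rw [show bd 2 = 1.8794 from rfl] at h4
        linarith)
    (fun u _ => wt_del_le Finset.subset_union_left u)
  rw [Finset.prod_insert hvS] at this
  have h2 : ∏ u ∈ S, (if u = v then (yk (gain G D v))⁻¹ else (0.7929 : ℝ)) =
      0.7929 ^ S.card := by
    rw [← Finset.prod_const]
    refine Finset.prod_congr rfl fun u hu => ?_
    rw [if_neg fun h : u = v => hvS (h ▸ hu)]
  rw [h2, if_pos rfl] at this
  exact this

theorem leaves_unique (h : AllBounds G ch m) (hI : Inv G D X)
    (hB : ∀ u ∈ B, Blocked G D X u) (hv : ch D X ∈ fr G D X) (hvB : ch D X ∉ B)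
    (hbl : ∀ u ∈ und G D, G.Adj (ch D X) u → Blocked G D (insert (ch D X) X) u) :
    (leaves G ch (m + 1) D X : ℝ) * yk (gain G D (ch D X)) ≤
      (0.9192 ^ ((und G D).filter fun u => G.Adj (ch D X) u ∧ u ∉ B).card *
        0.6712 ^ ((und G D).filter fun u => G.Adj (ch D X) u ∧ u ∈ B).card +
        0.7929 ^ ((und G D).filter fun u => G.Adj (ch D X) u ∧ u ∉ B).card) *
        meas G D X B := by
  have hin := meas_ins_le_pow (X := X) hI hv hvB
  have hout := leaves_del_blocking h hI hB hv hvB hbl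
  have hy := one_le_yk (gain G D (ch D X))
  have hM := meas_nonneg (G := G) D X B
  set p : ℝ := 0.9192 ^ ((und G D).filter fun u => G.Adj (ch D X) u ∧ u ∉ B).card *
        0.6712 ^ ((und G D).filter fun u => G.Adj (ch D X) u ∧ u ∈ B).card with hp
  set q : ℝ := 0.7929 ^ ((und G D).filter fun u => G.Adj (ch D X) u ∧ u ∉ B).card with hq
  have hp0 : 0 ≤ p := by positivity
  have hq0 : 0 ≤ q := by positivity
  set y := yk (gain G D (ch D X))
  -- The including child's measure is at least one; this supplies the lower bound required by
  -- `leaves_le_of_children`.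
  have h1 := (one_le_meas (insert (ch D X) D) X B).trans hin
  have key := leaves_le_of_children (G := G) (ch := ch) (m := m) (D := D) (X := X)
    (ci := y⁻¹ * p) (co := y⁻¹ * q)
    (c := y⁻¹ * (p + q)) ⟨_, hv⟩
    (fun _ => ((h.ins hI hB hv).basic).trans hin) hout (by positivity) hM (by rw [mul_add])
    (h1.trans (by
      refine mul_le_mul_of_nonneg_right ?_ hM
      refine mul_le_mul_of_nonneg_left (by linarith) (by positivity)))
  calc _ ≤ y⁻¹ * (p + q) * meas G D X B * y := by gcongr
    _ = (p + q) * meas G D X B * (y⁻¹ * y) := by ring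
    _ = _ := by rw [inv_mul_cancel₀ (by positivity), mul_one]

/-- The induction step at a node whose vertex cannot be included. -/
theorem bound_of_redundant (h : AllBounds G ch m) (hI : Inv G D X)
    (hB : ∀ u ∈ B, Blocked G D X u) (hv : ch D X ∈ fr G D X)
    (hred : Redundant G (insert (ch D X) D)) : Bound G ch (m + 1) D X B := by
  have hM := meas_nonneg (G := G) D X B
  have hdel := h.del hI hB hv
  have hmd := meas_del_le_self (G := G) (D := D) (X := X) (B := B) (v := ch D X)
  have step : ∀ c : ℝ, (leaves G ch m D (insert (ch D X) X) : ℝ) ≤ c * meas G D X B →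
      1 ≤ c * meas G D X B → (leaves G ch (m + 1) D X : ℝ) ≤ c * meas G D X B :=
    fun c h1 h2 => leaves_le_of_children (ci := 0) ⟨_, hv⟩ (fun h => absurd hred h) h1 le_rfl hM
      (by rw [zero_add]) h2
  -- Pure exclusion steps must preserve the hypotheses of all four bounds, since redundant choices
  -- may be processed before the vertex a bound refers to.
  have keep : ∀ w ∈ fr G D X, w ≠ ch D X → w ∈ fr G D (insert (ch D X) X) := by
    intro w hw hne
    obtain ⟨h1, h2, h3⟩ := mem_fr.1 hw
    exact mem_fr.2 ⟨h1, h2, by simp [hne, h3]⟩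
  have hlow : ∀ w ∈ fr G D X, w ∉ B → 3 ≤ gain G D w → 1.8277 ≤ meas G D X B := by
    intro w hw hwB hw3
    have h1 := wt_le_meas (G := G) D X B w
    rwa [wt_fr hw hwB, yk_of_three_le hw3] at h1
  constructor
  · have := step 1 (by linarith [hdel.basic]) (by linarith [one_le_meas (G := G) D X B])
    linarith
  · intro w hw hwB hw3
    by_cases hwv : w = ch D X
    · subst hwv
      exact leaves_large h hI hB hv hwB hw3
    · have h2 := hdel.large w (keep w hw hwv) hwB hw3
      exact step _ (by linarith) (by linarith [hlow w hw hwB hw3])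
  · intro w hw w' hw' hne hwB hwB' hw3 hw3'
    by_cases hwv : w = ch D X
    · subst hwv
      exact leaves_large_two h hI hB hv hwB hw3 hw' hne.symm hwB' hw3'
    by_cases hwv' : w' = ch D X
    · subst hwv'
      exact leaves_large_two h hI hB hv hwB' hw3' hw hne hwB hw3
    have h2 := hdel.large_two w (keep w hw hwv) w' (keep w' hw' hwv') hne hwB hwB' hw3 hw3'
    exact step _ (by linarith) (by linarith [hlow w hw hwB hw3])
  · intro w hw hwB hw2 huniq hbl
    by_cases hwv : w = ch D X
    · subst hwv
      exact leaves_unique h hI hB hv hwB hbl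
    · have h2 := hdel.unique w (keep w hw hwv) hwB hw2 (fun x hx => huniq x (by
        obtain ⟨a, b, c⟩ := mem_fr.1 hx
        exact mem_fr.2 ⟨a, b, fun h => c (by simp [h])⟩)) (fun u hu hwu =>
          (hbl u hu hwu).mono_right (Finset.insert_subset_insert _ (Finset.subset_insert _ _)))
      have hin := meas_ins_le_pow (X := X) hI hw hwB
      have hy := one_le_yk (gain G D w)
      set y := yk (gain G D w)
      set p : ℝ := 0.9192 ^ ((und G D).filter fun u => G.Adj w u ∧ u ∉ B).card *
        0.6712 ^ ((und G D).filter fun u => G.Adj w u ∧ u ∈ B).card with hp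
      set q : ℝ := 0.7929 ^ ((und G D).filter fun u => G.Adj w u ∧ u ∉ B).card with hq
      have hp0 : 0 ≤ p := by positivity
      have hq0 : 0 ≤ q := by positivity
      have h1 := (one_le_meas (insert w D) X B).trans hin
      have key := step (y⁻¹ * (p + q)) (by
        rw [mul_assoc, ← div_eq_inv_mul, le_div_iff₀ (by positivity)]
        exact h2.trans (by gcongr)) (h1.trans (by
          refine mul_le_mul_of_nonneg_right ?_ hM
          refine mul_le_mul_of_nonneg_left (by linarith) (by positivity)))
      calc _ ≤ y⁻¹ * (p + q) * meas G D X B * y := by gcongr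
        _ = (p + q) * meas G D X B * (y⁻¹ * y) := by ring
        _ = _ := by rw [inv_mul_cancel₀ (by positivity), mul_one]

end Measure

end CDSEnum

/-! ### Branching on vertices of gain one or two -/

namespace CDSEnum

section Measure

variable {V : Type*} [DecidableEq V] [Fintype V] {G : SimpleGraph V} [DecidableRel G.Adj]
variable {ch : Finset V → Finset V → V} {m : ℕ} {D X B : Finset V}

theorem mem_fr_insert {v x : V} (hx : x ∈ fr G D X) (hxv : x ≠ v) :
    x ∈ fr G (insert v D) X := by
  obtain ⟨h1, h2, h3⟩ := mem_fr.1 hx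
  exact mem_fr.2 ⟨cl_mono (Finset.subset_insert _ _) h1, by simp [hxv, h2], h3⟩

theorem wt_ins_other_one {v w x : V} (hv : v ∈ fr G D X) (hx : x ∈ fr G D X) (hxv : x ≠ v)
    (hxB : x ∉ B) (hw : w ∈ und G D) (hvw : G.Adj v w) (hxw : G.Adj x w)
    (hg : gain G D x = 1) : wt G (insert v D) X B x ≤ 1.7275⁻¹ * wt G D X B x := by
  have h1 := gain_insert_lt (mem_fr.1 hv).1 hw hvw hxw
  rw [wt_fr (mem_fr_insert hx hxv) hxB, wt_fr hx hxB, hg,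
    show gain G (insert v D) x = 0 by omega]
  norm_num [yk]

/-- Including `v` takes `w` away from the gain of `x`. The worse ratio is `1.7275 / 1.8095`, when
the gain falls from two to one. -/
theorem wt_ins_other {v w x : V} (hv : v ∈ fr G D X) (hx : x ∈ fr G D X) (hxv : x ≠ v)
    (hxB : x ∉ B) (hw : w ∈ und G D) (hvw : G.Adj v w) (hxw : G.Adj x w)
    (hg : gain G D x ≤ 2) : wt G (insert v D) X B x ≤ 0.9547 * wt G D X B x := by
  have h1 := gain_insert_lt (mem_fr.1 hv).1 hw hvw hxw
  rw [wt_fr (mem_fr_insert hx hxv) hxB, wt_fr hx hxB]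
  have h2 : gain G D x = 1 ∨ gain G D x = 2 := by omega
  rcases h2 with h2 | h2 <;> rw [h2] at h1 ⊢
  · rw [show gain G (insert v D) x = 0 by omega]
    norm_num [yk]
  · refine (yk_mono (show gain G (insert v D) x ≤ 1 by omega)).trans ?_
    norm_num [yk]

theorem wt_del_und (hI : Inv G D X) {v w : V} (hv : v ∈ fr G D X) (hw : w ∈ und G D)
    (hvw : G.Adj v w) (hwB : w ∉ B) :
    wt G D (insert v X) B w = bd (dg G X w - 1) := by
  rw [wt_und (hI.del hv) hw hwB, ← dg_insert (mem_fr.1 hv).2.2 hvw.symm, Nat.add_sub_cancel]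

theorem leaves_del_le (h : AllBounds G ch m) (hI : Inv G D X)
    (hB : ∀ u ∈ B, Blocked G D X u) {v : V} (hv : v ∈ fr G D X) (hvB : v ∉ B) :
    (leaves G ch m D (insert v X) : ℝ) ≤ (yk (gain G D v))⁻¹ * meas G D X B :=
  (h.del hI hB hv).basic.trans (meas_del_le hv hvB)

/-- Excluding the only frontier neighbour of an undominated vertex. -/
theorem leaves_del_le_bd (h : AllBounds G ch m) (hI : Inv G D X)
    (hB : ∀ u ∈ B, Blocked G D X u) {v w : V} (hv : v ∈ fr G D X) (hvB : v ∉ B)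
    (hw : w ∈ und G D) (hvw : G.Adj v w) (hwB : w ∉ B) {c : ℝ} (hc : 0 ≤ c)
    (hbd : dg G X w ≠ 1 → bd (dg G X w - 1) ≤ c * bd (dg G X w)) :
    (leaves G ch m D (insert v X) : ℝ) ≤ (yk (gain G D v))⁻¹ * c * meas G D X B := by
  have hM := meas_nonneg (G := G) D X B
  have hy := one_le_yk (gain G D v)
  by_cases h1 : dg G X w = 1
  · have h2 := dg_insert (mem_fr.1 hv).2.2 hvw.symm
    rw [leaves_of_dead (dead_of_dg_eq_zero hw (by omega))]
    push_cast
    positivity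
  · refine (h.del hI hB hv).basic.trans
      (meas_le_two (a := v) (b := w) (wt_del_le subset_rfl) hvw.ne ?_ ?_)
    · rw [wt_del_self]
      exact wt_self_coeff hv hvB
    · rw [wt_del_und hI hv hw hvw hwB, wt_und hI hw hwB]
      exact hbd h1

/-- The left side adds the weight left at `w` when `v` is excluded to the two branches at `w` after
`v` is included. From `q = 3` on the expression is monotone in `s` and `t`, so four corners with `s
+ t = 3` suffice. -/
theorem numeric_unique {q s t : ℕ} (hq : 2 ≤ q) (hst : s + t = q) :
    bd q + ((0.9192 : ℝ) ^ s * 0.6712 ^ t + 0.7929 ^ s) ≤ 1.7275 * bd (q + 1) := by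
  rcases hq.eq_or_lt with rfl | hq
  · have : s = 0 ∨ s = 1 ∨ s = 2 := by omega
    rcases this with rfl | rfl | rfl
    · rw [show t = 2 by omega]; norm_num [bd]
    · rw [show t = 1 by omega]; norm_num [bd]
    · rw [show t = 0 by omega]; norm_num [bd]
  · have h1 := bd_le q
    rw [bd_of_four_le (by omega : 4 ≤ q + 1)]
    have hs : ∀ j, j ≤ s → (0.9192 : ℝ) ^ s ≤ 0.9192 ^ j := fun j hj =>
      pow_le_pow_of_le_one (by norm_num) (by norm_num) hj
    have hs' : ∀ j, j ≤ s → (0.7929 : ℝ) ^ s ≤ 0.7929 ^ j := fun j hj =>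
      pow_le_pow_of_le_one (by norm_num) (by norm_num) hj
    have ht : ∀ j, j ≤ t → (0.6712 : ℝ) ^ t ≤ 0.6712 ^ j := fun j hj =>
      pow_le_pow_of_le_one (by norm_num) (by norm_num) hj
    have key : ∀ i j, i ≤ s → j ≤ t → (0.9192 : ℝ) ^ i * 0.6712 ^ j + 0.7929 ^ i ≤ 1.44 →
        (0.9192 : ℝ) ^ s * 0.6712 ^ t + 0.7929 ^ s ≤ 1.44 := by
      intro i j hi hj hij
      have h2 := mul_le_mul (hs i hi) (ht j hj) (by positivity) (by positivity)
      linarith [hs' i hi]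
    suffices (0.9192 : ℝ) ^ s * 0.6712 ^ t + 0.7929 ^ s ≤ 1.44 by linarith
    have : s = 0 ∨ s = 1 ∨ s = 2 ∨ 3 ≤ s := by omega
    rcases this with hs | hs | hs | hs
    · exact key 0 3 (by omega) (by omega) (by norm_num)
    · exact key 1 2 (by omega) (by omega) (by norm_num)
    · exact key 2 1 (by omega) (by omega) (by norm_num)
    · exact key 3 0 (by omega) (by omega) (by norm_num)

theorem filter_adj_und_insert {v w w' : V} (hv : v ∈ cl G D)
    (hvw : ∀ u ∈ und G D, G.Adj v u → u = w ∨ u = w') (p : V → Prop) [DecidablePred p]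
    (hww : ¬ G.Adj w w') :
    (und G (insert v D)).filter (fun u => G.Adj w u ∧ p u) =
      (und G D).filter fun u => G.Adj w u ∧ p u := by
  rw [und_insert hv, Finset.filter_filter]
  refine Finset.filter_congr fun u hu => ?_
  have : G.Adj w u → ¬ G.Adj v u := by
    intro h1 h2
    rcases hvw u hu h2 with rfl | rfl
    · exact h1.ne rfl
    · exact hww h1
  tauto

theorem gain_insert_of_not_adj {v w w' : V} (hv : v ∈ cl G D)
    (hvw : ∀ u ∈ und G D, G.Adj v u → u = w ∨ u = w') (hww : ¬ G.Adj w w') :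
    gain G (insert v D) w = gain G D w := by
  have := filter_adj_und_insert hv hvw (fun _ => True) hww
  simp only [and_true] at this
  rw [gain, this, gain]

theorem gain_insert_of_adj {v w w' : V} (hv : v ∈ cl G D) (hw' : w' ∈ und G D)
    (hvw' : G.Adj v w') (hvw : ∀ u ∈ und G D, G.Adj v u → u = w ∨ u = w')
    (hww : G.Adj w w') : gain G (insert v D) w + 1 = gain G D w := by
  have : (und G (insert v D)).filter (G.Adj w) = ((und G D).filter (G.Adj w)).erase w' := by
    ext u
    rw [und_insert hv]
    simp only [Finset.mem_filter, Finset.mem_erase]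
    constructor
    · rintro ⟨⟨h1, h2⟩, h3⟩
      exact ⟨fun h => h2 (h ▸ hvw'), h1, h3⟩
    · rintro ⟨h1, h2, h3⟩
      refine ⟨⟨h2, fun h => ?_⟩, h3⟩
      rcases hvw u h2 h with rfl | rfl
      · exact h3.ne rfl
      · exact h1 rfl
  rw [gain, this, Finset.card_erase_add_one, gain]
  simp [hw', hww]

/-- All frontier vertices dominate at most one new vertex. -/
theorem leaves_gain_one (h : AllBounds G ch m) (hI : Inv G D X)
    (hB : ∀ u ∈ B, Blocked G D X u) (hv : ch D X ∈ fr G D X)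
    (hnB : ∀ u ∈ fr G D X, u ∉ B) (hg : ∀ u ∈ fr G D X, gain G D u = 1) :
    (leaves G ch (m + 1) D X : ℝ) ≤ 1 * meas G D X B := by
  have hM := meas_nonneg (G := G) D X B
  have hM1 := one_le_meas (G := G) D X B
  have hvB := hnB _ hv
  have hgv := hg _ hv
  have hout := leaves_del_le h hI hB hv hvB
  have hyv : yk (gain G D (ch D X)) = 1.7275 := by rw [hgv]; rfl
  have hself := wt_self_coeff hv hvB
  have hvcl := (mem_fr.1 hv).1
  rw [hyv] at hout hself
  obtain ⟨w, hw⟩ := Finset.card_eq_one.1 hgv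
  have hwm : w ∈ (und G D).filter (G.Adj (ch D X)) := by rw [hw]; simp
  obtain ⟨hwu, hvw⟩ := Finset.mem_filter.1 hwm
  have honlyw : ∀ u ∈ und G D, G.Adj (ch D X) u → u = w := by
    intro u hu hvu
    have : u ∈ (und G D).filter (G.Adj (ch D X)) := Finset.mem_filter.2 ⟨hu, hvu⟩
    rw [hw] at this
    simpa using this
  have hbin := (h.ins hI hB hv)
  -- Another frontier neighbour of `w` also has gain one, so it falls to gain zero and weight one
  -- when `v` is included.
  by_cases hex : ∃ x ∈ fr G D X, x ≠ ch D X ∧ G.Adj x w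
  · obtain ⟨x, hx, hxv, hxw⟩ := hex
    have hxB := hnB x hx
    have hin : meas G (insert (ch D X) D) X B ≤
        1.7275⁻¹ * 0.9192 * 1.7275⁻¹ * meas G D X B := by
      refine meas_le_three (a := ch D X) (b := w) (c := x) (wt_ins_le hI hv) hvw.ne hxv.symm
        hxw.ne' ?_ (wt_ins_und hI hv hwu hvw)
        (wt_ins_other_one hv hx hxv hxB hwu hvw hxw (hg x hx))
      rw [wt_ins_self]
      exact hself
    exact leaves_le_of_children ⟨_, hv⟩ (fun _ => hbin.basic.trans hin) hout (by norm_num) hM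
      (by norm_num) (by linarith)
  by_cases hwB : w ∈ B
  · have hin : meas G (insert (ch D X) D) X B ≤ 1.7275⁻¹ * 0.6712 * meas G D X B := by
      refine meas_le_two (a := ch D X) (b := w) (wt_ins_le hI hv) hvw.ne ?_
        (wt_ins_blocked hI hwu hvw hwB)
      rw [wt_ins_self]
      exact hself
    exact leaves_le_of_children ⟨_, hv⟩ (fun _ => hbin.basic.trans hin) hout (by norm_num) hM
      (by norm_num) (by linarith)
  push Not at hex
  have hdg := dg_eq_gain_add_one hI hv hwu hvw fun x hx hxw => by
    by_contra hne
    exact hex x hx hne hxw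
  have hgw : gain G (insert (ch D X) D) w = gain G D w :=
    gain_insert_of_not_adj (w' := w) hvcl (fun u hu h => Or.inl (honlyw u hu h))
      (fun h => h.ne rfl)
  have hwf := fr_insert_of_und hI hwu hvw
  set q := gain G D w with hq
  have hin : meas G (insert (ch D X) D) X B ≤
      1.7275⁻¹ * (yk q / bd (q + 1)) * meas G D X B := by
    refine meas_le_two (a := ch D X) (b := w) (wt_ins_le hI hv) hvw.ne ?_ ?_
    · rw [wt_ins_self]
      exact hself
    · rw [wt_fr hwf hwB, wt_und hI hwu hwB, hgw, hdg, div_mul_cancel₀]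
      linarith [le_bd (q + 1)]
  have hbq := le_bd (q + 1)
  have hbq' := le_bd q
  have hyq := one_le_yk q
  -- For `q = 0`, excluding `v` leaves `w` without available neighbours, so that child is dead. For
  -- `q = 1`, its weight falls from `bd 2` to `bd 1`, and `0.9192 + 0.7929 ≤ 1.7275`. Larger `q`
  -- requires the bound `unique` in the including child.
  rcases Nat.lt_or_ge q 2 with hq2 | hq2
  · have hout' := leaves_del_le_bd h hI hB hv hvB hwu hvw hwB (c := 0.7929) (by norm_num)
      (fun h1 => by
        rw [hdg, show q = 1 by omega]
        norm_num [bd])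
    rw [hyv] at hout'
    have hin' : meas G (insert (ch D X) D) X B ≤ 1.7275⁻¹ * 0.9192 * meas G D X B := by
      refine hin.trans (mul_le_mul_of_nonneg_right ?_ hM)
      refine mul_le_mul_of_nonneg_left ?_ (by norm_num)
      rw [div_le_iff₀ (by linarith)]
      exact yk_le_bd le_rfl
    exact leaves_le_of_children ⟨_, hv⟩ (fun _ => hbin.basic.trans hin') hout' (by norm_num) hM
      (by norm_num) (by linarith)
  · have hout' := leaves_del_le_bd h hI hB hv hvB hwu hvw hwB (c := bd q / bd (q + 1))
      (by positivity)
      (fun h1 => by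
        rw [hdg, Nat.add_sub_cancel, div_mul_cancel₀]
        linarith)
    rw [hyv] at hout'
    have huni := hbin.unique w hwf hwB (by rw [hgw]; exact hq2) (by
        intro x hx hxw
        obtain ⟨hx1, hx2, hx3⟩ := mem_fr.1 hx
        have hx2' : x ≠ ch D X ∧ x ∉ D := by simpa using hx2
        have hxc : x ∈ cl G D := by
          rcases mem_cl_insert.1 hx1 with h1 | h1 | h1
          · exact h1
          · exact absurd h1 hx2'.1
          · by_contra hxc
            exact hxw (honlyw x (mem_und.2 hxc) h1)
        exact (gain_insert_le hvcl).trans (hg x (mem_fr.2 ⟨hxc, hx2'.2, hx3⟩)).le) (by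
        intro u hu hwu'
        have hvD := (mem_fr.1 hv).2.1
        -- The chosen vertex is the blocking witness: `w` was the only vertex it newly dominated.
        -- Once `w` is excluded and its neighbour `u` included, `u` dominates `w`.
        refine ⟨ch D X, by simp, ?_⟩
        rw [Finset.erase_insert hvD]
        refine ⟨hI.conn, ?_, ?_⟩
        · rintro z (rfl | hz)
          · exact cl_mono (Finset.subset_insert _ _) hvcl
          · by_cases hzc : z ∈ cl G D
            · exact cl_mono (Finset.subset_insert _ _) hzc
            · rw [honlyw z (mem_und.2 hzc) hz]
              exact mem_cl_of_adj (Finset.mem_insert_self _ _) hwu'.symm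
        · intro z hzX hz
          by_contra hzc
          rw [honlyw z (mem_und.2 hzc) hz] at hzX
          simp at hzX)
    rw [hgw] at huni
    set s := ((und G (insert (ch D X) D)).filter fun u => G.Adj w u ∧ u ∉ B).card with hs
    set t := ((und G (insert (ch D X) D)).filter fun u => G.Adj w u ∧ u ∈ B).card with ht
    have hst : s + t = q := by
      rw [← hgw, gain, hs, ht, ← Finset.card_union_of_disjoint]
      · congr 1
        ext u
        simp only [Finset.mem_union, Finset.mem_filter]
        tauto
      · rw [Finset.disjoint_left]
        intro u hu hu'
        exact (Finset.mem_filter.1 hu).2.2 (Finset.mem_filter.1 hu').2.2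
    have hnum := numeric_unique hq2 hst
    set e : ℝ := 0.9192 ^ s * 0.6712 ^ t + 0.7929 ^ s with he
    have he0 : 0 ≤ e := by positivity
    have hin' : (leaves G ch m (insert (ch D X) D) X : ℝ) ≤
        1.7275⁻¹ * (e / bd (q + 1)) * meas G D X B := by
      -- The weight `yk q` that `w` receives on becoming dominated cancels against the `yk` in
      -- `unique`; only `bd (q + 1)` remains.
      have h1 : (leaves G ch m (insert (ch D X) D) X : ℝ) * yk q ≤
          e * (1.7275⁻¹ * (yk q / bd (q + 1)) * meas G D X B) :=
        huni.trans (mul_le_mul_of_nonneg_left hin he0)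
      refine le_of_mul_le_mul_right (h1.trans_eq ?_) (by linarith : 0 < yk q)
      ring
    refine leaves_le_of_children ⟨_, hv⟩ (fun _ => hin') hout' (by positivity) hM
      ?_ (by linarith)
    rw [← mul_add, ← add_div, inv_mul_le_iff₀ (by norm_num), mul_one, div_le_iff₀ (by linarith)]
    linarith

/-- This reduces the gain-two cases to `f * cw * cw' + co ≤ 1.8095`. Here `f` is slack inherited
from the including child, `cw` and `cw'` are weight drops there, and `co` is the extra drop when the
vertex is excluded. -/
theorem leaves_two_children {w w' : V} (hI : Inv G D X) (hv : ch D X ∈ fr G D X) (hvB : ch D X ∉ B)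
    (hgv : gain G D (ch D X) = 2) (hvw : G.Adj (ch D X) w) (hvw' : G.Adj (ch D X) w')
    (hww : w ≠ w') {f cw cw' co : ℝ}
    (hf : (leaves G ch m (insert (ch D X) D) X : ℝ) ≤ f * meas G (insert (ch D X) D) X B)
    (hcw : wt G (insert (ch D X) D) X B w ≤ cw * wt G D X B w)
    (hcw' : wt G (insert (ch D X) D) X B w' ≤ cw' * wt G D X B w')
    (hout : (leaves G ch m D (insert (ch D X) X) : ℝ) ≤ 1.8095⁻¹ * co * meas G D X B)
    (hf0 : 0 ≤ f) (hcw0 : 0 ≤ cw) (hcw0' : 0 ≤ cw') (hsum : f * cw * cw' + co ≤ 1.8095) :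
    (leaves G ch (m + 1) D X : ℝ) ≤ 1 * meas G D X B := by
  have hM := meas_nonneg (G := G) D X B
  have hM1 := one_le_meas (G := G) D X B
  have hin : meas G (insert (ch D X) D) X B ≤ 1.8095⁻¹ * cw * cw' * meas G D X B := by
    refine meas_le_three (a := ch D X) (b := w) (c := w') (wt_ins_le hI hv) hvw.ne hvw'.ne hww
      ?_ hcw hcw'
    rw [wt_ins_self]
    have := wt_self_coeff hv hvB
    rwa [hgv] at this
  refine leaves_le_of_children (ci := 1.8095⁻¹ * (f * cw * cw')) ⟨_, hv⟩ (fun _ => ?_) hout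
    (by positivity) hM ?_ (by linarith)
  · refine hf.trans ((mul_le_mul_of_nonneg_left hin hf0).trans_eq ?_)
    ring
  · rw [← mul_add, inv_mul_le_iff₀ (by norm_num), mul_one]
    exact hsum

/-- All frontier vertices dominate at most two new vertices. -/
theorem leaves_gain_two (h : AllBounds G ch m) (hI : Inv G D X)
    (hB : ∀ u ∈ B, Blocked G D X u) (hv : ch D X ∈ fr G D X)
    (hnB : ∀ u ∈ fr G D X, u ∉ B) (hg : ∀ u ∈ fr G D X, gain G D u ≤ 2)
    (hgv : gain G D (ch D X) = 2) :
    (leaves G ch (m + 1) D X : ℝ) ≤ 1 * meas G D X B := by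
  have hM := meas_nonneg (G := G) D X B
  have hM1 := one_le_meas (G := G) D X B
  have hvB := hnB _ hv
  have hout := leaves_del_le h hI hB hv hvB
  have hyv : yk (gain G D (ch D X)) = 1.8095 := by rw [hgv]; rfl
  have hself := wt_self_coeff hv hvB
  have hvcl := (mem_fr.1 hv).1
  rw [hyv] at hout hself
  obtain ⟨w, w', hww, hw⟩ := Finset.card_eq_two.1 hgv
  have hwm : w ∈ (und G D).filter (G.Adj (ch D X)) := by rw [hw]; simp
  have hwm' : w' ∈ (und G D).filter (G.Adj (ch D X)) := by rw [hw]; simp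
  obtain ⟨hwu, hvw⟩ := Finset.mem_filter.1 hwm
  obtain ⟨hwu', hvw'⟩ := Finset.mem_filter.1 hwm'
  have honlyw : ∀ u ∈ und G D, G.Adj (ch D X) u → u = w ∨ u = w' := by
    intro u hu hvu
    have : u ∈ (und G D).filter (G.Adj (ch D X)) := Finset.mem_filter.2 ⟨hu, hvu⟩
    rw [hw] at this
    simpa using this
  have honlyw' : ∀ u ∈ und G D, G.Adj (ch D X) u → u = w' ∨ u = w :=
    fun u hu hvu => (honlyw u hu hvu).symm
  have hbin := h.ins hI hB hv
  have hcw := wt_ins_und (B := B) hI hv hwu hvw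
  have hcw' := wt_ins_und (B := B) hI hv hwu' hvw'
  have hout1 : (leaves G ch m D (insert (ch D X) X) : ℝ) ≤ 1.8095⁻¹ * 1 * meas G D X B := by
    rwa [mul_one]
  have hbasic : (leaves G ch m (insert (ch D X) D) X : ℝ) ≤
      1 * meas G (insert (ch D X) D) X B := by
    rw [one_mul]
    exact hbin.basic
  by_cases hex : ∃ x ∈ fr G D X, x ≠ ch D X ∧ (G.Adj x w ∨ G.Adj x w')
  · obtain ⟨x, hx, hxv, hxw⟩ := hex
    have hxB := hnB x hx
    have hxc := (mem_fr.1 hx).1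
    have hne : ∀ z ∈ und G D, z ≠ x := fun z hz hzx => mem_und.1 hz (hzx ▸ hxc)
    have hcx : wt G (insert (ch D X) D) X B x ≤ 0.9547 * wt G D X B x := by
      rcases hxw with hxw | hxw
      · exact wt_ins_other hv hx hxv hxB hwu hvw hxw (hg x hx)
      · exact wt_ins_other hv hx hxv hxB hwu' hvw' hxw (hg x hx)
    have hin : meas G (insert (ch D X) D) X B ≤
        1.8095⁻¹ * 0.9192 * 0.9192 * 0.9547 * meas G D X B := by
      refine meas_le_four (a := ch D X) (b := w) (c := w') (d := x) (wt_ins_le hI hv) hvw.ne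
        hvw'.ne hxv.symm hww (hne w hwu) (hne w' hwu') ?_ hcw hcw' hcx
      rw [wt_ins_self]
      exact hself
    exact leaves_le_of_children ⟨_, hv⟩ (fun _ => hbin.basic.trans hin) hout (by norm_num) hM
      (by norm_num) (by linarith)
  have hchildren := @leaves_two_children V _ _ G _ ch m D X B w w' hI hv hvB hgv hvw hvw'
    hww
  by_cases hwB : w ∈ B
  · exact hchildren hbasic (wt_ins_blocked hI hwu hvw hwB) hcw' hout1 (by norm_num)
      (by norm_num) (by norm_num) (by norm_num)
  by_cases hwB' : w' ∈ B
  · exact hchildren hbasic hcw (wt_ins_blocked hI hwu' hvw' hwB') hout1 (by norm_num)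
      (by norm_num) (by norm_num) (by norm_num)
  push Not at hex
  have hdg := dg_eq_gain_add_one hI hv hwu hvw fun x hx hxw => by
    by_contra hne
    exact (hex x hx hne).1 hxw
  have hdg' := dg_eq_gain_add_one hI hv hwu' hvw' fun x hx hxw => by
    by_contra hne
    exact (hex x hx hne).2 hxw
  have hwf := fr_insert_of_und hI hwu hvw
  have hwf' := fr_insert_of_und hI hwu' hvw'
  -- Two large vertices in the including child yield the factor 0.9569. Otherwise a new vertex of
  -- gain at most two had few available neighbours before, so excluding the chosen vertex visibly
  -- lowers its weight.
  by_cases hboth : 3 ≤ gain G (insert (ch D X) D) w ∧ 3 ≤ gain G (insert (ch D X) D) w'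
  · exact hchildren (hbin.large_two w hwf w' hwf' hww hwB hwB' hboth.1 hboth.2) hcw hcw' hout1
      (by norm_num) (by norm_num) (by norm_num) (by norm_num)
  by_cases hadj : G.Adj w w'
  · have ha := gain_insert_of_adj hvcl hwu' hvw' honlyw hadj
    have ha' := gain_insert_of_adj hvcl hwu hvw honlyw' hadj.symm
    -- When the two new vertices are adjacent, each loses the other from its gain. So the number of
    -- available neighbours exceeds the new gain by two, and the inclusion drop improves on 0.9192;
    -- 0.9901 rounds up `bd 3 / bd 4`.
    have hin_adj : ∀ z, z ∈ und G D → G.Adj (ch D X) z → z ∉ B →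
        dg G X z = gain G D z + 1 →
        gain G (insert (ch D X) D) z + 1 = gain G D z →
        gain G (insert (ch D X) D) z ≤ 2 →
        wt G (insert (ch D X) D) X B z ≤ 0.9192 * 0.9901 * wt G D X B z ∧
        wt G D (insert (ch D X) X) B z ≤ 0.9901 * wt G D X B z := by
      intro z hz hvz hzB h1 h2 h3
      rw [wt_fr (fr_insert_of_und hI hz hvz) hzB, wt_und hI hz hzB,
        wt_del_und hI hv hz hvz hzB, h1, ← h2]
      have : gain G (insert (ch D X) D) z = 0 ∨ gain G (insert (ch D X) D) z = 1 ∨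
        gain G (insert (ch D X) D) z = 2 := by omega
      rcases this with h4 | h4 | h4 <;> rw [h4] <;> norm_num [yk, bd]
    by_cases hbig : 3 ≤ gain G (insert (ch D X) D) w
    · have hsm : gain G (insert (ch D X) D) w' ≤ 2 := by
        by_contra hc
        exact hboth ⟨hbig, by omega⟩
      have hz := hin_adj w' hwu' hvw' hwB' hdg' ha' hsm
      have hout' := leaves_del_le_bd h hI hB hv hvB hwu' hvw' hwB' (c := 0.9901) (by norm_num)
        (fun _ => by
          rw [← wt_und hI hwu' hwB', ← wt_del_und hI hv hwu' hvw' hwB']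
          exact hz.2)
      rw [hyv] at hout'
      exact hchildren (hbin.large w hwf hwB hbig) hcw hz.1 hout' (by norm_num) (by norm_num)
        (by norm_num) (by norm_num)
    have hz := hin_adj w hwu hvw hwB hdg ha (by omega)
    by_cases hbig' : 3 ≤ gain G (insert (ch D X) D) w'
    · have hout' := leaves_del_le_bd h hI hB hv hvB hwu hvw hwB (c := 0.9901) (by norm_num)
        (fun _ => by
          rw [← wt_und hI hwu hwB, ← wt_del_und hI hv hwu hvw hwB]
          exact hz.2)
      rw [hyv] at hout'
      exact hchildren (hbin.large w' hwf' hwB' hbig') hz.1 hcw' hout' (by norm_num)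
        (by norm_num) (by norm_num) (by norm_num)
    have hz' := hin_adj w' hwu' hvw' hwB' hdg' ha' (by omega)
    have hout' : (leaves G ch m D (insert (ch D X) X) : ℝ) ≤
        1.8095⁻¹ * (0.9901 * 0.9901) * meas G D X B := by
      refine (h.del hI hB hv).basic.trans ?_
      rw [← mul_assoc]
      refine meas_le_three (a := ch D X) (b := w) (c := w') (wt_del_le subset_rfl) hvw.ne
        hvw'.ne hww ?_ hz.2 hz'.2
      rw [wt_del_self]
      exact hself
    exact hchildren hbasic hz.1 hz'.1 hout' (by norm_num) (by norm_num) (by norm_num)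
      (by norm_num)
  · have ha := gain_insert_of_not_adj hvcl honlyw hadj
    have ha' := gain_insert_of_not_adj hvcl honlyw' (fun h => hadj h.symm)
    -- Without an edge between them the gain is unchanged, so a new vertex of gain at most two has
    -- at most three available neighbours. The value one is omitted because exclusion is then dead.
    have hnum : ∀ d : ℕ, d = 2 ∨ d = 3 → bd (d - 1) ≤ 0.9547 * bd d := by
      rintro d (rfl | rfl) <;> norm_num [bd]
    have hout' : (leaves G ch m D (insert (ch D X) X) : ℝ) ≤
        1.8095⁻¹ * 0.9547 * meas G D X B := by
      rw [← hyv]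
      by_cases hbig : 3 ≤ gain G (insert (ch D X) D) w
      · exact leaves_del_le_bd h hI hB hv hvB hwu' hvw' hwB' (by norm_num)
          (fun hd => hnum _ (by omega))
      · exact leaves_del_le_bd h hI hB hv hvB hwu hvw hwB (by norm_num)
          (fun hd => hnum _ (by omega))
    exact hchildren hbasic hcw hcw' hout' (by norm_num) (by norm_num) (by norm_num)
      (by norm_num)

/-- At a node where no frontier inclusion is redundant, no frontier vertex is in `B` and none has
gain zero. The case split on the maximal gain is then complete. -/
theorem allBounds (hch : IsChoice G ch) (m : ℕ) : AllBounds G ch m := by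
  induction m with
  | zero => exact fun D X B _ _ => Bound.of_leaves_eq_zero rfl
  | succ m h =>
    intro D X B hI hB
    by_cases hd : Dead G D X
    · exact Bound.of_leaves_eq_zero (leaves_of_dead hd)
    by_cases hfr : fr G D X = ∅
    · have h1 : leaves G ch (m + 1) D X = 1 := by rw [leaves, if_neg hd, if_pos hfr]
      constructor
      · rw [h1]
        simpa using one_le_meas D X B
      all_goals
        intro w hw
        rw [hfr] at hw
        simp at hw
    obtain ⟨hv, hcase⟩ := hch D X (Finset.nonempty_iff_ne_empty.2 hfr)
    rcases hcase with hred | ⟨hnr, hmax⟩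
    · exact bound_of_redundant h hI hB hv hred
    have hnB : ∀ u ∈ fr G D X, u ∉ B := fun u hu huB => hnr u hu ((hB u huB).redundant hu)
    have hpos : ∀ u ∈ fr G D X, gain G D u ≠ 0 := fun u hu h0 =>
      hnr u hu (redundant_of_gain_eq_zero hI hu h0)
    have hvB := hnB _ hv
    have hlarge := leaves_large h hI hB hv hvB
    have hM := meas_nonneg (G := G) D X B
    constructor
    · have h0 := hpos _ hv
      have : gain G D (ch D X) = 1 ∨ gain G D (ch D X) = 2 ∨ 3 ≤ gain G D (ch D X) := by omega
      rcases this with h1 | h1 | h1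
      · have := leaves_gain_one h hI hB hv hnB (fun u hu => by
          have := hpos u hu
          have := hmax u hu
          omega)
        rwa [one_mul] at this
      · have := leaves_gain_two h hI hB hv hnB (fun u hu => by
          have := hmax u hu
          omega) h1
        rwa [one_mul] at this
      · linarith [hlarge h1]
    · intro w hw _ hw3
      exact hlarge (hw3.trans (hmax w hw))
    · intro w hw w' hw' hne hwB hwB' hw3 hw3'
      by_cases hwv : w = ch D X
      · exact leaves_large_two h hI hB hv hvB (hw3.trans (hmax w hw)) hw'
          (fun h => hne (hwv.trans h.symm)) hwB' hw3'
      · exact leaves_large_two h hI hB hv hvB (hw3.trans (hmax w hw)) hw hwv hwB hw3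
    · intro w hw hwB hw2 huniq hbl
      have hwv : w = ch D X := by
        by_contra hne
        have h1 := huniq _ hv (fun h => hne h.symm)
        have h2 := hmax w hw
        omega
      subst hwv
      exact leaves_unique h hI hB hv hwB hbl

/-- The search tree below a single vertex has at most `1.9884 ^ n` leaves. -/
theorem leaves_singleton_le (hch : IsChoice G ch) (m : ℕ) (x : V) :
    (leaves G ch m {x} ∅ : ℝ) ≤ 1.9884 ^ Fintype.card V :=
  (allBounds hch m {x} ∅ ∅ (inv_singleton x) (by simp)).basic.trans (meas_le _ _ _)

end Measure

end CDSEnum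

namespace WordRAM

/-! ### Rules for total correctness with time bounds -/

/-- The register `x` occurs in the expression. -/
def Expr.uses (x : ℕ) : Expr → Bool
  | .const _ => false
  | .reg y => x == y
  | .read _ i => i.uses x
  | .add e f => e.uses x || f.uses x
  | .sub e f => e.uses x || f.uses x
  | .mul e f => e.uses x || f.uses x
  | .lt e f => e.uses x || f.uses x
  | .eq e f => e.uses x || f.uses x

/-- The state after the assignment of `k` to register `x`. -/
def State.set (s : State) (x k : ℕ) : State := { s with reg := Function.update s.reg x k }

/-- The state after the assignment of `k` to cell `i` of array `a`. -/
def State.put (s : State) (a i k : ℕ) : State :=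
  { s with mem := Function.update s.mem a (Function.update (s.mem a) i k) }

@[simp] theorem State.set_reg (s : State) (x k y : ℕ) :
    (s.set x k).reg y = if y = x then k else s.reg y := by
  simp [State.set, Function.update_apply]

@[simp] theorem State.set_mem (s : State) (x k : ℕ) : (s.set x k).mem = s.mem := rfl

@[simp] theorem State.set_out (s : State) (x k : ℕ) : (s.set x k).out = s.out := rfl

@[simp] theorem State.put_reg (s : State) (a i k : ℕ) : (s.put a i k).reg = s.reg := rfl

@[simp] theorem State.put_out (s : State) (a i k : ℕ) : (s.put a i k).out = s.out := rfl

theorem State.put_mem (s : State) (a i k b j : ℕ) :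
    (s.put a i k).mem b j = if b = a ∧ j = i then k else s.mem b j := by
  unfold State.put
  by_cases h : b = a
  · subst h
    by_cases hj : j = i
    · simp [hj]
    · simp [hj]
  · simp [h]

theorem State.put_mem_ne (s : State) {a b : ℕ} (i k : ℕ) (h : b ≠ a) :
    (s.put a i k).mem b = s.mem b := by
  funext j
  simp [State.put_mem, h]

/-- This lets the accumulator of a counting loop change while the summed expression keeps its value.
-/
theorem Expr.eval_congr {x : ℕ} {s s' : State} (hm : s'.mem = s.mem)
    (hr : ∀ y, y ≠ x → s'.reg y = s.reg y) (e : Expr) (he : e.uses x = false) :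
    e.eval s' = e.eval s := by
  induction e with
  | const k => rfl
  | reg y =>
    simp only [Expr.uses, beq_eq_false_iff_ne] at he
    exact hr y he.symm
  | read a i ih => simp only [Expr.uses] at he; simp [Expr.eval, hm, ih he]
  | add e f ihe ihf | sub e f ihe ihf | mul e f ihe ihf | lt e f ihe ihf | eq e f ihe ihf =>
    simp only [Expr.uses, Bool.or_eq_false_iff] at he
    simp [Expr.eval, ihe he.1, ihf he.2]

theorem Expr.fits_congr {W x : ℕ} {s s' : State} (hm : s'.mem = s.mem)
    (hr : ∀ y, y ≠ x → s'.reg y = s.reg y) (e : Expr) (he : e.uses x = false) :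
    e.Fits W s' ↔ e.Fits W s := by
  induction e with
  | const k => rfl
  | reg y =>
    simp only [Expr.uses, beq_eq_false_iff_ne] at he
    simp [Expr.Fits, hr y he.symm]
  | read a i ih =>
    simp only [Expr.uses] at he
    simp [Expr.Fits, hm, ih he, Expr.eval_congr hm hr i he]
  | add e f ihe ihf | sub e f ihe ihf | mul e f ihe ihf | lt e f ihe ihf | eq e f ihe ihf =>
    simp only [Expr.uses, Bool.or_eq_false_iff] at he
    simp [Expr.Fits, ihe he.1, ihf he.2, Expr.eval_congr hm hr e he.1,
      Expr.eval_congr hm hr f he.2]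

/-- The program may write register `x`. -/
def Cmd.wreg (x : ℕ) : Cmd → Bool
  | .skip => false
  | .assign y _ => x == y
  | .store _ _ _ => false
  | .output _ => false
  | .seq c d => c.wreg x || d.wreg x
  | .ite _ c d => c.wreg x || d.wreg x
  | .while _ c => c.wreg x

/-- The program may write array `a`. -/
def Cmd.wmem (a : ℕ) : Cmd → Bool
  | .skip => false
  | .assign _ _ => false
  | .store b _ _ => a == b
  | .output _ => false
  | .seq c d => c.wmem a || d.wmem a
  | .ite _ c d => c.wmem a || d.wmem a
  | .while _ c => c.wmem a

/-- The program has no output command. -/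
def Cmd.quiet : Cmd → Bool
  | .skip => true
  | .assign _ _ => true
  | .store _ _ _ => true
  | .output _ => false
  | .seq c d => c.quiet && d.quiet
  | .ite _ c d => c.quiet && d.quiet
  | .while _ c => c.quiet

/-- What `c` does not write is the same in both states. -/
structure Frame (c : Cmd) (s s' : State) : Prop where
  reg : ∀ x, c.wreg x = false → s'.reg x = s.reg x
  mem : ∀ a, c.wmem a = false → s'.mem a = s.mem a
  out : c.quiet = true → s'.out = s.out

/-- Write sets are computed from the syntax, so for concrete programs preservation of a register or
array is decided by `rfl`. -/
theorem Exec.frame {W t : ℕ} {c : Cmd} {s s' : State} (h : Exec W c s t s') : Frame c s s' := by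
  induction h with
  | skip s => exact ⟨fun _ _ => rfl, fun _ _ => rfl, fun _ => rfl⟩
  | assign x e s he =>
    refine ⟨fun y hy => ?_, fun _ _ => rfl, fun _ => rfl⟩
    simp only [Cmd.wreg, beq_eq_false_iff_ne] at hy
    simp [hy]
  | store a i e s hi he =>
    refine ⟨fun _ _ => rfl, fun b hb => ?_, fun _ => rfl⟩
    simp only [Cmd.wmem, beq_eq_false_iff_ne] at hb
    simp [hb]
  | output e s he => exact ⟨fun _ _ => rfl, fun _ _ => rfl, fun h => by simp [Cmd.quiet] at h⟩
  | seq c d s s₁ s₂ t₁ t₂ hc hd ihc ihd =>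
    refine ⟨fun x hx => ?_, fun a ha => ?_, fun hq => ?_⟩
    · simp only [Cmd.wreg, Bool.or_eq_false_iff] at hx
      rw [ihd.reg x hx.2, ihc.reg x hx.1]
    · simp only [Cmd.wmem, Bool.or_eq_false_iff] at ha
      rw [ihd.mem a ha.2, ihc.mem a ha.1]
    · simp only [Cmd.quiet, Bool.and_eq_true] at hq
      rw [ihd.out hq.2, ihc.out hq.1]
  | iteTrue e c d s s₁ t he h hc ih =>
    refine ⟨fun x hx => ?_, fun a ha => ?_, fun hq => ?_⟩
    · simp only [Cmd.wreg, Bool.or_eq_false_iff] at hx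
      exact ih.reg x hx.1
    · simp only [Cmd.wmem, Bool.or_eq_false_iff] at ha
      exact ih.mem a ha.1
    · simp only [Cmd.quiet, Bool.and_eq_true] at hq
      exact ih.out hq.1
  | iteFalse e c d s s₁ t he h hc ih =>
    refine ⟨fun x hx => ?_, fun a ha => ?_, fun hq => ?_⟩
    · simp only [Cmd.wreg, Bool.or_eq_false_iff] at hx
      exact ih.reg x hx.2
    · simp only [Cmd.wmem, Bool.or_eq_false_iff] at ha
      exact ih.mem a ha.2
    · simp only [Cmd.quiet, Bool.and_eq_true] at hq
      exact ih.out hq.2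
  | whileTrue e c s s₁ s₂ t₁ t₂ he h hc hw ihc ihw =>
    refine ⟨fun x hx => ?_, fun a ha => ?_, fun hq => ?_⟩
    · rw [ihw.reg x hx, ihc.reg x hx]
    · rw [ihw.mem a ha, ihc.mem a ha]
    · rw [ihw.out hq, ihc.out hq]
  | whileFalse e c s he h => exact ⟨fun _ _ => rfl, fun _ _ => rfl, fun _ => rfl⟩

/-- Started in `s`, the program halts within `K` steps in a state that satisfies `Q`. -/
def Run (W : ℕ) (c : Cmd) (K : ℕ) (s : State) (Q : State → Prop) : Prop :=
  ∃ t s', t ≤ K ∧ Exec W c s t s' ∧ Q s'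

variable {W : ℕ}

theorem Run.mono {c : Cmd} {K K' : ℕ} {s : State} {Q Q' : State → Prop} (h : Run W c K s Q)
    (hK : K ≤ K') (hQ : ∀ s', Frame c s s' → Q s' → Q' s') : Run W c K' s Q' := by
  obtain ⟨t, s', ht, he, hq⟩ := h
  exact ⟨t, s', ht.trans hK, he, hQ s' he.frame hq⟩

theorem Run.skip {s : State} {Q : State → Prop} (h : Q s) : Run W .skip 1 s Q :=
  ⟨1, s, le_rfl, .skip s, h⟩

theorem Run.assign {x : ℕ} {e : Expr} {s : State} {Q : State → Prop} (he : e.Fits W s)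
    (h : Q (s.set x (e.eval s))) : Run W (.assign x e) (e.cost + 1) s Q :=
  ⟨_, _, le_rfl, .assign x e s he, h⟩

theorem Run.store {a : ℕ} {i e : Expr} {s : State} {Q : State → Prop} (hi : i.Fits W s)
    (he : e.Fits W s) (h : Q (s.put a (i.eval s) (e.eval s))) :
    Run W (.store a i e) (i.cost + e.cost + 1) s Q :=
  ⟨_, _, le_rfl, .store a i e s hi he, h⟩

theorem Run.output {e : Expr} {s : State} {Q : State → Prop} (he : e.Fits W s)
    (h : Q { s with out := s.out ++ [e.eval s] }) : Run W (.output e) (e.cost + 1) s Q :=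
  ⟨_, _, le_rfl, .output e s he, h⟩

theorem Run.seq {c d : Cmd} {K L : ℕ} {s : State} {P Q : State → Prop} (hc : Run W c K s P)
    (hd : ∀ s', Frame c s s' → P s' → Run W d L s' Q) : Run W (.seq c d) (K + L) s Q := by
  obtain ⟨t, s', ht, he, hp⟩ := hc
  obtain ⟨t', s'', ht', he', hq⟩ := hd s' he.frame hp
  exact ⟨t + t', s'', by omega, .seq c d s s' s'' t t' he he', hq⟩

theorem Run.ite {e : Expr} {c d : Cmd} {K : ℕ} {s : State} {Q : State → Prop}
    (he : e.Fits W s) (hc : e.eval s ≠ 0 → Run W c K s Q) (hd : e.eval s = 0 → Run W d K s Q) :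
    Run W (.ite e c d) (e.cost + 1 + K) s Q := by
  by_cases h : e.eval s = 0
  · obtain ⟨t, s', ht, hx, hq⟩ := hd h
    exact ⟨_, s', by omega, .iteFalse e c d s s' t he h hx, hq⟩
  · obtain ⟨t, s', ht, hx, hq⟩ := hc h
    exact ⟨_, s', by omega, .iteTrue e c d s s' t he h hx, hq⟩

/-- Run `c` for all values of register `i` below the number in register `0`. -/
def forN (i : ℕ) (c : Cmd) : Cmd :=
  .seq (.assign i (.const 0)) (.while (.lt (.reg i) (.reg 0))
    (.seq c (.assign i (.add (.reg i) (.const 1)))))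

/-- `I j` is the invariant with the counter already at `j`, so the body must establish it after the
increment. The counter ends at `n`, which must be representable. -/
theorem Run.forN {n i K : ℕ} {c : Cmd} {s : State} {Q : State → Prop} (I : ℕ → State → Prop)
    (hW : n + 2 ≤ W) (hi : i ≠ 0) (hci : c.wreg i = false) (hc0 : c.wreg 0 = false)
    (hn : s.reg 0 = n) (h0 : I 0 (s.set i 0))
    (hbody : ∀ j < n, ∀ s', Frame (WordRAM.forN i c) s s' → s'.reg i = j → I j s' →
      Run W c K s' fun s'' => I (j + 1) (s''.set i (j + 1)))
    (hpost : ∀ s', Frame (WordRAM.forN i c) s s' → I n s' → Q s') :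
    Run W (WordRAM.forN i c) ((K + 12) * (n + 1)) s Q := by
  have key : ∀ k j, j + k = n → ∀ s', Frame (WordRAM.forN i c) s s' → s'.reg i = j → I j s' →
      Run W (.while (.lt (.reg i) (.reg 0)) (.seq c (.assign i (.add (.reg i) (.const 1)))))
        ((K + 8) * k + 4) s' Q := by
    intro k
    induction k with
    | zero =>
      intro j hj s' hf hij hI
      have h0' : s'.reg 0 = n := by
        rw [hf.reg 0 (by simp [WordRAM.forN, Cmd.wreg, hi.symm, hc0]), hn]
      refine ⟨4, s', by omega, .whileFalse _ _ s' ?_ ?_, hpost s' hf ?_⟩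
      · simp only [Expr.Fits, h0', hij]; omega
      · simp [Expr.eval, h0', hij]; omega
      · rwa [show n = j by omega]
    | succ k ih =>
      intro j hj s' hf hij hI
      have h0' : s'.reg 0 = n := by
        rw [hf.reg 0 (by simp [WordRAM.forN, Cmd.wreg, hi.symm, hc0]), hn]
      obtain ⟨t, s₁, ht, he, hq⟩ := hbody j (by omega) s' hf hij hI
      have hs1 : s₁.reg i = j := by rw [he.frame.reg i hci, hij]
      have hfull : Exec W (.seq c (.assign i (.add (.reg i) (.const 1)))) s' (t + 4)
          (s₁.set i (j + 1)) := by
        have := Exec.assign (W := W) i (.add (.reg i) (.const 1)) s₁ (by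
          simp only [Expr.Fits, Expr.eval, hs1]; omega)
        simp only [Expr.eval, hs1] at this
        exact .seq _ _ _ _ _ _ _ he this
      have hf' : Frame (WordRAM.forN i c) s (s₁.set i (j + 1)) := by
        have h2 := hfull.frame
        refine ⟨fun x hx => ?_, fun a ha => ?_, fun hq => ?_⟩
        · rw [h2.reg x, hf.reg x hx]
          simp only [WordRAM.forN, Cmd.wreg, Bool.or_eq_false_iff] at hx ⊢
          exact hx.2
        · rw [h2.mem a, hf.mem a ha]
          simpa [WordRAM.forN, Cmd.wmem] using ha
        · rw [h2.out, hf.out hq]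
          simpa [WordRAM.forN, Cmd.quiet] using hq
      obtain ⟨t', s₂, ht', he', hq'⟩ := ih (j + 1) (by omega) (s₁.set i (j + 1)) hf' (by simp) hq
      refine ⟨_, s₂, ?_, .whileTrue _ _ s' _ s₂ (t + 4) t' ?_ ?_ hfull he', hq'⟩
      · simp only [Expr.cost]
        rw [Nat.mul_succ]
        omega
      · simp only [Expr.Fits, h0', hij]; omega
      · simp [Expr.eval, h0', hij]; omega
  have hset : Exec W (.assign i (.const 0)) s 2 (s.set i 0) :=
    .assign i (.const 0) s (by simp only [Expr.Fits]; omega)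
  have hf0 : Frame (WordRAM.forN i c) s (s.set i 0) := by
    refine ⟨fun x hx => ?_, fun a _ => rfl, fun _ => rfl⟩
    have : x ≠ i := by
      rintro rfl
      simp [WordRAM.forN, Cmd.wreg] at hx
    simp [this]
  obtain ⟨t, s', ht, he, hq⟩ := key n 0 (by omega) (s.set i 0) hf0 (by simp) h0
  refine ⟨2 + t, s', ?_, .seq _ _ _ _ _ _ _ hset he, hq⟩
  nlinarith

/-! ### Boolean expressions and counting loops -/

open Classical in
/-- The number `1` if `p` holds and `0` otherwise. -/
noncomputable def ind (p : Prop) : ℕ := if p then 1 else 0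

theorem ind_le (p : Prop) : ind p ≤ 1 := by
  unfold ind
  split_ifs <;> simp

theorem ind_congr {p q : Prop} (h : p ↔ q) : ind p = ind q := by rw [propext h]

@[simp] theorem ind_eq_zero {p : Prop} : ind p = 0 ↔ ¬ p := by
  unfold ind
  split_ifs <;> simp_all

@[simp] theorem ind_eq_one {p : Prop} : ind p = 1 ↔ p := by
  unfold ind
  split_ifs <;> simp_all

theorem ind_true {p : Prop} (h : p) : ind p = 1 := ind_eq_one.2 h

theorem ind_false {p : Prop} (h : ¬ p) : ind p = 0 := ind_eq_zero.2 h

/-- The number of elements that satisfy `P`. -/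
noncomputable def count {n : ℕ} (P : Fin n → Prop) : ℕ := ∑ i, ind (P i)

theorem count_eq_zero {n : ℕ} {P : Fin n → Prop} : count P = 0 ↔ ∀ i, ¬ P i := by
  simp [count]

theorem count_le {n : ℕ} (P : Fin n → Prop) : count P ≤ n := by
  calc count P ≤ ∑ _i : Fin n, 1 := Finset.sum_le_sum fun i _ => ind_le _
    _ = n := by simp

theorem count_eq_card {n : ℕ} (P : Fin n → Prop) [DecidablePred P] :
    count P = (Finset.univ.filter P).card := by
  rw [Finset.card_filter]
  refine Finset.sum_congr rfl fun i _ => ?_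
  unfold ind
  split_ifs <;> rfl

/-- The expression can be evaluated and has value `v`. -/
def Val (W : ℕ) (s : State) (e : Expr) (v : ℕ) : Prop := e.Fits W s ∧ e.eval s = v

theorem Val.const {s : State} {k : ℕ} (h : k < W) : Val W s (.const k) k := ⟨h, rfl⟩

theorem Val.reg {s : State} {x k : ℕ} (hx : s.reg x = k) (h : k < W) : Val W s (.reg x) k :=
  ⟨by simpa [Expr.Fits, hx] using h, hx⟩

theorem Val.read {s : State} {a i k : ℕ} {e : Expr} (he : Val W s e i) (h : s.mem a i = k)
    (hk : k < W) : Val W s (.read a e) k := by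
  obtain ⟨h1, rfl⟩ := he
  exact ⟨⟨h1, by simpa [h] using hk⟩, h⟩

theorem Val.add {s : State} {e f : Expr} {a b : ℕ} (he : Val W s e a) (hf : Val W s f b)
    (h : a + b < W) : Val W s (.add e f) (a + b) := by
  obtain ⟨h1, rfl⟩ := he
  obtain ⟨h2, rfl⟩ := hf
  exact ⟨⟨h1, h2, h⟩, rfl⟩

theorem Val.mul {s : State} {e f : Expr} {a b : ℕ} (he : Val W s e a) (hf : Val W s f b)
    (h : a * b < W) : Val W s (.mul e f) (a * b) := by
  obtain ⟨h1, rfl⟩ := he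
  obtain ⟨h2, rfl⟩ := hf
  exact ⟨⟨h1, h2, h⟩, rfl⟩

theorem Val.sub {s : State} {e f : Expr} {a b : ℕ} (he : Val W s e a) (hf : Val W s f b) :
    Val W s (.sub e f) (a - b) := by
  obtain ⟨h1, rfl⟩ := he
  obtain ⟨h2, rfl⟩ := hf
  exact ⟨⟨h1, h2⟩, rfl⟩

theorem Val.lt {s : State} {e f : Expr} {a b : ℕ} (hW : 1 < W) (he : Val W s e a)
    (hf : Val W s f b) : Val W s (.lt e f) (ind (a < b)) := by
  obtain ⟨h1, rfl⟩ := he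
  obtain ⟨h2, rfl⟩ := hf
  refine ⟨⟨h1, h2, hW⟩, ?_⟩
  simp only [Expr.eval, ind]
  split_ifs <;> rfl

theorem Val.eq {s : State} {e f : Expr} {a b : ℕ} (hW : 1 < W) (he : Val W s e a)
    (hf : Val W s f b) : Val W s (.eq e f) (ind (a = b)) := by
  obtain ⟨h1, rfl⟩ := he
  obtain ⟨h2, rfl⟩ := hf
  refine ⟨⟨h1, h2, hW⟩, ?_⟩
  simp only [Expr.eval, ind]
  split_ifs <;> rfl

theorem Val.congr {s : State} {e : Expr} {p q : Prop} (he : Val W s e (ind p)) (h : p ↔ q) :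
    Val W s e (ind q) := by rwa [← ind_congr h]

theorem Val.and {s : State} {e f : Expr} {p q : Prop} (hW : 1 < W) (he : Val W s e (ind p))
    (hf : Val W s f (ind q)) : Val W s (.mul e f) (ind (p ∧ q)) := by
  have h : ind p * ind q = ind (p ∧ q) := by
    by_cases hp : p <;> by_cases hq : q <;> simp [ind, hp, hq]
  rw [← h]
  exact Val.mul he hf (by rw [h]; have := ind_le (p ∧ q); omega)

theorem Val.or {s : State} {e f : Expr} {p q : Prop} (hW : 2 < W) (he : Val W s e (ind p))
    (hf : Val W s f (ind q)) : Val W s (.lt (.const 0) (.add e f)) (ind (p ∨ q)) := by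
  have h1 := ind_le p
  have h2 := ind_le q
  refine ((Val.lt (by omega) (Val.const (by omega))
    (Val.add he hf (by omega))).congr ?_)
  by_cases hp : p <;> by_cases hq : q <;> simp [ind, hp, hq]

/-- Assign to register `a` the number of values of register `i` below the number in register `0`
for which `e` holds after `c`. -/
def countN (a i : ℕ) (c : Cmd) (e : Expr) : Cmd :=
  .seq (.assign a (.const 0)) (forN i (.seq c (.assign a (.add (.reg a) e))))

theorem Run.countN {n a i K : ℕ} {c : Cmd} {e : Expr} {s : State} {P : Fin n → Prop}
    {J : State → Prop} (hW : n + 2 ≤ W) (hi : i ≠ 0) (ha : a ≠ 0) (hai : i ≠ a)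
    (hca : c.wreg a = false) (hci : c.wreg i = false) (hc0 : c.wreg 0 = false)
    (hn : s.reg 0 = n) (he : e.cost ≤ 30) (hJ : J s) (hJa : ∀ s k, J s → J (s.set a k))
    (hJi : ∀ s k, J s → J (s.set i k))
    (hbody : ∀ k : Fin n, ∀ s', Frame (WordRAM.countN a i c e) s s' → s'.reg i = k → J s' →
      Run W c K s' fun s'' => Val W s'' e (ind (P k)) ∧ J s'') :
    Run W (WordRAM.countN a i c e) ((K + 50) * (n + 1)) s
      fun s' => s'.reg a = count P ∧ J s' := by
  -- Partial counts are sums over all of `Fin n` with a cutoff, which avoids changing index types.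
  let cnt : ℕ → ℕ := fun j => ∑ k : Fin n, if (k : ℕ) < j then ind (P k) else 0
  have hcnt_le : ∀ j, cnt j ≤ n := fun j => by
    calc cnt j ≤ ∑ _k : Fin n, 1 := Finset.sum_le_sum fun k _ => by
          have := ind_le (P k)
          split_ifs <;> omega
      _ = n := by simp
  have hcnt_succ : ∀ k : Fin n, cnt (k + 1) = cnt k + ind (P k) := fun k => by
    have h1 : ∀ l : Fin n, (if (l : ℕ) < k + 1 then ind (P l) else 0) =
        (if (l : ℕ) < k then ind (P l) else 0) + if l = k then ind (P l) else 0 := by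
      intro l
      rcases lt_trichotomy l k with h | h | h
      · have h' : (l : ℕ) < k := h
        rw [if_pos (by omega), if_pos h', if_neg h.ne, add_zero]
      · subst h
        simp
      · have h' : (k : ℕ) < l := h
        rw [if_neg (by omega), if_neg (by omega), if_neg h.ne']
    simp only [cnt, h1, Finset.sum_add_distrib]
    congr 1
    simp
  refine Run.mono (K := 2 + (K + 33 + 12) * (n + 1)) (Q := fun s' =>
    s'.reg a = count P ∧ J s') ?_ (by nlinarith) (fun _ _ h => h)
  refine Run.seq (K := 2) (P := fun s' => s' = s.set a 0)
    (Run.assign (by simp only [Expr.Fits]; omega) rfl) ?_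
  rintro _ - rfl
  refine Run.forN (n := n) (K := K + 33) (fun j s' => s'.reg a = cnt j ∧ J s') hW hi
    (by simp [Cmd.wreg, hci, hai]) (by simp [Cmd.wreg, hc0, ha.symm]) (by simp [ha.symm, hn])
    ⟨by simp [hai.symm, cnt], hJi _ _ (hJa _ _ hJ)⟩ ?_ ?_
  · intro j hj s' hf hij hI
    have hf' : Frame (WordRAM.countN a i c e) s s' := by
      refine ⟨fun x hx => ?_, fun b hb => ?_, fun hq => ?_⟩
      · simp only [WordRAM.countN, Cmd.wreg, Bool.or_eq_false_iff, beq_eq_false_iff_ne] at hx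
        rw [hf.reg x hx.2]
        simp [hx.1]
      · rw [hf.mem b (by simpa [WordRAM.countN, Cmd.wmem] using hb)]
        rfl
      · rw [hf.out (by simpa [WordRAM.countN, Cmd.quiet] using hq)]
        rfl
    refine Run.mono (K := K + (e.cost + 3)) (Q := fun s'' => (s''.set i (j + 1)).reg a =
      cnt (j + 1) ∧ J (s''.set i (j + 1))) ?_ (by omega) (fun _ _ h => h)
    refine Run.seq (hbody ⟨j, hj⟩ s' hf' hij hI.2) ?_
    rintro s₁ hf₁ ⟨⟨hv1, hv2⟩, hJ₁⟩
    have hra : s₁.reg a = cnt j := by rw [hf₁.reg a hca, hI.1]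
    have hsucc := hcnt_succ ⟨j, hj⟩
    simp only at hsucc
    have hle := hcnt_le (j + 1)
    refine Run.mono (Run.assign (Q := fun s'' => (s''.set i (j + 1)).reg a =
      cnt (j + 1) ∧ J (s''.set i (j + 1))) ⟨?_, hv1, ?_⟩ ⟨?_, hJi _ _ (hJa _ _ hJ₁)⟩)
      (by simp only [Expr.cost]; omega) (fun _ _ h => h)
    · simp only [Expr.Fits]; omega
    · simp only [Expr.eval]; omega
    · simp only [State.set_reg, hai.symm, if_false, if_true, Expr.eval]
      omega
  · rintro s' - ⟨h1, h2⟩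
    refine ⟨?_, h2⟩
    rw [h1]
    simp [cnt, count]

/-- Assign to register `a` the number of values of register `i` below the number in register `0`
for which `e` holds. -/
def sumN (a i : ℕ) (e : Expr) : Cmd := countN a i .skip e

theorem Run.sumN {n a i : ℕ} {e : Expr} {s : State} (P : Fin n → Prop)
    (hW : n + 2 ≤ W) (hi : i ≠ 0) (ha : a ≠ 0) (hai : i ≠ a)
    (hn : s.reg 0 = n) (hu : e.uses a = false) (he : e.cost ≤ 30)
    (hv : ∀ k : Fin n, Val W (s.set i k) e (ind (P k))) :
    Run W (WordRAM.sumN a i e) (60 * (n + 1)) s fun s' => s'.reg a = count P := by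
  refine Run.mono (Run.countN (K := 1) (P := P) (J := fun _ => True) hW hi ha hai rfl rfl rfl hn
    he trivial (fun _ _ _ => trivial) (fun _ _ _ => trivial) ?_)
    (Nat.mul_le_mul_right _ (by omega)) (fun _ _ h => h.1)
  intro k s' hf hik _
  refine Run.skip ⟨?_, trivial⟩
  have hm : s'.mem = (s.set i k).mem := by
    funext b
    rw [hf.mem b (by simp [WordRAM.countN, WordRAM.forN, Cmd.wmem])]
    rfl
  have hr : ∀ y, y ≠ a → s'.reg y = (s.set i k).reg y := by
    intro y hy
    by_cases hyi : y = i
    · subst hyi; simp [hik]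
    · rw [hf.reg y (by simp [WordRAM.countN, WordRAM.forN, Cmd.wreg, hy, hyi])]
      simp [hyi]
  exact ⟨(Expr.fits_congr hm hr e hu).2 (hv k).1, (Expr.eval_congr hm hr e hu).trans (hv k).2⟩

/-- Fill array `a` with the values of `e` after `c`, for all values of register `i` below the
number in register `0`. -/
def fillN (a i : ℕ) (c : Cmd) (e : Expr) : Cmd := forN i (.seq c (.store a (.reg i) e))

theorem Run.fillN {n a i K : ℕ} {c : Cmd} {e : Expr} {s : State} (f : Fin n → ℕ)
    (hW : n + 2 ≤ W) (hi : i ≠ 0)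
    (hci : c.wreg i = false) (hc0 : c.wreg 0 = false) (hca : c.wmem a = false)
    (hn : s.reg 0 = n) (he : e.cost ≤ 30)
    (hbody : ∀ k : Fin n, ∀ s', Frame (WordRAM.fillN a i c e) s s' → s'.reg i = k →
      Run W c K s' fun s'' => Val W s'' e (f k)) :
    Run W (WordRAM.fillN a i c e) ((K + 50) * (n + 1)) s
      fun s' => ∀ k : Fin n, s'.mem a k = f k := by
  refine Run.mono (K := (K + 33 + 12) * (n + 1)) (Q := fun s' => ∀ k : Fin n, s'.mem a k = f k)
    ?_ (Nat.mul_le_mul_right _ (by omega)) (fun _ _ h => h)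
  refine Run.forN (n := n) (K := K + 33)
    (fun j s' => ∀ k : Fin n, (k : ℕ) < j → s'.mem a k = f k) hW hi
    (by simp [Cmd.wreg, hci]) (by simp [Cmd.wreg, hc0]) hn (by simp) ?_
    (fun s' _ h k => h k k.2)
  intro j hj s' hf hij hI
  refine Run.mono (K := K + (e.cost + 3)) (Q := fun s'' => ∀ k : Fin n, (k : ℕ) < j + 1 →
    (s''.set i (j + 1)).mem a k = f k) ?_ (by omega) (fun _ _ h => h)
  refine Run.seq (hbody ⟨j, hj⟩ s' hf hij) ?_
  rintro s₁ hf₁ ⟨hv1, hv2⟩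
  have hri : s₁.reg i = j := by rw [hf₁.reg i hci, hij]
  refine Run.mono (Run.store (Q := fun s'' => ∀ k : Fin n, (k : ℕ) < j + 1 →
    (s''.set i (j + 1)).mem a k = f k) ?_ hv1 ?_)
    (by simp only [Expr.cost]; omega) (fun _ _ h => h)
  · simp only [Expr.Fits]; omega
  · intro k hk
    simp only [State.set_mem, State.put_mem, true_and, Expr.eval, hri, hv2]
    split_ifs with h
    · congr 1
      exact Fin.ext h.symm
    · rw [hf₁.mem a hca]
      exact hI k (by omega)

end WordRAM

namespace CDSEnum

open WordRAM

/-! ### The tests at a node of the search tree -/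

section Program

/-- Adjacency of the vertices in registers `x` and `y`. -/
def adjE (x y : ℕ) : Expr := .read 0 (.add (.mul (.reg x) (.reg 0)) (.reg y))

/-- The vertices in registers `x` and `y` are equal or adjacent. -/
def closedE (x y : ℕ) : Expr := .lt (.const 0) (.add (.eq (.reg x) (.reg y)) (adjE x y))

/-- The vertex in register `x` has status `k`. -/
def statusE (x k : ℕ) : Expr := .eq (.read 1 (.reg x)) (.const k)

/-- The vertex in register `x` has the flag `k` in array `a`. -/
def flagE (a x k : ℕ) : Expr := .eq (.read a (.reg x)) (.const k)

/-- Array `3` becomes the indicator of the closed neighbourhood of the vertices of status `1`. -/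
def domC : Cmd :=
  fillN 3 4 (sumN 10 5 (.mul (statusE 5 1) (closedE 5 4))) (.lt (.const 0) (.reg 10))

/-- Register `11` counts the vertices that can no longer be dominated. -/
def deadC : Cmd :=
  countN 11 4 (sumN 10 5 (.mul (adjE 4 5) (.eq (statusE 5 2) (.const 0))))
    (.mul (flagE 3 4 0) (.eq (.reg 10) (.const 0)))

/-- Array `4` becomes the indicator of the first vertex of status `1`. -/
def startC : Cmd :=
  fillN 4 8 (sumN 10 5 (.mul (statusE 5 1) (.lt (.reg 5) (.reg 8))))
    (.mul (statusE 8 1) (.eq (.reg 10) (.const 0)))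

/-- Put the vertex in register `8` into array `4` if it has status `1` and is adjacent to a
vertex there. -/
def growC : Cmd :=
  .seq (sumN 10 5 (.mul (flagE 4 5 1) (adjE 5 8)))
    (.ite (.mul (statusE 8 1) (.lt (.const 0) (.reg 10))) (.store 4 (.reg 8) (.const 1)) .skip)

/-- Array `4` becomes the indicator of a connected component of the vertices of status `1`. -/
def reachC : Cmd := .seq startC (forN 7 (forN 8 growC))

/-- Tests whether the vertex in register `6` can be removed from the vertices of status `1`. -/
def removeC : Cmd :=
  .seq (.store 1 (.reg 6) (.const 0)) (.seq reachC
    (.seq (sumN 9 5 (.mul (statusE 5 1) (.eq (flagE 4 5 1) (.const 0))))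
      (.seq (countN 18 7 (sumN 10 5 (.mul (statusE 5 1) (closedE 5 7)))
          (.mul (closedE 6 7) (.eq (.reg 10) (.const 0))))
        (.store 1 (.reg 6) (.const 1)))))

/-- Register `12` counts the vertices that can be removed from the vertices of status `1`. -/
def redundantC : Cmd :=
  countN 12 6 (.ite (statusE 6 1) removeC
      (.seq (.assign 9 (.const 1)) (.assign 18 (.const 0))))
    (.mul (.eq (.reg 9) (.const 0)) (.eq (.reg 18) (.const 0)))

variable {n : ℕ} {G : SimpleGraph (Fin n)} {W : ℕ} {s : State}

variable (n G W) in
/-- The state holds the graph `G`, and the status array has entries at most `2`. -/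
structure Env (s : State) : Prop where
  bound : n * n + 20 * n + 100 ≤ W
  size : s.reg 0 = n
  adj : ∀ i j : Fin n, s.mem 0 (i * n + j) = ind (G.Adj i j)
  status : ∀ i : Fin n, s.mem 1 i ≤ 2

theorem Env.frame {s' : State} {c : Cmd} (h : Env n G W s) (hf : Frame c s s')
    (h0 : c.wreg 0 = false) (hm : c.wmem 0 = false) (hs : ∀ i : Fin n, s'.mem 1 i ≤ 2) :
    Env n G W s' :=
  ⟨h.bound, by rw [hf.reg 0 h0, h.size], fun i j => by rw [hf.mem 0 hm, h.adj], hs⟩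

theorem Env.frame' {s' : State} {c : Cmd} (h : Env n G W s) (hf : Frame c s s')
    (h0 : c.wreg 0 = false) (hm : c.wmem 0 = false) (h1 : c.wmem 1 = false) :
    Env n G W s' :=
  h.frame hf h0 hm fun i => by rw [hf.mem 1 h1]; exact h.status i

theorem Env.set (h : Env n G W s) {x k : ℕ} (hx : x ≠ 0) : Env n G W (s.set x k) :=
  ⟨h.bound, by simp [hx.symm, h.size], h.adj, h.status⟩

theorem Env.put (h : Env n G W s) {i k : ℕ} (hk : k ≤ 2) : Env n G W (s.put 1 i k) := by
  refine ⟨h.bound, h.size, fun i j => ?_, fun j => ?_⟩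
  · rw [State.put_mem_ne _ _ _ (by norm_num)]
    exact h.adj i j
  · rw [State.put_mem]
    split_ifs
    · exact hk
    · exact h.status j

theorem Env.lt_bound (h : Env n G W s) (i : Fin n) : (i : ℕ) < W := by
  have := h.bound
  have := i.2
  omega

theorem Env.val_adj (h : Env n G W s) {x y : ℕ} {i j : Fin n} (hx : s.reg x = i)
    (hy : s.reg y = j) : Val W s (adjE x y) (ind (G.Adj i j)) := by
  have hb := h.bound
  have hi : (i : ℕ) * n + j < n * n := by
    calc (i : ℕ) * n + j < i * n + n := by have := j.2; omega
      _ = (i + 1) * n := by ring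
      _ ≤ n * n := Nat.mul_le_mul_right _ i.2
  have := ind_le (G.Adj i j)
  exact Val.read (Val.add (Val.mul (Val.reg hx (h.lt_bound i)) (Val.reg h.size (by omega))
    (by omega)) (Val.reg hy (h.lt_bound j)) (by omega)) (h.adj i j) (by omega)

theorem Env.val_closed (h : Env n G W s) {x y : ℕ} {i j : Fin n} (hx : s.reg x = i)
    (hy : s.reg y = j) : Val W s (closedE x y) (ind (i = j ∨ G.Adj i j)) := by
  have hb := h.bound
  refine Val.or (by omega) ((Val.eq (by omega) (Val.reg hx (h.lt_bound i))
    (Val.reg hy (h.lt_bound j))).congr ?_) (h.val_adj hx hy)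
  exact Fin.ext_iff.symm

theorem Env.val_status (h : Env n G W s) {x k : ℕ} {i : Fin n} (hx : s.reg x = i)
    (hk : k ≤ 2) : Val W s (statusE x k) (ind (s.mem 1 i = k)) := by
  have hb := h.bound
  have := h.status i
  exact Val.eq (by omega) (Val.read (Val.reg hx (h.lt_bound i)) rfl (by omega))
    (Val.const (by omega))

theorem Env.val_flag (h : Env n G W s) {a x k : ℕ} {i : Fin n} (hx : s.reg x = i)
    {p : Prop} (hp : s.mem a i = ind p) (hk : k ≤ 2) :
    Val W s (flagE a x k) (ind (ind p = k)) := by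
  have hb := h.bound
  have := ind_le p
  exact Val.eq (by omega) (Val.read (Val.reg hx (h.lt_bound i)) hp (by omega))
    (Val.const (by omega))

theorem Env.val_zero (h : Env n G W s) {x k : ℕ} (hx : s.reg x = k) (hk : k ≤ n) :
    Val W s (.eq (.reg x) (.const 0)) (ind (k = 0)) := by
  have hb := h.bound
  exact Val.eq (by omega) (Val.reg hx (by omega)) (Val.const (by omega))

theorem Env.val_pos (h : Env n G W s) {x k : ℕ} (hx : s.reg x = k) (hk : k ≤ n) :
    Val W s (.lt (.const 0) (.reg x)) (ind (0 < k)) := by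
  have hb := h.bound
  exact Val.lt (by omega) (Val.const (by omega)) (Val.reg hx (by omega))

theorem Env.val_not (h : Env n G W s) {e : Expr} {p : Prop} (he : Val W s e (ind p)) :
    Val W s (.eq e (.const 0)) (ind (¬ p)) := by
  have hb := h.bound
  exact (Val.eq (by omega) he (Val.const (by omega))).congr (by simp)

theorem Env.bound_one (h : Env n G W s) : 1 < W := by have := h.bound; omega

theorem Env.bound_n (h : Env n G W s) : n + 2 ≤ W := by have := h.bound; omega

theorem run_domC [DecidableRel G.Adj] (h : Env n G W s) {S : Finset (Fin n)}
    (hS : ∀ i : Fin n, s.mem 1 i = 1 ↔ i ∈ S) :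
    Run W domC (110 * (n + 1) ^ 2) s fun s' => ∀ i : Fin n, s'.mem 3 i = ind (i ∈ cl G S) := by
  refine Run.mono (Run.fillN (K := 60 * (n + 1)) (fun i : Fin n => ind (i ∈ cl G S)) h.bound_n
    (by decide) rfl rfl rfl h.size (by decide) ?_) (by nlinarith) (fun _ _ h => h)
  intro k s' hf hk
  have h' : Env n G W s' := h.frame' hf rfl rfl rfl
  refine Run.mono (Run.sumN (fun i => i ∈ S ∧ (i = k ∨ G.Adj i k)) h.bound_n (by decide)
    (by decide) (by decide) h'.size rfl (by decide) ?_) le_rfl ?_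
  · intro i
    have h'' : Env n G W (s'.set 5 i) := h'.set (by decide)
    refine Val.and h.bound_one ((h''.val_status (i := i) (by simp) (by decide)).congr ?_)
      (h''.val_closed (by simp) (by simpa using hk))
    rw [← hS, State.set_mem, hf.mem 1 rfl]
  · intro s'' hf' hr
    have h'' : Env n G W s'' := h'.frame' hf' rfl rfl rfl
    refine (h''.val_pos hr (count_le _)).congr ?_
    rw [Nat.pos_iff_ne_zero, ne_eq, count_eq_zero, mem_cl]
    push Not
    constructor
    · rintro ⟨i, hi, rfl | hik⟩
      · exact Or.inl hi
      · exact Or.inr ⟨i, hi, hik⟩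
    · rintro (hk | ⟨i, hi, hik⟩)
      · exact ⟨k, hk, Or.inl rfl⟩
      · exact ⟨i, hi, Or.inr hik⟩

theorem run_deadC [DecidableRel G.Adj] (h : Env n G W s) {D X : Finset (Fin n)}
    (hX : ∀ i : Fin n, s.mem 1 i = 2 ↔ i ∈ X)
    (hd : ∀ i : Fin n, s.mem 3 i = ind (i ∈ cl G D)) :
    Run W deadC (110 * (n + 1) ^ 2) s
      fun s' => (s'.reg 11 = 0 ↔ ¬ Dead G D X) ∧ s'.reg 11 ≤ n := by
  refine Run.mono (Run.countN (K := 60 * (n + 1)) (J := fun _ => True)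
    (P := fun i : Fin n => i ∉ cl G D ∧ ∀ u, G.Adj i u → u ∈ X) h.bound_n
    (by decide) (by decide) (by decide) rfl rfl rfl h.size (by decide) trivial
    (fun _ _ _ => trivial) (fun _ _ _ => trivial) ?_) (by nlinarith) ?_
  · intro k s' hf hk _
    have h' : Env n G W s' := h.frame' hf rfl rfl rfl
    refine Run.mono (Run.sumN (fun i => G.Adj k i ∧ i ∉ X) h.bound_n (by decide)
      (by decide) (by decide) h'.size rfl (by decide) ?_) le_rfl ?_
    · intro i
      have h'' : Env n G W (s'.set 5 i) := h'.set (by decide)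
      refine Val.and h.bound_one (h''.val_adj (by simpa using hk) (by simp))
        ((h''.val_not (h''.val_status (i := i) (by simp) (by decide))).congr ?_)
      rw [← hX, State.set_mem, hf.mem 1 rfl]
    · intro s'' hf' hr
      have h'' : Env n G W s'' := h'.frame' hf' rfl rfl rfl
      refine ⟨Val.and h.bound_one ((h''.val_flag (i := k) (p := k ∈ cl G D)
        (by rw [hf'.reg 4 rfl, hk]) ?_ (by decide)).congr ?_)
        ((h''.val_zero hr (count_le _)).congr ?_), trivial⟩
      · rw [hf'.mem 3 rfl, hf.mem 3 rfl, hd]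
      · simp
      · rw [count_eq_zero]
        push Not
        rfl
  · rintro s' - ⟨hr, -⟩
    rw [hr, count_eq_zero]
    refine ⟨?_, count_le _⟩
    simp only [Dead, mem_und]
    push Not
    rfl

/-- A subset of `S` that has no edges to the rest of `S`. -/
def ClosedIn (G : SimpleGraph (Fin n)) (S C : Finset (Fin n)) : Prop :=
  ∀ a ∈ C, ∀ b ∈ S, G.Adj a b → b ∈ C

/-- The set `R` grows from the first vertex of `S` along edges of `S`. -/
structure Reached (G : SimpleGraph (Fin n)) (S R : Finset (Fin n)) : Prop where
  sub : R ⊆ S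
  start : ∀ a ∈ S, (∀ b ∈ S, ¬ b < a) → a ∈ R
  least : ∀ C ⊆ S, ClosedIn G S C → (∀ a ∈ S, (∀ b ∈ S, ¬ b < a) → a ∈ C) → R ⊆ C

theorem exists_first {S : Finset (Fin n)} (hS : S.Nonempty) : ∃ a ∈ S, ∀ b ∈ S, ¬ b < a :=
  ⟨S.min' hS, S.min'_mem hS, fun b hb => not_lt.2 (S.min'_le b hb)⟩

/-- A closed `R` is the component of the first vertex. If it is all of `S`, a closed set either
contains that vertex, hence everything, or its complement does, so the set is empty. -/
theorem Reached.cutConnected_iff {S R : Finset (Fin n)} (h : Reached G S R)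
    (hc : ClosedIn G S R) (hS : S.Nonempty) : (∀ a ∈ S, a ∈ R) ↔ CutConnected G S := by
  obtain ⟨a₀, ha₀, hmin⟩ := exists_first hS
  have hfirst : ∀ a ∈ S, (∀ b ∈ S, ¬ b < a) → a = a₀ := fun a ha hb =>
    le_antisymm (not_lt.1 (hb a₀ ha₀)) (not_lt.1 (hmin a ha))
  constructor
  · intro hall
    refine ⟨hS, fun C hCS hC hcl => ?_⟩
    by_cases ha : a₀ ∈ C
    · intro b hb
      exact h.least C hCS hcl (fun a ha' hb' => (hfirst a ha' hb').symm ▸ ha) (hall b hb)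
    · exfalso
      obtain ⟨c, hc'⟩ := hC
      have := h.least (S \ C) Finset.sdiff_subset (by
        intro a ha b hb hab
        obtain ⟨h1, h2⟩ := Finset.mem_sdiff.1 ha
        refine Finset.mem_sdiff.2 ⟨hb, fun hbC => h2 (hcl b hbC a h1 hab.symm)⟩)
        (fun a ha' hb' => by
          rw [hfirst a ha' hb']
          exact Finset.mem_sdiff.2 ⟨ha₀, ha⟩) (hall c (hCS hc'))
      exact (Finset.mem_sdiff.1 this).2 hc'
  · intro hconn
    exact hconn.2 R h.sub ⟨a₀, h.start a₀ ha₀ hmin⟩ hc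

theorem run_startC (h : Env n G W s) {S : Finset (Fin n)}
    (hS : ∀ i : Fin n, s.mem 1 i = 1 ↔ i ∈ S) :
    Run W startC (110 * (n + 1) ^ 2) s
      fun s' => ∀ i : Fin n, s'.mem 4 i = ind (i ∈ S ∧ ∀ b ∈ S, ¬ b < i) := by
  refine Run.mono (Run.fillN (K := 60 * (n + 1))
    (fun i : Fin n => ind (i ∈ S ∧ ∀ b ∈ S, ¬ b < i)) h.bound_n
    (by decide) rfl rfl rfl h.size (by decide) ?_) (by nlinarith) (fun _ _ h => h)
  intro k s' hf hk
  have h' : Env n G W s' := h.frame' hf rfl rfl rfl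
  refine Run.mono (Run.sumN (fun i => i ∈ S ∧ i < k) h.bound_n (by decide)
    (by decide) (by decide) h'.size rfl (by decide) ?_) le_rfl ?_
  · intro i
    have h'' : Env n G W (s'.set 5 i) := h'.set (by decide)
    refine Val.and h.bound_one ((h''.val_status (i := i) (by simp) (by decide)).congr ?_)
      ((Val.lt h.bound_one (Val.reg (k := i) (by simp) (h''.lt_bound i))
        (Val.reg (k := k) (by simpa using hk) (h''.lt_bound k))).congr Fin.lt_def.symm)
    rw [← hS, State.set_mem, hf.mem 1 rfl]
  · intro s'' hf' hr
    have h'' : Env n G W s'' := h'.frame' hf' rfl rfl rfl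
    refine Val.and h.bound_one ((h''.val_status (i := k) (by rw [hf'.reg 8 rfl, hk])
      (by decide)).congr ?_) ((h''.val_zero hr (count_le _)).congr ?_)
    · rw [← hS, hf'.mem 1 rfl, hf.mem 1 rfl]
    · rw [count_eq_zero]
      push Not
      rfl

theorem run_growC (h : Env n G W s) {S R : Finset (Fin n)} {k : Fin n}
    (hS : ∀ i : Fin n, s.mem 1 i = 1 ↔ i ∈ S) (hk : s.reg 8 = k)
    (hR : ∀ i : Fin n, s.mem 4 i = ind (i ∈ R)) (hr : Reached G S R) :
    Run W growC (100 * (n + 1)) s fun s' => ∃ R', (∀ i : Fin n, s'.mem 4 i = ind (i ∈ R')) ∧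
      Reached G S R' ∧ R ⊆ R' ∧ (k ∈ S → (∃ a ∈ R, G.Adj a k) → k ∈ R') := by
  refine Run.mono (K := 60 * (n + 1) + 20) (Run.seq (Run.sumN (fun i => i ∈ R ∧ G.Adj i k)
    h.bound_n (by decide) (by decide) (by decide) h.size rfl (by decide) ?_) (L := 20) ?_)
    (by omega) (fun _ _ h => h)
  · intro i
    have h'' : Env n G W (s.set 5 i) := h.set (by decide)
    exact Val.and h.bound_one ((h''.val_flag (i := i) (by simp) (hR i) (by decide)).congr
      (by simp)) (h''.val_adj (by simp) (by simpa using hk))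
  · intro s' hf hc
    have h' : Env n G W s' := h.frame' hf rfl rfl rfl
    have hk' : s'.reg 8 = k := by rw [hf.reg 8 rfl, hk]
    have hv : Val W s' (.mul (statusE 8 1) (.lt (.const 0) (.reg 10)))
        (ind (k ∈ S ∧ ∃ a ∈ R, G.Adj a k)) := by
      refine Val.and h.bound_one ((h'.val_status hk' (by decide)).congr ?_)
        ((h'.val_pos hc (count_le _)).congr ?_)
      · rw [← hS, hf.mem 1 rfl]
      · rw [Nat.pos_iff_ne_zero, ne_eq, count_eq_zero]
        push Not
        rfl
    refine Run.mono (Run.ite (K := 3) hv.1 ?_ ?_) (by decide) (fun _ _ h => h)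
    · intro hne
      rw [hv.2, ne_eq, ind_eq_zero, not_not] at hne
      refine Run.store (Q := fun s' => ∃ R', (∀ i : Fin n, s'.mem 4 i = ind (i ∈ R')) ∧
        Reached G S R' ∧ R ⊆ R' ∧ (k ∈ S → (∃ a ∈ R, G.Adj a k) → k ∈ R'))
        (Val.reg hk' (h.lt_bound k)).1 (Val.const h.bound_one).1
        ⟨insert k R, fun i => ?_, ⟨?_, ?_, ?_⟩, Finset.subset_insert _ _, fun _ _ => by simp⟩
      · simp only [Expr.eval, hk', State.put_mem, true_and]
        split_ifs with hik
        · rw [ind_true]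
          rw [Fin.ext hik]
          simp
        · rw [hf.mem 4 rfl, hR]
          refine ind_congr ?_
          have : i ≠ k := fun h => hik (by rw [h])
          simp [this]
      · exact Finset.insert_subset hne.1 hr.sub
      · exact fun a ha hb => Finset.mem_insert_of_mem (hr.start a ha hb)
      · intro C hCS hC hst
        have hRC := hr.least C hCS hC hst
        obtain ⟨hkS, a, ha, hak⟩ := hne
        exact Finset.insert_subset (hC a (hRC ha) k hkS hak) hRC
    · intro he
      rw [hv.2, ind_eq_zero] at he
      refine Run.mono (Run.skip (Q := fun s' => ∃ R',
        (∀ i : Fin n, s'.mem 4 i = ind (i ∈ R')) ∧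
        Reached G S R' ∧ R ⊆ R' ∧ (k ∈ S → (∃ a ∈ R, G.Adj a k) → k ∈ R'))
        ⟨R, fun i => by rw [hf.mem 4 rfl, hR], hr, subset_rfl, ?_⟩) (by decide) (fun _ _ h => h)
      exact fun h1 h2 => absurd ⟨h1, h2⟩ he

/-- If `R` is already closed, leastness prevents growth. Otherwise some edge leaves `R` within `S`,
and the round adds at least its endpoint. -/
theorem run_round (h : Env n G W s) {S R : Finset (Fin n)}
    (hS : ∀ i : Fin n, s.mem 1 i = 1 ↔ i ∈ S)
    (hR : ∀ i : Fin n, s.mem 4 i = ind (i ∈ R)) (hr : Reached G S R) :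
    Run W (forN 8 growC) (112 * (n + 1) ^ 2) s fun s' => ∃ R',
      (∀ i : Fin n, s'.mem 4 i = ind (i ∈ R')) ∧ Reached G S R' ∧
      (ClosedIn G S R' ∨ R.card + 1 ≤ R'.card) := by
  refine Run.mono (Run.forN (n := n) (K := 100 * (n + 1)) (fun j s' => ∃ R',
    (∀ i : Fin n, s'.mem 4 i = ind (i ∈ R')) ∧ Reached G S R' ∧ R ⊆ R' ∧
      ∀ k : Fin n, (k : ℕ) < j → k ∈ S → (∃ a ∈ R, G.Adj a k) → k ∈ R') h.bound_n (by decide)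
    rfl rfl h.size ⟨R, hR, hr, subset_rfl, by simp⟩ ?_ (Q := fun s' => ∃ R',
      (∀ i : Fin n, s'.mem 4 i = ind (i ∈ R')) ∧ Reached G S R' ∧
      (ClosedIn G S R' ∨ R.card + 1 ≤ R'.card)) ?_) (by nlinarith) (fun _ _ h => h)
  · rintro j hj s' hf hij ⟨R₁, h1, h2, h3, h4⟩
    refine Run.mono (run_growC (k := ⟨j, hj⟩) (h.frame' hf rfl rfl rfl)
      (fun i => by rw [hf.mem 1 rfl, hS]) hij h1 h2) le_rfl ?_
    rintro s'' - ⟨R', h5, h6, h7, h8⟩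
    refine ⟨R', h5, h6, h3.trans h7, fun k hk hkS ⟨a, ha, hak⟩ => ?_⟩
    rcases Nat.lt_succ_iff_lt_or_eq.1 hk with hk | hk
    · exact h7 (h4 k hk hkS ⟨a, ha, hak⟩)
    · have : k = ⟨j, hj⟩ := Fin.ext hk
      rw [← this] at h8
      exact h8 hkS ⟨a, h3 ha, hak⟩
  · rintro s' - ⟨R', h1, h2, h3, h4⟩
    refine ⟨R', h1, h2, ?_⟩
    by_cases hc : ClosedIn G S R
    · left
      have : R' = R := Finset.Subset.antisymm (h2.least R hr.sub hc hr.start) h3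
      rwa [this]
    · right
      unfold ClosedIn at hc
      push Not at hc
      obtain ⟨a, ha, b, hb, hab, hbR⟩ := hc
      refine Finset.card_lt_card ((Finset.ssubset_iff_of_subset h3).2 ⟨b, ?_, hbR⟩)
      exact h4 b b.2 hb ⟨a, ha, hab⟩

theorem run_reachC (h : Env n G W s) {S : Finset (Fin n)}
    (hS : ∀ i : Fin n, s.mem 1 i = 1 ↔ i ∈ S) :
    Run W reachC (250 * (n + 1) ^ 3) s fun s' => ∃ R,
      (∀ i : Fin n, s'.mem 4 i = ind (i ∈ R)) ∧ Reached G S R ∧ ClosedIn G S R := by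
  classical
  refine Run.mono (K := 110 * (n + 1) ^ 2 + (112 * (n + 1) ^ 2 + 12) * (n + 1))
    (Run.seq (run_startC h hS) ?_) (by nlinarith [sq_nonneg (n + 1 : ℤ)]) (fun _ _ h => h)
  intro s₁ hf₁ hstart
  have h₁ : Env n G W s₁ := h.frame' hf₁ rfl rfl rfl
  let R₀ : Finset (Fin n) := S.filter fun i => ∀ b ∈ S, ¬ b < i
  have hR₀ : Reached G S R₀ := by
    refine ⟨Finset.filter_subset _ _, fun a ha hb => Finset.mem_filter.2 ⟨ha, hb⟩, ?_⟩
    intro C _ _ hst a ha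
    obtain ⟨h1, h2⟩ := Finset.mem_filter.1 ha
    exact hst a h1 h2
  refine Run.forN (n := n) (fun j s' => ∃ R, (∀ i : Fin n, s'.mem 4 i = ind (i ∈ R)) ∧
    Reached G S R ∧ (ClosedIn G S R ∨ R₀.card + j ≤ R.card)) h.bound_n (by decide) rfl rfl
    h₁.size ⟨R₀, fun i => ?_, hR₀, Or.inr le_rfl⟩ ?_ ?_
  · rw [State.set_mem, hstart]
    exact ind_congr (by simp [R₀])
  · rintro j hj s' hf hij ⟨R, hR, hr, hcase⟩
    refine Run.mono (run_round (h₁.frame' hf rfl rfl rfl)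
      (fun i => by rw [hf.mem 1 rfl, hf₁.mem 1 rfl, hS]) hR hr) le_rfl ?_
    rintro s'' - ⟨R', h1, h2, h3⟩
    refine ⟨R', h1, h2, ?_⟩
    rcases hcase with hc | hc
    · rcases h3 with h3 | h3
      · exact Or.inl h3
      · have := Finset.card_le_card (h2.least R hr.sub hc hr.start)
        omega
    · rcases h3 with h3 | h3
      · exact Or.inl h3
      · right
        omega
  · rintro s' - ⟨R, hR, hr, hcase⟩
    refine ⟨R, hR, hr, ?_⟩
    rcases hcase with hc | hc
    · exact hc
    -- If no round reached closure, the initial vertex and `n` strict increases would give more than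
    -- `n` elements. For empty `S` there is no initial vertex, but closure is vacuous.
    · rcases S.eq_empty_or_nonempty with rfl | hne
      · have : R = ∅ := Finset.subset_empty.1 hr.sub
        subst this
        intro a ha
        simp at ha
      · exfalso
        obtain ⟨a, ha, hmin⟩ := exists_first hne
        have h1 : 0 < R₀.card := Finset.card_pos.2 ⟨a, Finset.mem_filter.2 ⟨ha, hmin⟩⟩
        have h2 := Finset.card_le_univ R
        rw [Fintype.card_fin] at h2
        omega

end Program

end CDSEnum

/-! ### The redundancy test -/

namespace CDSEnum

open WordRAM

section Program

variable {n : ℕ} {G : SimpleGraph (Fin n)} {W : ℕ} {s : State}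

theorem run_removeC [DecidableRel G.Adj] (h : Env n G W s) {S : Finset (Fin n)} {v : Fin n}
    (hS : ∀ i : Fin n, s.mem 1 i = 1 ↔ i ∈ S) (hv : v ∈ S) (hrv : s.reg 6 = v) :
    Run W removeC (500 * (n + 1) ^ 3) s fun s' =>
      Val W s' (.mul (.eq (.reg 9) (.const 0)) (.eq (.reg 18) (.const 0)))
        (ind (CutConnected G (S.erase v) ∧
          ∀ w, w = v ∨ G.Adj v w → w ∈ cl G (S.erase v))) ∧ s'.mem 1 = s.mem 1 := by
  refine Run.mono (K := 3 + (250 * (n + 1) ^ 3 + (60 * (n + 1) +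
    ((60 * (n + 1) + 50) * (n + 1) + 3)))) ?_ (by
      have : 1 ≤ n + 1 := by omega
      nlinarith [Nat.mul_le_mul this this, Nat.mul_le_mul (Nat.mul_le_mul this this) this])
    (fun _ _ h => h)
  refine Run.seq (P := fun s₁ => s₁ = s.put 1 v 0) (Run.store
    (Val.reg hrv (h.lt_bound v)).1 (Val.const (by have := h.bound_one; omega)).1
    (by simp [Expr.eval, hrv])) ?_
  rintro s₁ - rfl
  have h₁ : Env n G W (s.put 1 v 0) := h.put (by omega)
  have hS₁ : ∀ i : Fin n, (s.put 1 v 0).mem 1 i = 1 ↔ i ∈ S.erase v := by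
    intro i
    rw [State.put_mem, Finset.mem_erase]
    by_cases hi : i = v
    · simp [hi]
    · have : (i : ℕ) ≠ v := fun h => hi (Fin.ext h)
      simp [hi, this, hS]
  have hr₁ : (s.put 1 v 0).reg 6 = v := hrv
  have hback : ∀ s₂ : State, s₂.mem 1 = (s.put 1 v 0).mem 1 →
      (s₂.put 1 v 1).mem 1 = s.mem 1 := by
    intro s₂ h2
    funext j
    rw [State.put_mem, h2, State.put_mem]
    by_cases hj : j = v
    · simp [hj, (hS v).2 hv]
    · simp [hj]
  generalize s.put 1 v 0 = s₁ at *
  refine Run.seq (run_reachC h₁ hS₁) ?_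
  rintro s₂ hf₂ ⟨R, hR, hr, hc⟩
  have h₂ : Env n G W s₂ := h₁.frame' hf₂ rfl rfl rfl
  refine Run.seq (Run.sumN (fun i => i ∈ S.erase v ∧ i ∉ R) h.bound_n (by decide) (by decide)
    (by decide) h₂.size rfl (by decide) ?_) ?_
  · intro i
    have h' : Env n G W (s₂.set 5 i) := h₂.set (by decide)
    refine Val.and h.bound_one ((h'.val_status (i := i) (by simp) (by decide)).congr ?_)
      ((h'.val_not (h'.val_flag (i := i) (by simp) (hR i) (by decide))).congr (by simp))
    rw [← hS₁, State.set_mem, hf₂.mem 1 rfl]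
  intro s₃ hf₃ h9
  have h₃ : Env n G W s₃ := h₂.frame' hf₃ rfl rfl rfl
  refine Run.seq (Run.countN (K := 60 * (n + 1)) (J := fun _ => True)
    (P := fun w : Fin n => (v = w ∨ G.Adj v w) ∧ w ∉ cl G (S.erase v)) h.bound_n
    (by decide) (by decide) (by decide) rfl rfl rfl h₃.size (by decide) trivial
    (fun _ _ _ => trivial) (fun _ _ _ => trivial) ?_) ?_
  · intro w s' hf hw _
    have h' : Env n G W s' := h₃.frame' hf rfl rfl rfl
    refine Run.mono (Run.sumN (fun i => i ∈ S.erase v ∧ (i = w ∨ G.Adj i w)) h.bound_n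
      (by decide) (by decide) (by decide) h'.size rfl (by decide) ?_) le_rfl ?_
    · intro i
      have h'' : Env n G W (s'.set 5 i) := h'.set (by decide)
      refine Val.and h.bound_one ((h''.val_status (i := i) (by simp) (by decide)).congr ?_)
        (h''.val_closed (by simp) (by simpa using hw))
      rw [← hS₁, State.set_mem, hf.mem 1 rfl, hf₃.mem 1 rfl, hf₂.mem 1 rfl]
    · intro s'' hf' hr
      have h'' : Env n G W s'' := h'.frame' hf' rfl rfl rfl
      refine ⟨Val.and h.bound_one (h''.val_closed (by
        rw [hf'.reg 6 rfl, hf.reg 6 rfl, hf₃.reg 6 rfl, hf₂.reg 6 rfl, hr₁])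
        (by rw [hf'.reg 7 rfl, hw])) ((h''.val_zero hr (count_le _)).congr ?_), trivial⟩
      rw [count_eq_zero, mem_cl]
      constructor
      · rintro hno (hw | ⟨u, hu, huw⟩)
        · exact hno w ⟨hw, Or.inl rfl⟩
        · exact hno u ⟨hu, Or.inr huw⟩
      · rintro hno i ⟨hi, rfl | hiw⟩
        · exact hno (Or.inl hi)
        · exact hno (Or.inr ⟨i, hi, hiw⟩)
  rintro s₄ hf₄ ⟨h18, -⟩
  have h₄ : Env n G W s₄ := h₃.frame' hf₄ rfl rfl rfl
  have hr₄ : s₄.reg 6 = v := by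
    rw [hf₄.reg 6 rfl, hf₃.reg 6 rfl, hf₂.reg 6 rfl, hr₁]
  refine Run.store (Val.reg hr₄ (h.lt_bound v)).1 (Val.const h.bound_one).1 ⟨?_, ?_⟩
  · rw [← hf₄.reg 9 rfl] at h9
    have h₅ : Env n G W (s₄.put 1 ((Expr.reg 6).eval s₄) ((Expr.const 1).eval s₄)) :=
      h₄.put (by simp [Expr.eval])
    refine (Val.and h.bound_one (h₅.val_zero (by simpa using h9) (count_le _))
      (h₅.val_zero (by simpa using h18) (count_le _))).congr ?_
    rw [count_eq_zero, count_eq_zero]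
    have hdom : (∀ i, ¬ ((v = i ∨ G.Adj v i) ∧ i ∉ cl G (S.erase v))) ↔
        ∀ w, w = v ∨ G.Adj v w → w ∈ cl G (S.erase v) := by
      refine forall_congr' fun w => ?_
      rw [not_and, not_not, eq_comm]
    rw [hdom]
    by_cases hne : (S.erase v).Nonempty
    · refine and_congr_left fun _ => ?_
      rw [← hr.cutConnected_iff hc hne]
      refine forall_congr' fun w => ?_
      rw [not_and, not_not, Finset.mem_erase]
    · rw [Finset.not_nonempty_iff_eq_empty] at hne
      rw [hne]
      -- For `S = {v}` the reachability test succeeds vacuously although the empty set is not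
      -- connected. The domination test fails at `v`, so the product is still correct.
      have hno : ¬ ∀ w, w = v ∨ G.Adj v w → w ∈ cl G (∅ : Finset (Fin n)) := fun hall => by
        have := hall v (Or.inl rfl)
        simp [mem_cl] at this
      tauto
  · have : (Expr.reg 6).eval s₄ = v := hr₄
    rw [this]
    exact hback s₄ (by rw [hf₄.mem 1 rfl, hf₃.mem 1 rfl, hf₂.mem 1 rfl])

theorem run_redundantC [DecidableRel G.Adj] (h : Env n G W s) {S : Finset (Fin n)}
    (hS : ∀ i : Fin n, s.mem 1 i = 1 ↔ i ∈ S) :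
    Run W redundantC (600 * (n + 1) ^ 4) s fun s' =>
      (0 < s'.reg 12 ↔ Redundant G S) ∧ s'.reg 12 ≤ n ∧ s'.mem 1 = s.mem 1 := by
  refine Run.mono (Run.countN (K := 500 * (n + 1) ^ 3 + 10) (J := fun s' => s'.mem 1 = s.mem 1)
    (P := fun v : Fin n => v ∈ S ∧ CutConnected G (S.erase v) ∧
      ∀ w, w = v ∨ G.Adj v w → w ∈ cl G (S.erase v)) h.bound_n
    (by decide) (by decide) (by decide) rfl rfl rfl h.size (by decide) rfl
    (fun _ _ h => h) (fun _ _ h => h) ?_) (by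
      have : 1 ≤ n + 1 := by omega
      have h3 : 1 ≤ (n + 1) ^ 3 := Nat.one_le_pow _ _ this
      nlinarith) ?_
  · intro v s' hf hv hJ
    have h' : Env n G W s' := h.frame hf rfl rfl fun i => by rw [hJ]; exact h.status i
    have hv6 := h'.val_status hv (k := 1) (by decide)
    have h3 : 1 ≤ (n + 1) ^ 3 := Nat.one_le_pow _ _ (by omega)
    refine Run.mono (Run.ite (K := 500 * (n + 1) ^ 3) hv6.1 ?_ ?_)
      (by simp only [statusE, Expr.cost]; omega) (fun _ _ h => h)
    · intro hne
      rw [hv6.2, ne_eq, ind_eq_zero, not_not, hJ, hS] at hne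
      refine Run.mono (run_removeC h' (fun i => by rw [hJ, hS]) hne hv) le_rfl ?_
      rintro s'' - ⟨h1, h2⟩
      refine ⟨h1.congr ?_, h2.trans hJ⟩
      tauto
    · intro he
      rw [hv6.2, ind_eq_zero, hJ, hS] at he
      -- A nonzero register `9` marks failure, so a vertex outside `S` is not counted as removable.
      refine Run.mono (K := 2 + 2) (Run.seq (P := fun s₁ => s₁ = s'.set 9 1)
        (Run.assign (Val.const h.bound_one).1 rfl) (Q := fun s'' => s'' = (s'.set 9 1).set 18 0)
        ?_) (by omega) ?_
      · rintro _ - rfl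
        exact Run.assign (Val.const (by have := h.bound_one; omega)).1 rfl
      · rintro _ - rfl
        have h'' : Env n G W ((s'.set 9 1).set 18 0) := (h'.set (by decide)).set (by decide)
        refine ⟨(Val.and h.bound_one (Val.eq (a := 1) (b := 0) h.bound_one
          (Val.reg (by simp) h.bound_one) (Val.const (by have := h.bound_one; omega)))
          (h''.val_zero (k := 0) (by simp) (by omega))).congr ?_, hJ⟩
        simp [he]
  · rintro s' - ⟨h1, h2⟩
    refine ⟨?_, h1 ▸ count_le _, h2⟩
    rw [h1, Nat.pos_iff_ne_zero, ne_eq, count_eq_zero]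
    push Not
    rfl

/-! ### The choice of the branching vertex -/

open Classical in
variable (G) in
/-- The priority of a vertex in the choice of the branching vertex. -/
noncomputable def key [DecidableRel G.Adj] (D X : Finset (Fin n)) (v : Fin n) : ℕ :=
  if v ∈ fr G D X then gain G D v + 1 + ind (Redundant G (insert v D)) * (n + 1) else 0

variable (G) in
/-- The largest priority among the first `j` vertices and the first vertex that has it. -/
noncomputable def best [DecidableRel G.Adj] (D X : Finset (Fin n)) : ℕ → ℕ × ℕ
  | 0 => (0, 0)
  | j + 1 => if h : j < n then
      (if (best D X j).1 < key G D X ⟨j, h⟩ then (key G D X ⟨j, h⟩, j) else best D X j)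
    else best D X j

variable (G) in
/-- The branching vertex. -/
noncomputable def choose [DecidableRel G.Adj] (r : Fin n) (D X : Finset (Fin n)) : Fin n :=
  if h : (best G D X n).2 < n then ⟨(best G D X n).2, h⟩ else r

theorem best_spec [DecidableRel G.Adj] (D X : Finset (Fin n)) {j : ℕ} (hj : j ≤ n) :
    (∀ v : Fin n, (v : ℕ) < j → key G D X v ≤ (best G D X j).1) ∧
    ((best G D X j).1 ≠ 0 → ∃ v : Fin n, (v : ℕ) = (best G D X j).2 ∧
      key G D X v = (best G D X j).1) := by
  induction j with
  | zero => simp [best]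
  | succ j ih =>
    obtain ⟨h1, h2⟩ := ih (by omega)
    have hjn : j < n := by omega
    rw [best, dif_pos hjn]
    split_ifs with hlt
    · refine ⟨fun v hv => ?_, fun _ => ⟨⟨j, hjn⟩, rfl, rfl⟩⟩
      rcases Nat.lt_succ_iff_lt_or_eq.1 hv with hv | hv
      · exact (h1 v hv).trans hlt.le
      · rw [show v = ⟨j, hjn⟩ from Fin.ext hv]
    · refine ⟨fun v hv => ?_, h2⟩
      rcases Nat.lt_succ_iff_lt_or_eq.1 hv with hv | hv
      · exact h1 v hv
      · rw [show v = ⟨j, hjn⟩ from Fin.ext hv]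
        omega

theorem gain_le [DecidableRel G.Adj] (D : Finset (Fin n)) (v : Fin n) : gain G D v ≤ n := by
  have := Finset.card_le_univ ((und G D).filter (G.Adj v))
  rwa [Fintype.card_fin] at this

theorem best_eq_zero_iff [DecidableRel G.Adj] (D X : Finset (Fin n)) :
    (best G D X n).1 = 0 ↔ fr G D X = ∅ := by
  obtain ⟨h1, h2⟩ := best_spec (G := G) D X le_rfl
  constructor
  · intro h0
    rw [Finset.eq_empty_iff_forall_notMem]
    intro v hv
    have := h1 v v.2
    rw [key, if_pos hv] at this
    omega
  · intro he
    by_contra hne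
    obtain ⟨v, -, hv⟩ := h2 hne
    rw [key, he, if_neg (by simp)] at hv
    exact hne hv.symm

theorem best_choose [DecidableRel G.Adj] (r : Fin n) {D X : Finset (Fin n)}
    (h : (fr G D X).Nonempty) : ((choose G r D X : Fin n) : ℕ) = (best G D X n).2 ∧
      key G D X (choose G r D X) = (best G D X n).1 := by
  obtain ⟨-, h2⟩ := best_spec (G := G) D X le_rfl
  obtain ⟨v, hv, hk⟩ := h2 (fun h0 => h.ne_empty ((best_eq_zero_iff D X).1 h0))
  have hlt : (best G D X n).2 < n := hv ▸ v.2
  have hc : choose G r D X = v := by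
    rw [choose, dif_pos hlt]
    exact Fin.ext hv.symm
  rw [hc]
  exact ⟨hv, hk⟩

/-- Gains are at most `n`, so the bonus `n + 1` ranks every redundant inclusion above all others.
The additional `1` separates frontier vertices from the priority zero of the rest. The vertex `r` is
only a default. -/
theorem isChoice_choose [DecidableRel G.Adj] (r : Fin n) : IsChoice G (choose G r) := by
  intro D X hne
  obtain ⟨h1, -⟩ := best_spec (G := G) D X le_rfl
  obtain ⟨-, hk⟩ := best_choose r hne
  set v := choose G r D X
  have hv : v ∈ fr G D X := by
    by_contra hv
    rw [key, if_neg hv] at hk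
    exact hne.ne_empty ((best_eq_zero_iff D X).1 hk.symm)
  refine ⟨hv, ?_⟩
  by_cases hred : Redundant G (insert v D)
  · exact Or.inl hred
  · right
    rw [key, if_pos hv, ind_false hred] at hk
    have hg := gain_le (G := G) D v
    constructor
    · intro u hu hru
      have := h1 u u.2
      rw [key, if_pos hu, ind_true hru] at this
      omega
    · intro u hu
      have := h1 u u.2
      rw [key, if_pos hu] at this
      omega

/-- The threshold `n + 1` recovers redundancy from the priority, so `pushC` need not test it again.
-/
theorem best_lt_iff [DecidableRel G.Adj] (r : Fin n) {D X : Finset (Fin n)}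
    (h : (fr G D X).Nonempty) :
    n + 1 < (best G D X n).1 ↔ Redundant G (insert (choose G r D X) D) := by
  obtain ⟨-, hk⟩ := best_choose r h
  have hv := (isChoice_choose r D X h).1
  rw [key, if_pos hv] at hk
  have hg := gain_le (G := G) D (choose G r D X)
  by_cases hred : Redundant G (insert (choose G r D X) D)
  · rw [ind_true hred] at hk
    simp only [hred, iff_true]
    omega
  · rw [ind_false hred] at hk
    simp only [hred, iff_false]
    omega

theorem best_le [DecidableRel G.Adj] (D X : Finset (Fin n)) {j : ℕ} (hj : j ≤ n) :
    (best G D X j).1 ≤ 2 * n + 2 ∧ (best G D X j).2 ≤ n := by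
  induction j with
  | zero => simp [best]
  | succ j ih =>
    have ih := ih (by omega)
    rw [best, dif_pos (by omega)]
    split_ifs
    · refine ⟨?_, by simp only; omega⟩
      simp only [key]
      have hg := gain_le (G := G) D ⟨j, by omega⟩
      split_ifs
      · have := ind_le (Redundant G (insert (⟨j, by omega⟩ : Fin n) D))
        have h2 : ind (Redundant G (insert (⟨j, by omega⟩ : Fin n) D)) * (n + 1) ≤
          1 * (n + 1) := Nat.mul_le_mul_right _ this
        omega
      · omega
    · exact ih

/-- Compare the priority of the vertex in register `4` with the largest one so far. -/
def compareC : Cmd :=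
  .seq (sumN 15 5 (.mul (adjE 4 5) (flagE 3 5 0)))
    (.seq (.store 1 (.reg 4) (.const 1)) (.seq redundantC (.seq (.store 1 (.reg 4) (.const 0))
      (.seq (.assign 15 (.add (.add (.reg 15) (.const 1))
          (.mul (.lt (.const 0) (.reg 12)) (.add (.reg 0) (.const 1)))))
        (.ite (.lt (.reg 13) (.reg 15))
          (.seq (.assign 13 (.reg 15)) (.assign 14 (.reg 4))) .skip)))))

/-- Registers `13` and `14` receive the largest priority and the branching vertex. -/
def selectC : Cmd :=
  .seq (.assign 13 (.const 0)) (.seq (.assign 14 (.const 0))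
    (forN 4 (.ite (.mul (statusE 4 0) (flagE 3 4 1)) compareC .skip)))

variable (n) in
/-- The status array represents the state `(D, X)` of the search. -/
def Status (D X : Finset (Fin n)) (s : State) : Prop :=
  ∀ i : Fin n, s.mem 1 i = if i ∈ D then 1 else if i ∈ X then 2 else 0

theorem Status.mem_left {D X : Finset (Fin n)} (h : Status n D X s) (i : Fin n) :
    s.mem 1 i = 1 ↔ i ∈ D := by
  rw [h i]
  split_ifs <;> simp_all

theorem Status.mem_right {D X : Finset (Fin n)} (h : Status n D X s) (hD : Disjoint D X)
    (i : Fin n) : s.mem 1 i = 2 ↔ i ∈ X := by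
  rw [h i]
  split_ifs with h1 h2
  · simp [Finset.disjoint_left.1 hD h1]
  · simp [h2]
  · simp [h2]

theorem Status.mem_none {D X : Finset (Fin n)} (h : Status n D X s) (i : Fin n) :
    s.mem 1 i = 0 ↔ i ∉ D ∧ i ∉ X := by
  rw [h i]
  split_ifs <;> simp_all

/-- The vertex is included only for the test. Its status was zero because it is in the frontier, so
writing zero afterwards restores the array. -/
theorem run_compareC [DecidableRel G.Adj] (h : Env n G W s) {D X : Finset (Fin n)} {v : Fin n}
    (hst : Status n D X s) (hd : ∀ i : Fin n, s.mem 3 i = ind (i ∈ cl G D))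
    (hr : s.reg 4 = v) (hv : v ∈ fr G D X) {b c : ℕ} (hb : s.reg 13 = b)
    (hbW : b ≤ 2 * n + 2) (hc : s.reg 14 = c) :
    Run W compareC (700 * (n + 1) ^ 4) s fun s' => s'.mem 1 = s.mem 1 ∧
      s'.reg 13 = (if b < key G D X v then key G D X v else b) ∧
      s'.reg 14 = (if b < key G D X v then (v : ℕ) else c) := by
  have hW := h.bound
  refine Run.mono (K := 60 * (n + 1) + (3 + (600 * (n + 1) ^ 4 + (3 + (15 + 15))))) ?_ (by
      have h1 : 1 ≤ n + 1 := by omega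
      have h3 : n + 1 ≤ (n + 1) ^ 4 := Nat.le_self_pow (by omega) _
      nlinarith) (fun _ _ h => h)
  refine Run.seq (Run.sumN (fun i => G.Adj v i ∧ i ∉ cl G D) h.bound_n (by decide) (by decide)
    (by decide) h.size rfl (by decide) ?_) ?_
  · intro i
    have h' : Env n G W (s.set 5 i) := h.set (by decide)
    exact Val.and h.bound_one (h'.val_adj (by simpa using hr) (by simp))
      ((h'.val_flag (i := i) (by simp) (hd i) (by decide)).congr (by simp))
  intro s₁ hf₁ h15
  have hgain : count (fun i => G.Adj v i ∧ i ∉ cl G D) = gain G D v := by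
    rw [count_eq_card, gain]
    congr 1
    ext i
    simp [mem_und, and_comm]
  rw [hgain] at h15
  have h₁ : Env n G W s₁ := h.frame' hf₁ rfl rfl rfl
  have hr₁ : s₁.reg 4 = v := by rw [hf₁.reg 4 rfl, hr]
  obtain ⟨hv1, hv2, hv3⟩ := mem_fr.1 hv
  refine Run.seq (K := 3) (P := fun s₂ => s₂ = s₁.put 1 v 1) (Run.store
    (Val.reg hr₁ (h.lt_bound v)).1 (Val.const h.bound_one).1
    (by simp [Expr.eval, hr₁])) ?_
  rintro _ - rfl
  have h₂ : Env n G W (s₁.put 1 v 1) := h₁.put (by omega)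
  have hS₂ : ∀ i : Fin n, (s₁.put 1 v 1).mem 1 i = 1 ↔ i ∈ insert v D := by
    intro i
    rw [State.put_mem, Finset.mem_insert, hf₁.mem 1 rfl]
    by_cases hi : i = v
    · simp [hi]
    · have : (i : ℕ) ≠ v := fun h => hi (Fin.ext h)
      simp [hi, this, hst.mem_left]
  refine Run.seq (run_redundantC h₂ hS₂) ?_
  rintro s₃ hf₃ ⟨h12, h12n, hm3⟩
  have h₃ : Env n G W s₃ := h₂.frame hf₃ rfl rfl fun i => by rw [hm3]; exact h₂.status i
  have hr₃ : s₃.reg 4 = v := by rw [hf₃.reg 4 rfl]; exact hr₁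
  refine Run.seq (K := 3) (P := fun s₄ => s₄ = s₃.put 1 v 0) (Run.store
    (Val.reg hr₃ (h.lt_bound v)).1 (Val.const (by omega)).1
    (by simp [Expr.eval, hr₃])) ?_
  rintro _ - rfl
  have h₄ : Env n G W (s₃.put 1 v 0) := h₃.put (by omega)
  have hm4 : (s₃.put 1 v 0).mem 1 = s.mem 1 := by
    funext j
    rw [State.put_mem, hm3, State.put_mem, hf₁.mem 1 rfl]
    by_cases hj : j = v
    · simp [hj, (hst.mem_none v).2 ⟨hv2, hv3⟩]
    · simp [hj]
  have h15' : (s₃.put 1 v 0).reg 15 = gain G D v := by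
    rw [State.put_reg, hf₃.reg 15 rfl, State.put_reg, h15]
  have h13' : (s₃.put 1 v 0).reg 13 = b := by
    rw [State.put_reg, hf₃.reg 13 rfl, State.put_reg, hf₁.reg 13 rfl, hb]
  have h14' : (s₃.put 1 v 0).reg 14 = c := by
    rw [State.put_reg, hf₃.reg 14 rfl, State.put_reg, hf₁.reg 14 rfl, hc]
  have h4' : (s₃.put 1 v 0).reg 4 = v := hr₃
  have h12' : (0 < (s₃.put 1 v 0).reg 12 ↔ Redundant G (insert v D)) := h12
  have h12n' : (s₃.put 1 v 0).reg 12 ≤ n := h12n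
  generalize s₃.put 1 v 0 = s₄ at *
  have hg := gain_le (G := G) D v
  have hkey : key G D X v = gain G D v + 1 + ind (Redundant G (insert v D)) * (n + 1) := by
    rw [key, if_pos hv]
  have hkn : key G D X v ≤ 2 * n + 2 := by
    have h1 := Nat.mul_le_mul_right (n + 1) (ind_le (Redundant G (insert v D)))
    omega
  have hval : Val W s₄ (.add (.add (.reg 15) (.const 1))
      (.mul (.lt (.const 0) (.reg 12)) (.add (.reg 0) (.const 1)))) (key G D X v) := by
    rw [hkey]
    refine Val.add (Val.add (Val.reg h15' (by omega)) (Val.const (by omega)) (by omega))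
      (Val.mul ((h₄.val_pos rfl h12n').congr h12')
        (Val.add (Val.reg h₄.size (by omega)) (Val.const (by omega)) (by omega)) ?_) ?_
    · omega
    · omega
  refine Run.seq (K := 15) (P := fun s₅ => s₅ = s₄.set 15 (key G D X v))
    (Run.mono (Run.assign hval.1 (Q := fun s₅ => s₅ = s₄.set 15 (key G D X v))
      (by rw [hval.2])) (by decide) (fun _ _ h => h)) ?_
  rintro _ - rfl
  have hlt : Val W (s₄.set 15 (key G D X v)) (.lt (.reg 13) (.reg 15))
      (ind (b < key G D X v)) :=
    Val.lt h.bound_one (Val.reg (by simpa using h13') (by omega)) (Val.reg (by simp) (by omega))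
  refine Run.mono (Run.ite (K := 4) hlt.1 ?_ ?_) (by decide) (fun _ _ h => h)
  · intro hne
    rw [hlt.2, ne_eq, ind_eq_zero, not_not] at hne
    have hv15 : Val W (s₄.set 15 (key G D X v)) (.reg 15) (key G D X v) :=
      Val.reg (by simp) (by omega)
    refine Run.seq (K := 2) (L := 2) (P := fun s₅ => s₅ =
      (s₄.set 15 (key G D X v)).set 13 (key G D X v)) (Run.assign hv15.1 (by rw [hv15.2])) ?_
    rintro _ - rfl
    have hv4 : Val W ((s₄.set 15 (key G D X v)).set 13 (key G D X v)) (.reg 4) v :=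
      Val.reg (by simpa using h4') (h.lt_bound v)
    refine Run.assign hv4.1 ?_
    simp [hm4, hne, Expr.eval, h4']
  · intro he
    rw [hlt.2, ind_eq_zero] at he
    refine Run.mono (Run.skip (Q := fun s' => s'.mem 1 = s.mem 1 ∧
      s'.reg 13 = (if b < key G D X v then key G D X v else b) ∧
      s'.reg 14 = (if b < key G D X v then (v : ℕ) else c)) ?_) (by decide) (fun _ _ h => h)
    simp [hm4, he, h13', h14']

theorem run_selectC [DecidableRel G.Adj] (h : Env n G W s) {D X : Finset (Fin n)}
    (hst : Status n D X s) (hd : ∀ i : Fin n, s.mem 3 i = ind (i ∈ cl G D)) :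
    Run W selectC (800 * (n + 1) ^ 5) s fun s' => s'.mem 1 = s.mem 1 ∧
      s'.reg 13 = (best G D X n).1 ∧ s'.reg 14 = (best G D X n).2 := by
  have hW := h.bound
  have hN : 1 ≤ (n + 1) ^ 4 := Nat.one_le_pow _ _ (by omega)
  refine Run.mono (K := 2 + (2 + (700 * (n + 1) ^ 4 + 20 + 12) * (n + 1))) ?_ (by nlinarith)
    (fun _ _ h => h)
  refine Run.seq (K := 2) (P := fun s₁ => s₁ = s.set 13 0)
    (Run.assign (Val.const (by omega)).1 rfl) ?_
  rintro _ - rfl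
  refine Run.seq (K := 2) (P := fun s₁ => s₁ = (s.set 13 0).set 14 0)
    (Run.assign (Val.const (by omega)).1 rfl) ?_
  rintro _ - rfl
  have h₁ : Env n G W ((s.set 13 0).set 14 0) := (h.set (by decide)).set (by decide)
  refine Run.forN (n := n) (fun j s' => s'.mem 1 = s.mem 1 ∧
    s'.reg 13 = (best G D X j).1 ∧ s'.reg 14 = (best G D X j).2) h.bound_n (by decide) rfl rfl
    h₁.size (by simp [best]) ?_ (fun _ _ h => h)
  rintro j hj s' hf hij ⟨hm, h13, h14⟩
  have h' : Env n G W s' := h₁.frame hf rfl rfl fun i => by rw [hm]; exact h.status i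
  have hst' : Status n D X s' := fun i => by rw [hm]; exact hst i
  have hd' : ∀ i : Fin n, s'.mem 3 i = ind (i ∈ cl G D) := fun i => by
    rw [hf.mem 3 rfl]
    exact hd i
  obtain ⟨hb1, hb2⟩ := best_le (G := G) D X hj.le
  have hij' : s'.reg 4 = (⟨j, hj⟩ : Fin n) := hij
  have hv : Val W s' (.mul (statusE 4 0) (flagE 3 4 1)) (ind ((⟨j, hj⟩ : Fin n) ∈ fr G D X)) :=
    (Val.and h.bound_one (h'.val_status hij' (by decide))
      (h'.val_flag hij' (hd' _) (by decide))).congr (by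
        rw [hst'.mem_none, ind_eq_one, mem_fr]
        tauto)
  refine Run.mono (Run.ite (K := 700 * (n + 1) ^ 4) hv.1 ?_ ?_)
    (by simp only [statusE, flagE, Expr.cost]; omega) (fun _ _ h => h)
  · intro hne
    rw [hv.2, ne_eq, ind_eq_zero, not_not] at hne
    refine Run.mono (run_compareC h' hst' hd' hij' hne h13 hb1 h14) le_rfl ?_
    rintro s'' - ⟨h1, h2, h3⟩
    refine ⟨h1.trans hm, ?_, ?_⟩
    · by_cases hlt : (best G D X j).1 < key G D X ⟨j, hj⟩
      · rw [if_pos hlt] at h2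
        rw [best, dif_pos hj, if_pos hlt]
        exact h2
      · rw [if_neg hlt] at h2
        rw [best, dif_pos hj, if_neg hlt]
        exact h2
    · by_cases hlt : (best G D X j).1 < key G D X ⟨j, hj⟩
      · rw [if_pos hlt] at h3
        rw [best, dif_pos hj, if_pos hlt]
        exact h3
      · rw [if_neg hlt] at h3
        rw [best, dif_pos hj, if_neg hlt]
        exact h3
  · intro he
    rw [hv.2, ind_eq_zero] at he
    refine Run.mono (Run.skip (Q := fun s'' => (s''.set 4 (j + 1)).mem 1 = s.mem 1 ∧
      (s''.set 4 (j + 1)).reg 13 = (best G D X (j + 1)).1 ∧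
      (s''.set 4 (j + 1)).reg 14 = (best G D X (j + 1)).2) ?_) (by omega) (fun _ _ h => h)
    have hk : key G D X ⟨j, hj⟩ = 0 := by rw [key, if_neg he]
    simp [best, hj, hk, hm, h13, h14]

/-- All tests at a node of the search tree. -/
def nodeC : Cmd :=
  .seq domC (.seq deadC (.seq selectC (.seq (sumN 17 5 (flagE 3 5 0))
    (sumN 16 5 (.mul (statusE 5 1) (.lt (.reg 5) (.reg 1)))))))

variable (G) in
/-- The result of the tests at the node `(D, X)` of the search from the vertex `r`. -/
structure NodeResult [DecidableRel G.Adj] (r : Fin n) (D X : Finset (Fin n)) (s : State) :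
    Prop where
  dead : s.reg 11 = 0 ↔ ¬ Dead G D X
  dead_le : s.reg 11 ≤ n
  bestKey : s.reg 13 = (best G D X n).1
  bestVertex : s.reg 14 = (best G D X n).2
  und : s.reg 17 = 0 ↔ und G D = ∅
  und_le : s.reg 17 ≤ n
  first : s.reg 16 = 0 ↔ ∀ i ∈ D, r ≤ i
  first_le : s.reg 16 ≤ n

theorem run_nodeC [DecidableRel G.Adj] (h : Env n G W s) {D X : Finset (Fin n)} {r : Fin n}
    (hst : Status n D X s) (hdis : Disjoint D X) (hr : s.reg 1 = r) :
    Run W nodeC (1200 * (n + 1) ^ 5) s fun s' => s'.mem 1 = s.mem 1 ∧ NodeResult G r D X s' := by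
  have h2 : (n + 1) ^ 2 ≤ (n + 1) ^ 5 := Nat.pow_le_pow_right (by omega) (by omega)
  have h1 : n + 1 ≤ (n + 1) ^ 5 := Nat.le_self_pow (by omega) _
  refine Run.mono (K := 110 * (n + 1) ^ 2 + (110 * (n + 1) ^ 2 + (800 * (n + 1) ^ 5 +
    (60 * (n + 1) + 60 * (n + 1))))) ?_ (by omega) (fun _ _ h => h)
  refine Run.seq (run_domC h hst.mem_left) ?_
  intro s₁ hf₁ hd₁
  have h₁ : Env n G W s₁ := h.frame' hf₁ rfl rfl rfl
  have hm₁ : s₁.mem 1 = s.mem 1 := hf₁.mem 1 rfl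
  refine Run.seq (run_deadC h₁ (fun i => by rw [hm₁]; exact hst.mem_right hdis i) hd₁) ?_
  rintro s₂ hf₂ ⟨hdead, hdead'⟩
  have h₂ : Env n G W s₂ := h₁.frame' hf₂ rfl rfl rfl
  have hm₂ : s₂.mem 1 = s.mem 1 := (hf₂.mem 1 rfl).trans hm₁
  have hd₂ : ∀ i : Fin n, s₂.mem 3 i = ind (i ∈ cl G D) := fun i => by
    rw [hf₂.mem 3 rfl]
    exact hd₁ i
  refine Run.seq (run_selectC h₂ (fun i => by rw [hm₂]; exact hst i) hd₂) ?_
  rintro s₃ hf₃ ⟨hm, h13, h14⟩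
  have hm₃ : s₃.mem 1 = s.mem 1 := hm.trans hm₂
  have h₃ : Env n G W s₃ := h₂.frame hf₃ rfl rfl fun i => by rw [hm]; exact h₂.status i
  have hr₃ : s₃.reg 1 = r := by rw [hf₃.reg 1 rfl, hf₂.reg 1 rfl, hf₁.reg 1 rfl, hr]
  refine Run.seq (Run.sumN (fun i => i ∉ cl G D) h.bound_n (by decide) (by decide)
    (by decide) h₃.size rfl (by decide) ?_) ?_
  · intro i
    have h' : Env n G W (s₃.set 5 i) := h₃.set (by decide)
    refine (h'.val_flag (i := i) (p := i ∈ cl G D) (by simp) ?_ (by decide)).congr (by simp)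
    rw [State.set_mem, hf₃.mem 3 rfl, hd₂]
  intro s₄ hf₄ h17
  have h₄ : Env n G W s₄ := h₃.frame' hf₄ rfl rfl rfl
  refine Run.mono (Run.sumN (fun i => i ∈ D ∧ i < r) h.bound_n (by decide) (by decide)
    (by decide) h₄.size rfl (by decide) ?_) le_rfl ?_
  · intro i
    have h' : Env n G W (s₄.set 5 i) := h₄.set (by decide)
    refine Val.and h.bound_one ((h'.val_status (i := i) (by simp) (by decide)).congr ?_)
      ((Val.lt h.bound_one (Val.reg (k := i) (by simp) (h'.lt_bound i))
        (Val.reg (k := r) ?_ (h'.lt_bound r))).congr Fin.lt_def.symm)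
    · rw [State.set_mem, hf₄.mem 1 rfl, hm₃, hst.mem_left]
    · simp [hf₄.reg 1 rfl, hr₃]
  · intro s₅ hf₅ h16
    refine ⟨by rw [hf₅.mem 1 rfl, hf₄.mem 1 rfl, hm₃], ?_, ?_, ?_, ?_, ?_, ?_, ?_, ?_⟩
    · rw [hf₅.reg 11 rfl, hf₄.reg 11 rfl, hf₃.reg 11 rfl]
      exact hdead
    · rw [hf₅.reg 11 rfl, hf₄.reg 11 rfl, hf₃.reg 11 rfl]
      exact hdead'
    · rw [hf₅.reg 13 rfl, hf₄.reg 13 rfl, h13]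
    · rw [hf₅.reg 14 rfl, hf₄.reg 14 rfl, h14]
    · rw [hf₅.reg 17 rfl, h17, count_eq_zero, Finset.eq_empty_iff_forall_notMem]
      simp [mem_und]
    · rw [hf₅.reg 17 rfl, h17]
      exact count_le _
    · rw [h16, count_eq_zero]
      push Not
      rfl
    · rw [h16]
      exact count_le _

end Program

end CDSEnum

/-! ### Composing iterations of a loop -/

namespace WordRAM

variable {W : ℕ}

/-- Some iterations of the loop `while e c` lead from one state to another in the given time. -/
inductive Iter (W : ℕ) (e : Expr) (c : Cmd) : State → ℕ → State → Prop
  | refl (s : State) : Iter W e c s 0 s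
  | step {s s₁ s₂ : State} {t₁ t₂ : ℕ} (he : e.Fits W s) (h : e.eval s ≠ 0)
      (hc : Exec W c s t₁ s₁) (hi : Iter W e c s₁ t₂ s₂) :
      Iter W e c s (e.cost + 1 + t₁ + t₂) s₂

theorem Iter.trans {e : Expr} {c : Cmd} {s s₁ s₂ : State} {t₁ t₂ : ℕ} (h : Iter W e c s t₁ s₁)
    (h' : Iter W e c s₁ t₂ s₂) : Iter W e c s (t₁ + t₂) s₂ := by
  induction h with
  | refl s => simpa using h'
  | step he h hc _ ih =>
    rw [add_assoc]
    exact .step he h hc (ih h')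

theorem Iter.exec {e : Expr} {c : Cmd} {s s₁ s₂ : State} {t₁ t₂ : ℕ} (h : Iter W e c s t₁ s₁)
    (h' : Exec W (.while e c) s₁ t₂ s₂) : Exec W (.while e c) s (t₁ + t₂) s₂ := by
  induction h with
  | refl s => simpa using h'
  | step he h hc _ ih =>
    rw [add_assoc]
    exact .whileTrue _ _ _ _ _ _ _ he h hc (ih h')

/-- Iterations of the loop `while e c` that take at most `K` steps lead to a state that
satisfies `Q`. -/
def Loop (W : ℕ) (e : Expr) (c : Cmd) (K : ℕ) (s : State) (Q : State → Prop) : Prop :=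
  ∃ t s', t ≤ K ∧ Iter W e c s t s' ∧ Q s'

theorem Loop.single {e : Expr} {c : Cmd} {K : ℕ} {s : State} {Q : State → Prop}
    (he : e.Fits W s) (h : e.eval s ≠ 0) (hc : Run W c K s Q) :
    Loop W e c (e.cost + 1 + K) s Q := by
  obtain ⟨t, s', ht, hx, hq⟩ := hc
  exact ⟨_, s', by omega, .step he h hx (.refl _), hq⟩

theorem Loop.trans {e : Expr} {c : Cmd} {K L : ℕ} {s : State} {P Q : State → Prop}
    (h : Loop W e c K s P) (h' : ∀ s', P s' → Loop W e c L s' Q) : Loop W e c (K + L) s Q := by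
  obtain ⟨t, s', ht, hx, hp⟩ := h
  obtain ⟨t', s'', ht', hx', hq⟩ := h' s' hp
  exact ⟨_, s'', by omega, hx.trans hx', hq⟩

theorem Loop.mono {e : Expr} {c : Cmd} {K L : ℕ} {s : State} {P Q : State → Prop}
    (h : Loop W e c K s P) (hK : K ≤ L) (hPQ : ∀ s', P s' → Q s') : Loop W e c L s Q := by
  obtain ⟨t, s', ht, hx, hp⟩ := h
  exact ⟨t, s', ht.trans hK, hx, hPQ s' hp⟩

theorem Loop.run {e : Expr} {c : Cmd} {K : ℕ} {s : State} {P : State → Prop}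
    (h : Loop W e c K s P) (hP : ∀ s', P s' → Val W s' e 0) :
    Run W (.while e c) (K + (e.cost + 1)) s P := by
  obtain ⟨t, s', ht, hx, hp⟩ := h
  obtain ⟨h1, h2⟩ := hP s' hp
  exact ⟨_, s', by omega, hx.exec (.whileFalse e c s' h1 h2), hp⟩

end WordRAM

namespace CDSEnum

open WordRAM

/-! ### The depth-first traversal of the search tree -/

/-- Descend from an inner node to its first child. -/
def pushC : Cmd :=
  .seq (.store 2 (.reg 2) (.reg 14)) (.seq (.assign 2 (.add (.reg 2) (.const 1)))
    (.ite (.lt (.add (.reg 0) (.const 1)) (.reg 13)) (.store 1 (.reg 14) (.const 2))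
      (.store 1 (.reg 14) (.const 1))))

/-- Write the characteristic vector of the vertices of status `1`. -/
def writeC : Cmd := forN 5 (.output (statusE 5 1))

/-- Handle a leaf. -/
def leafC : Cmd :=
  .seq (.ite (.mul (.mul (.eq (.reg 11) (.const 0)) (.eq (.reg 17) (.const 0)))
      (.eq (.reg 16) (.const 0))) writeC .skip)
    (.assign 3 (.const 2))

/-- Go to the second child of the parent, or to the parent, or finish at the root. -/
def popC : Cmd :=
  .ite (.eq (.reg 2) (.const 0)) (.assign 3 (.const 0))
    (.seq (.assign 9 (.read 2 (.sub (.reg 2) (.const 1))))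
      (.ite (statusE 9 1) (.seq (.store 1 (.reg 9) (.const 2)) (.assign 3 (.const 1)))
        (.seq (.store 1 (.reg 9) (.const 0)) (.assign 2 (.sub (.reg 2) (.const 1))))))

/-- One step of the traversal: visit a new node if register `3` holds `1`, else backtrack. -/
def moveC : Cmd :=
  .ite (.eq (.reg 3) (.const 1))
    (.seq nodeC (.ite (.mul (.eq (.reg 11) (.const 0)) (.lt (.const 0) (.reg 13))) pushC leafC))
    popC

section Search

variable {n : ℕ} {G : SimpleGraph (Fin n)} {W : ℕ} {s : State}

variable (G W) in
/-- The traversal with root `r` is at the node `(D, X)` at depth `p`, with the given mode, stack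
and output. -/
structure At (r : Fin n) (D X : Finset (Fin n)) (p mode : ℕ) (stk : ℕ → ℕ) (o : List ℕ)
    (s : State) : Prop where
  env : Env n G W s
  status : Status n D X s
  root : s.reg 1 = r
  depth : s.reg 2 = p
  mode : s.reg 3 = mode
  stack : ∀ i < p, s.mem 2 i = stk i
  out : s.out = o

theorem run_writeC (h : Env n G W s) {D : Finset (Fin n)}
    (hD : ∀ i : Fin n, s.mem 1 i = 1 ↔ i ∈ D) :
    Run W writeC (17 * (n + 1)) s fun s' => s'.out = s.out ++ charVector D := by
  refine Run.forN (n := n) (K := 5) (fun j s' => s'.out = s.out ++ (charVector D).take j)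
    h.bound_n (by decide) rfl rfl h.size (by simp) ?_ ?_
  · intro j hj s' hf hij ho
    have h' : Env n G W s' := h.frame' hf rfl rfl rfl
    have hv := h'.val_status (x := 5) (i := ⟨j, hj⟩) (k := 1) hij (by decide)
    refine Run.output hv.1 ?_
    rw [hv.2]
    change s'.out ++ _ = _
    rw [ho, List.append_assoc, List.take_add_one]
    congr 2
    rw [hf.mem 1 rfl, ind_congr (hD _), charVector, List.getElem?_ofFn]
    simp only [hj, ↓reduceDIte, Option.toList_some, List.cons.injEq, and_true]
    unfold ind
    split_ifs <;> rfl
  · intro s' _ ho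
    rw [ho, List.take_of_length_le (by simp [charVector])]

theorem Status.insert_left {D X : Finset (Fin n)} {v : Fin n} (h : Status n D X s) :
    Status n (insert v D) X (s.put 1 v 1) := by
  intro i
  rw [State.put_mem, h i]
  by_cases hi : i = v
  · simp [hi]
  · have : (i : ℕ) ≠ v := fun h => hi (Fin.ext h)
    simp [hi, this]

theorem Status.insert_right {D X : Finset (Fin n)} {v : Fin n} (h : Status n D X s)
    (hv : v ∉ D) : Status n D (insert v X) (s.put 1 v 2) := by
  intro i
  rw [State.put_mem, h i]
  by_cases hi : i = v
  · simp [hi, hv]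
  · have : (i : ℕ) ≠ v := fun h => hi (Fin.ext h)
    simp [hi, this]

theorem Status.exclude {D X : Finset (Fin n)} {v : Fin n} (h : Status n (insert v D) X s)
    (hv : v ∉ D) : Status n D (insert v X) (s.put 1 v 2) := by
  intro i
  rw [State.put_mem, h i]
  by_cases hi : i = v
  · simp [hi, hv]
  · have : (i : ℕ) ≠ v := fun h => hi (Fin.ext h)
    simp [hi, this]

theorem Status.restore {D X : Finset (Fin n)} {v : Fin n} (h : Status n D (insert v X) s)
    (hv : v ∉ D) (hv' : v ∉ X) : Status n D X (s.put 1 v 0) := by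
  intro i
  rw [State.put_mem, h i]
  by_cases hi : i = v
  · simp [hi, hv, hv']
  · have : (i : ℕ) ≠ v := fun h => hi (Fin.ext h)
    simp [hi, this]

/-- If inclusion is redundant, the descent goes straight to the excluding child. Status `2` then
makes backtracking treat that child as the last one. -/
theorem run_pushC [DecidableRel G.Adj] {r : Fin n} {D X : Finset (Fin n)} {p : ℕ}
    {stk : ℕ → ℕ} {o : List ℕ} (h : At G W r D X p 1 stk o s) (hp : p < n)
    (hn : NodeResult G r D X s) (hfr : (fr G D X).Nonempty) :
    Run W pushC 20 s fun s' =>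
      (Redundant G (insert (choose G r D X) D) → At G W r D (insert (choose G r D X) X) (p + 1) 1
        (Function.update stk p (choose G r D X)) o s') ∧
      (¬ Redundant G (insert (choose G r D X) D) → At G W r (insert (choose G r D X) D) X (p + 1)
        1 (Function.update stk p (choose G r D X)) o s') := by
  have hb := h.env.bound
  have hred := best_lt_iff (G := G) r hfr
  have hv := (mem_fr.1 (isChoice_choose r D X hfr).1).2.1
  have h14 : s.reg 14 = choose G r D X := by
    rw [hn.bestVertex, (best_choose (G := G) r hfr).1]
  have h13 := hn.bestKey
  obtain ⟨hle, -⟩ := best_le (G := G) D X le_rfl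
  generalize choose G r D X = v at *
  have h2 := h.depth
  have v14 : Val W s (.reg 14) v := Val.reg h14 (h.env.lt_bound v)
  have v2 : Val W s (.reg 2) p := Val.reg h2 (by omega)
  refine Run.mono (K := 3 + (4 + 9)) ?_ (by omega) (fun _ _ h => h)
  refine Run.seq (K := 3) (P := fun s' => s' = s.put 2 p v)
    (Run.store v2.1 v14.1 (by rw [v2.2, v14.2])) ?_
  rintro _ - rfl
  have vp : Val W (s.put 2 p v) (.add (.reg 2) (.const 1)) (p + 1) :=
    Val.add (Val.reg h2 (by omega)) (Val.const (by omega)) (by omega)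
  refine Run.seq (K := 4) (P := fun s' => s' = (s.put 2 p v).set 2 (p + 1))
    (Run.assign vp.1 (by rw [vp.2])) ?_
  rintro _ - rfl
  set s₁ := (s.put 2 p v).set 2 (p + 1) with hs₁
  have hm : s₁.mem 1 = s.mem 1 := State.put_mem_ne s p v (by decide : (1 : ℕ) ≠ 2)
  have h₁ : Env n G W s₁ := by
    refine ⟨hb, by simp [hs₁, h.env.size], fun i j => ?_, fun i => ?_⟩
    · rw [← h.env.adj, hs₁, State.set_mem, State.put_mem_ne _ _ _ (by decide)]
    · rw [hm]
      exact h.env.status i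
  have hst : Status n D X s₁ := fun i => by rw [hm]; exact h.status i
  have hstack : ∀ (k i : ℕ), i < p + 1 →
      (s₁.put 1 v k).mem 2 i = Function.update stk p v i := by
    intro k i hi
    rw [State.put_mem_ne _ _ _ (by decide), hs₁, State.set_mem, State.put_mem,
      Function.update_apply]
    by_cases hip : i = p
    · simp [hip]
    · simp only [hip, and_false, if_false]
      exact h.stack i (by omega)
  have w14 : Val W s₁ (.reg 14) v := Val.reg (by simpa [hs₁] using h14) (h.env.lt_bound v)
  have vlt : Val W s₁ (.lt (.add (.reg 0) (.const 1)) (.reg 13))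
      (ind (n + 1 < (best G D X n).1)) :=
    Val.lt (by omega) (Val.add (Val.reg h₁.size (by omega)) (Val.const (by omega)) (by omega))
      (Val.reg (by simpa [hs₁] using h13) (by omega))
  refine Run.ite (K := 3) vlt.1 ?_ ?_
  · intro hne
    rw [vlt.2, ne_eq, ind_eq_zero, not_not, hred] at hne
    refine Run.store w14.1 (Val.const (by omega)).1 ?_
    rw [w14.2]
    refine ⟨fun _ => ⟨h₁.put le_rfl, hst.insert_right hv, ?_, ?_, ?_, hstack 2, ?_⟩,
      fun hno => absurd hne hno⟩
    · simpa [hs₁] using h.root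
    · simp [hs₁]
    · simpa [hs₁] using h.mode
    · simpa [hs₁] using h.out
  · intro he
    rw [vlt.2, ind_eq_zero, hred] at he
    refine Run.store w14.1 (Val.const (by omega)).1 ?_
    rw [w14.2]
    refine ⟨fun hno => absurd hno he, fun _ => ⟨h₁.put (by simp [Expr.eval]), hst.insert_left, ?_, ?_, ?_,
      hstack 1, ?_⟩⟩
    · simpa [hs₁] using h.root
    · simp [hs₁]
    · simpa [hs₁] using h.mode
    · simpa [hs₁] using h.out

open Classical in
theorem run_leafC [DecidableRel G.Adj] {r : Fin n} {D X : Finset (Fin n)} {p : ℕ}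
    {stk : ℕ → ℕ} {o : List ℕ} (h : At G W r D X p 1 stk o s) (hn : NodeResult G r D X s) :
    Run W leafC (17 * (n + 1) + 20) s (At G W r D X p 2 stk
      (o ++ if ¬ Dead G D X ∧ und G D = ∅ ∧ ∀ i ∈ D, r ≤ i then charVector D else [])) := by
  have hb := h.env.bound
  have v : Val W s (.mul (.mul (.eq (.reg 11) (.const 0)) (.eq (.reg 17) (.const 0)))
      (.eq (.reg 16) (.const 0))) (ind (¬ Dead G D X ∧ und G D = ∅ ∧ ∀ i ∈ D, r ≤ i)) := by
    refine (Val.and (by omega) (Val.and (by omega)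
      ((h.env.val_zero rfl hn.dead_le).congr hn.dead)
      ((h.env.val_zero rfl hn.und_le).congr hn.und))
      ((h.env.val_zero rfl hn.first_le).congr hn.first)).congr and_assoc
  refine Run.mono (K := 12 + 17 * (n + 1) + 2) ?_ (by omega) (fun _ _ h => h)
  refine Run.seq (Run.ite (K := 17 * (n + 1)) (Q := fun s' => s'.out = o ++
    if ¬ Dead G D X ∧ und G D = ∅ ∧ ∀ i ∈ D, r ≤ i then charVector D else []) v.1 ?_ ?_) ?_
  · intro hne
    rw [v.2, ne_eq, ind_eq_zero, not_not] at hne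
    rw [if_pos hne, ← h.out]
    exact run_writeC h.env h.status.mem_left
  · intro he
    rw [v.2, ind_eq_zero] at he
    rw [if_neg he, ← h.out]
    exact Run.mono (Run.skip (Q := fun s' => s'.out = s.out ++ []) (by simp)) (by omega)
      (fun _ _ h => h)
  · intro s' hf ho
    refine Run.assign (Val.const (by omega)).1 ⟨(h.env.frame' hf rfl rfl rfl).set (by decide),
      ?_, ?_, ?_, by simp [Expr.eval], ?_, ho⟩
    · intro i
      rw [State.set_mem, hf.mem 1 rfl]
      exact h.status i
    · simp [hf.reg 1 rfl, h.root]
    · simp [hf.reg 2 rfl, h.depth]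
    · intro i hi
      rw [State.set_mem, hf.mem 2 rfl]
      exact h.stack i hi

theorem run_moveC_visit [DecidableRel G.Adj] {r : Fin n} {D X : Finset (Fin n)} {p : ℕ}
    {stk : ℕ → ℕ} {o : List ℕ} (h : At G W r D X p 1 stk o s) (hdis : Disjoint D X)
    {Q : State → Prop}
    (hpush : ¬ Dead G D X → (fr G D X).Nonempty → ∀ s', At G W r D X p 1 stk o s' →
      NodeResult G r D X s' → Run W pushC 20 s' Q)
    (hleaf : (Dead G D X ∨ fr G D X = ∅) → ∀ s', At G W r D X p 1 stk o s' →
      NodeResult G r D X s' → Run W leafC (17 * (n + 1) + 20) s' Q) :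
    Run W moveC (1300 * (n + 1) ^ 5) s Q := by
  have hb := h.env.bound
  have h1 : n + 1 ≤ (n + 1) ^ 5 := Nat.le_self_pow (by omega) _
  have v : Val W s (.eq (.reg 3) (.const 1)) (ind (1 = 1)) :=
    Val.eq (by omega) (Val.reg h.mode (by omega)) (Val.const (by omega))
  refine Run.mono (K := 4 + (1200 * (n + 1) ^ 5 + (8 + (17 * (n + 1) + 20)))) ?_ (by omega)
    (fun _ _ h => h)
  refine Run.ite (K := 1200 * (n + 1) ^ 5 + (8 + (17 * (n + 1) + 20))) v.1 ?_ ?_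
  · intro _
    refine Run.seq (run_nodeC h.env h.status hdis h.root) ?_
    rintro s₁ hf ⟨hm, hn⟩
    have h₁ : At G W r D X p 1 stk o s₁ := by
      refine ⟨h.env.frame hf rfl rfl fun i => by rw [hm]; exact h.env.status i,
        fun i => by rw [hm]; exact h.status i, ?_, ?_, ?_, ?_, ?_⟩
      · rw [hf.reg 1 rfl, h.root]
      · rw [hf.reg 2 rfl, h.depth]
      · rw [hf.reg 3 rfl, h.mode]
      · rw [hf.mem 2 rfl]
        exact h.stack
      · rw [hf.out rfl, h.out]
    obtain ⟨hle, -⟩ := best_le (G := G) D X le_rfl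
    have v' : Val W s₁ (.mul (.eq (.reg 11) (.const 0)) (.lt (.const 0) (.reg 13)))
        (ind (¬ Dead G D X ∧ (fr G D X).Nonempty)) := by
      refine Val.and (by omega) ((h₁.env.val_zero rfl hn.dead_le).congr hn.dead)
        ((Val.lt (by omega) (Val.const (by omega)) (Val.reg hn.bestKey (by omega))).congr ?_)
      rw [Finset.nonempty_iff_ne_empty, ne_eq, ← best_eq_zero_iff, Nat.pos_iff_ne_zero]
    refine Run.ite (K := 17 * (n + 1) + 20) v'.1 ?_ ?_
    · intro hne
      rw [v'.2, ne_eq, ind_eq_zero, not_not] at hne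
      exact Run.mono (hpush hne.1 hne.2 s₁ h₁ hn) (by omega) (fun _ _ h => h)
    · intro he
      rw [v'.2, ind_eq_zero, not_and_or, not_not, Finset.not_nonempty_iff_eq_empty] at he
      exact hleaf he s₁ h₁ hn
  · intro he
    rw [v.2, ind_eq_zero] at he
    exact absurd rfl he

/-- The status of the top stack vertex tells which child was just finished, so the stack stores only
vertices. -/
theorem run_moveC_pop {r : Fin n} {D X : Finset (Fin n)} {p : ℕ} {v : Fin n}
    {stk : ℕ → ℕ} {o : List ℕ} (h : At G W r D X (p + 1) 2 stk o s) (hp : p < n)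
    (hs : stk p = v) {D' X' : Finset (Fin n)} {q m : ℕ}
    (hin : v ∈ D → Status n D' X' (s.put 1 v 2) ∧ q = p + 1 ∧ m = 1)
    (hout : v ∉ D → Status n D' X' (s.put 1 v 0) ∧ q = p ∧ m = 2) :
    Run W moveC (1300 * (n + 1) ^ 5) s (At G W r D' X' q m stk o) := by
  have hb := h.env.bound
  have h1 : 1 ≤ (n + 1) ^ 5 := Nat.one_le_pow _ _ (by omega)
  have v₁ : Val W s (.eq (.reg 3) (.const 1)) (ind (2 = 1)) :=
    Val.eq (by omega) (Val.reg h.mode (by omega)) (Val.const (by omega))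
  have v₂ : Val W s (.eq (.reg 2) (.const 0)) (ind (p + 1 = 0)) :=
    Val.eq (by omega) (Val.reg h.depth (by omega)) (Val.const (by omega))
  have v₃ : Val W s (.read 2 (.sub (.reg 2) (.const 1))) v :=
    Val.read (Val.sub (Val.reg h.depth (by omega)) (Val.const (by omega)))
      ((h.stack p (by omega)).trans hs) (h.env.lt_bound v)
  refine Run.mono (K := 4 + (4 + (5 + (5 + 7)))) ?_ (by omega) (fun _ _ h => h)
  refine Run.ite (K := 4 + (5 + (5 + 7))) v₁.1 (fun hne => absurd (v₁.2.trans (ind_false (by decide))) hne) ?_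
  intro _
  refine Run.ite (K := 5 + (5 + 7)) v₂.1 (fun hne => absurd (v₂.2.trans (ind_false (by omega))) hne) ?_
  intro _
  refine Run.seq (K := 5) (P := fun s' => s' = s.set 9 v)
    (Run.assign v₃.1 (by rw [v₃.2])) ?_
  rintro _ - rfl
  have h' : Env n G W (s.set 9 v) := h.env.set (by decide)
  have hv := h'.val_status (x := 9) (i := v) (k := 1) (by simp) (by decide)
  have v₄ : Val W (s.set 9 v) (.reg 9) v := Val.reg (by simp) (h.env.lt_bound v)
  refine Run.ite (K := 7) hv.1 ?_ ?_
  · intro hne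
    rw [hv.2, ne_eq, ind_eq_zero, not_not] at hne
    obtain ⟨hst, rfl, rfl⟩ := hin ((h.status.mem_left v).1 hne)
    refine Run.mono (K := 3 + 2) ?_ (by omega) (fun _ _ h => h)
    refine Run.seq (K := 3) (P := fun s' => s' = (s.set 9 v).put 1 v 2)
      (Run.store v₄.1 (Val.const (by omega)).1 (by rw [v₄.2]; rfl)) ?_
    rintro _ - rfl
    refine Run.assign (Val.const (by omega)).1 ⟨(h'.put (by decide)).set (by decide), hst,
      by simpa using h.root, by simpa using h.depth, by simp [Expr.eval], ?_, h.out⟩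
    intro i hi
    rw [State.set_mem, State.put_mem_ne _ _ _ (by decide)]
    exact h.stack i hi
  · intro he
    rw [hv.2, ind_eq_zero] at he
    obtain ⟨hst, rfl, rfl⟩ := hout (fun hvD => he ((h.status.mem_left v).2 hvD))
    have v₅ : Val W ((s.set 9 v).put 1 v 0) (.sub (.reg 2) (.const 1)) (q + 1 - 1) :=
      Val.sub (Val.reg (by simpa using h.depth) (by omega)) (Val.const (by omega))
    refine Run.mono (K := 3 + 4) ?_ (by omega) (fun _ _ h => h)
    refine Run.seq (K := 3) (P := fun s' => s' = (s.set 9 v).put 1 v 0)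
      (Run.store v₄.1 (Val.const (by omega)).1 (by rw [v₄.2]; rfl)) ?_
    rintro _ - rfl
    refine Run.assign v₅.1 ⟨(h'.put (by decide)).set (by decide), hst,
      by simpa using h.root, by simp [v₅.2], by simpa using h.mode, ?_, h.out⟩
    intro i hi
    rw [State.set_mem, State.put_mem_ne _ _ _ (by decide)]
    exact h.stack i (by omega)

theorem run_moveC_finish {r : Fin n} {D X : Finset (Fin n)} {stk : ℕ → ℕ} {o : List ℕ}
    (h : At G W r D X 0 2 stk o s) :
    Run W moveC (1300 * (n + 1) ^ 5) s (At G W r D X 0 0 stk o) := by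
  have hb := h.env.bound
  have h1 : 1 ≤ (n + 1) ^ 5 := Nat.one_le_pow _ _ (by omega)
  have v₁ : Val W s (.eq (.reg 3) (.const 1)) (ind (2 = 1)) :=
    Val.eq (by omega) (Val.reg h.mode (by omega)) (Val.const (by omega))
  have v₂ : Val W s (.eq (.reg 2) (.const 0)) (ind (0 = 0)) :=
    Val.eq (by omega) (Val.reg h.depth (by omega)) (Val.const (by omega))
  refine Run.mono (K := 4 + (4 + 2)) ?_ (by omega) (fun _ _ h => h)
  refine Run.ite (K := 4 + 2) v₁.1 (fun hne => absurd (v₁.2.trans (ind_false (by decide))) hne) ?_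
  intro _
  refine Run.ite (K := 2) v₂.1 ?_ (fun he => absurd (he.symm.trans (v₂.2.trans (ind_true rfl)))
    (by decide))
  intro _
  exact Run.assign (Val.const (by omega)).1 ⟨h.env.set (by decide), h.status,
    by simpa using h.root, by simpa using h.depth, by simp [Expr.eval], h.stack, h.out⟩

/-- A step of the traversal as an iteration of its loop. -/
theorem loop_moveC {r : Fin n} {D X : Finset (Fin n)} {p mode : ℕ} {stk : ℕ → ℕ} {o : List ℕ}
    {Q : State → Prop} (h : At G W r D X p mode stk o s) (hm : mode ≠ 0) (hm' : mode ≤ 2)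
    (hr : Run W moveC (1300 * (n + 1) ^ 5) s Q) :
    Loop W (.reg 3) moveC (1400 * (n + 1) ^ 5) s Q := by
  have hb := h.env.bound
  have h1 : 1 ≤ (n + 1) ^ 5 := Nat.one_le_pow _ _ (by omega)
  have v : Val W s (.reg 3) mode := Val.reg h.mode (by omega)
  exact (Loop.single v.1 (by rwa [v.2]) hr).mono (by simp only [Expr.cost]; omega)
    (fun _ h => h)

variable (G) in
/-- The output of the traversal from the node `(D, X)`: the sets found that have no vertex below
the root. -/
noncomputable def listed [DecidableRel G.Adj] (r : Fin n) (m : ℕ) (D X : Finset (Fin n)) :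
    List (Finset (Fin n)) :=
  (found G (choose G r) m D X).filter fun E => ∀ i ∈ E, r ≤ i

/-- Traversing a subtree returns to its own node in mode `2` with the stack below it intact, so the
traversals of two children compose. The bound on `p` keeps the stack within `n` cells. -/
theorem loop_search [DecidableRel G.Adj] {r : Fin n} (m : ℕ) {D X : Finset (Fin n)} {p : ℕ}
    {stk : ℕ → ℕ} {o : List ℕ} (h : At G W r D X p 1 stk o s) (hdis : Disjoint D X)
    (hm : (Finset.univ \ (D ∪ X)).card < m) (hp : p + (Finset.univ \ (D ∪ X)).card ≤ n) :
    Loop W (.reg 3) moveC (1400 * (n + 1) ^ 5 * steps G (choose G r) m D X) s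
      (At G W r D X p 2 stk (o ++ (listed G r m D X).flatMap charVector)) := by
  induction m generalizing D X p stk o s with
  | zero => omega
  | succ m ih =>
    by_cases hleaf : Dead G D X ∨ fr G D X = ∅
    · have hsteps : steps G (choose G r) (m + 1) D X = 1 := by
        rw [steps]
        rcases hleaf with hd | hf
        · rw [if_pos hd]
        · simp [hf]
      rw [hsteps, mul_one]
      refine loop_moveC h (by decide) (by decide) (run_moveC_visit h hdis
        (fun h1 h2 => absurd hleaf (not_or.2 ⟨h1, h2.ne_empty⟩)) ?_)
      intro _ s' h' hn
      refine Run.mono (run_leafC h' hn) le_rfl ?_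
      intro s'' _ hs''
      convert hs'' using 2
      rw [listed, found]
      by_cases hd : Dead G D X
      · simp [hd]
      · have hf := hleaf.resolve_left hd
        by_cases hu : und G D = ∅
        · by_cases hr : ∀ i ∈ D, r ≤ i
          · rw [if_neg hd, if_pos hf, if_pos hu, if_pos ⟨hd, hu, hr⟩,
              List.filter_cons_of_pos (by simpa using hr)]
            simp
          · rw [if_neg hd, if_pos hf, if_pos hu, if_neg fun h => hr h.2.2,
              List.filter_cons_of_neg (by simpa using hr)]
            simp
        · simp [hd, hf, hu]
    · obtain ⟨hd, hf⟩ := not_or.1 hleaf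
      have hne : (fr G D X).Nonempty := Finset.nonempty_iff_ne_empty.2 hf
      have hv := (isChoice_choose r D X hne).1
      obtain ⟨-, hvD, hvX⟩ := mem_fr.1 hv
      have hcl := card_compl_insert_left hv
      have hcr := card_compl_insert_right hv
      have hpn : p < n := by omega
      have hdr : Disjoint D (insert (choose G r D X) X) :=
        Finset.disjoint_insert_right.2 ⟨hvD, hdis⟩
      have hdl : Disjoint (insert (choose G r D X) D) X :=
        Finset.disjoint_insert_left.2 ⟨hvX, hdis⟩
      have hvisit := loop_moveC h (by decide) (by decide) (run_moveC_visit h hdis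
        (fun _ h2 s' h' hn => run_pushC h' hpn hn h2)
        (fun hl => absurd hl hleaf))
      have hpop : ∀ o' s', At G W r D (insert (choose G r D X) X) (p + 1) 2
          (Function.update stk p (choose G r D X)) o' s' →
          Loop W (.reg 3) moveC (1400 * (n + 1) ^ 5) s' (At G W r D X p 2 stk o') := by
        intro o' s' h'
        refine (loop_moveC h' (by decide) (by decide) (run_moveC_pop h' hpn (by simp)
          (fun hin => absurd hin hvD)
          (fun _ => ⟨h'.status.restore hvD hvX, rfl, rfl⟩))).mono le_rfl ?_
        rintro s'' ⟨h1, h2, h3, h4, h5, h6, h7⟩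
        refine ⟨h1, h2, h3, h4, h5, fun i hi => ?_, h7⟩
        -- The pushed entry sits at index `p`, outside the part of the stack that matters at depth
        -- `p`.
        rw [h6 i hi, Function.update_of_ne hi.ne]
      by_cases hred : Redundant G (insert (choose G r D X) D)
      · have hsteps : steps G (choose G r) (m + 1) D X =
            1 + steps G (choose G r) m D (insert (choose G r D X) X) + 1 := by
          rw [steps]
          simp [hd, hf, hred]
        have hlist : listed G r (m + 1) D X =
            listed G r m D (insert (choose G r D X) X) := by
          rw [listed, found]
          simp [hd, hf, hred, listed]
        rw [hsteps, hlist, mul_add, mul_add, mul_one]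
        exact (hvisit.trans fun s' hs' => ih (hs'.1 hred) hdr (by omega) (by omega)).trans
          (hpop _)
      · have hsteps : steps G (choose G r) (m + 1) D X =
            1 + steps G (choose G r) m (insert (choose G r D X) D) X + 1 +
              steps G (choose G r) m D (insert (choose G r D X) X) + 1 := by
          rw [steps]
          simp [hd, hf, hred, add_assoc]
        have hlist : listed G r (m + 1) D X = listed G r m (insert (choose G r D X) D) X ++
            listed G r m D (insert (choose G r D X) X) := by
          rw [listed, found]
          simp [hd, hf, hred, listed]
        rw [hsteps, hlist, mul_add, mul_add, mul_add, mul_add, mul_one, List.flatMap_append,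
          ← List.append_assoc]
        refine (((hvisit.trans fun s' hs' => ih (hs'.2 hred) hdl (by omega) (by omega)).trans
          fun s' h' => loop_moveC h' (by decide) (by decide) (run_moveC_pop h' hpn (by simp)
            (fun _ => ⟨h'.status.exclude hvD, rfl, rfl⟩)
            (fun hno => absurd (Finset.mem_insert_self _ _) hno))).trans
          fun s' h' => ih h' hdr (by omega) (by omega)).trans (hpop _)

end Search

end CDSEnum

/-! ### Output length and running time -/

namespace WordRAM

theorem Exec.length_out_le {W t : ℕ} {c : Cmd} {s s' : State} (h : Exec W c s t s') :
    s'.out.length ≤ s.out.length + t := by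
  induction h with
  | skip | assign | store | whileFalse => simp
  | output e s he => simp
  | seq c d s s₁ s₂ t₁ t₂ _ _ ih₁ ih₂ => omega
  | iteTrue e c d s s₁ t _ _ _ ih => omega
  | iteFalse e c d s s₁ t _ _ _ ih => omega
  | whileTrue e c s s₁ s₂ t₁ t₂ _ _ _ _ ih₁ ih₂ => omega

end WordRAM

namespace CDSEnum

open WordRAM

/-! ### The enumeration program -/

/-- Traverse the search tree whose root is the vertex in register `1`. -/
def rootC : Cmd :=
  .seq (fillN 1 5 .skip (.const 0)) (.seq (.store 1 (.reg 1) (.const 1))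
    (.seq (.assign 2 (.const 0)) (.seq (.assign 3 (.const 1)) (.while (.reg 3) moveC))))

/-- The program that outputs all minimal connected dominating sets. -/
def enumerateC : Cmd := forN 1 rootC

section Enumerate

variable {n : ℕ} {G : SimpleGraph (Fin n)} {W : ℕ} {s : State}

variable (n) in
/-- A bound for the number of leaves of a search tree. -/
noncomputable def leafBound : ℕ := ⌊(1.9884 : ℝ) ^ n⌋₊

theorem steps_singleton_le [DecidableRel G.Adj] (r : Fin n) :
    steps G (choose G r) (n + 1) {r} ∅ ≤ 4 * (n + 1) * leafBound n + 1 := by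
  have h := leaves_singleton_le (isChoice_choose (G := G) r) (n + 1) r
  rw [Fintype.card_fin] at h
  exact (steps_le _ _ _ _).trans (by gcongr; exact Nat.le_floor h)

theorem run_rootC [DecidableRel G.Adj] (h : Env n G W s) {r : Fin n} (hr : s.reg 1 = r) :
    Run W rootC (6000 * (n + 1) ^ 6 * (leafBound n + 1)) s fun s' => Env n G W s' ∧
      s'.out = s.out ++ (listed G r (n + 1) {r} ∅).flatMap charVector := by
  have hb := h.bound
  have hsteps := steps_singleton_le (G := G) r
  refine Run.mono (K := 51 * (n + 1) + (3 + (2 + (2 + (1400 * (n + 1) ^ 5 *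
    steps G (choose G r) (n + 1) {r} ∅ + 1400 * (n + 1) ^ 5 + 2))))) ?_ ?_ (fun _ _ h => h)
  · refine Run.seq (Run.fillN (K := 1) (fun _ : Fin n => 0) h.bound_n (by decide) rfl rfl rfl
      h.size (by decide) fun k s' _ _ => Run.skip (Val.const (by omega))) ?_
    intro s₁ hf₁ h0
    have h₁ : Env n G W s₁ := h.frame hf₁ rfl rfl fun i => by rw [h0]; omega
    have hr₁ : s₁.reg 1 = r := by rw [hf₁.reg 1 rfl, hr]
    have v₁ : Val W s₁ (.reg 1) r := Val.reg hr₁ (h.lt_bound r)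
    refine Run.seq (K := 3) (P := fun s' => s' = s₁.put 1 r 1)
      (Run.store v₁.1 (Val.const (by omega)).1 (by rw [v₁.2]; rfl)) ?_
    rintro _ - rfl
    refine Run.seq (K := 2) (P := fun s' => s' = (s₁.put 1 r 1).set 2 0)
      (Run.assign (Val.const (by omega)).1 rfl) ?_
    rintro _ - rfl
    refine Run.seq (K := 2) (P := fun s' => s' = ((s₁.put 1 r 1).set 2 0).set 3 1)
      (Run.assign (Val.const (by omega)).1 rfl) ?_
    rintro _ - rfl
    have hat : At G W r {r} ∅ 0 1 (fun _ => 0) s.out (((s₁.put 1 r 1).set 2 0).set 3 1) := by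
      refine ⟨((h₁.put (by decide)).set (by decide)).set (by decide), ?_, by simpa using hr₁,
        by simp, by simp, fun i hi => absurd hi (by omega), hf₁.out rfl⟩
      have hst : Status n ∅ ∅ s₁ := fun i => by simp [h0]
      exact hst.insert_left
    have hcard : (Finset.univ \ ({r} ∪ ∅ : Finset (Fin n))).card = n - 1 := by
      rw [Finset.union_empty, Finset.card_sdiff_of_subset (Finset.subset_univ _)]
      simp
    have hn := r.2
    exact Run.mono (((loop_search (n + 1) hat (by simp) (by omega) (by omega)).trans
      fun s' h' => loop_moveC h' (by decide) (by decide) (run_moveC_finish h')).run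
      fun s' h' => Val.reg h'.mode (by omega)) le_rfl fun s' _ h' => ⟨h'.env, h'.out⟩
  · generalize leafBound n = M at *
    generalize steps G (choose G r) (n + 1) {r} ∅ = T at *
    have h1 : 1 ≤ (n + 1) ^ 4 := Nat.one_le_pow _ _ (by omega)
    have h2 : (n + 1) ^ 5 = (n + 1) ^ 4 * (n + 1) := pow_succ _ _
    have h3 : (n + 1) ^ 6 = (n + 1) ^ 5 * (n + 1) := pow_succ _ _
    have h4 : n + 1 ≤ (n + 1) ^ 5 := Nat.le_self_pow (by omega) _
    have h5 : (n + 1) ^ 5 ≤ (n + 1) ^ 6 := Nat.pow_le_pow_right (by omega) (by omega)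
    have h6 : 1400 * (n + 1) ^ 5 * T ≤ 5600 * ((n + 1) ^ 6 * M) + 1400 * (n + 1) ^ 5 := by
      calc 1400 * (n + 1) ^ 5 * T ≤ 1400 * (n + 1) ^ 5 * (4 * (n + 1) * M + 1) := by gcongr
        _ = _ := by rw [h3]; ring
    have h7 : 6000 * (n + 1) ^ 6 * (M + 1) = 6000 * ((n + 1) ^ 6 * M) + 6000 * (n + 1) ^ 6 := by
      ring
    omega

variable (G) in
/-- All minimal connected dominating sets in the order of the enumeration. -/
noncomputable def allListed [DecidableRel G.Adj] : List (Finset (Fin n)) :=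
  (List.finRange n).flatMap fun r => listed G r (n + 1) {r} ∅

theorem mem_listed [DecidableRel G.Adj] (r : Fin n) (E : Finset (Fin n)) :
    E ∈ listed G r (n + 1) {r} ∅ ↔ IsMinimalCDS G E ∧ r ∈ E ∧ ∀ i ∈ E, r ≤ i := by
  have hcard : (Finset.univ \ ({r} ∪ ∅ : Finset (Fin n))).card < n + 1 :=
    Nat.lt_succ_of_le ((Finset.card_le_univ _).trans (Fintype.card_fin n).le)
  have h := (found_spec (isChoice_choose (G := G) r) (n + 1) {r} ∅ (inv_singleton r)
    (not_redundant_singleton r) hcard).2 E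
  rw [listed, List.mem_filter, h]
  simp [and_assoc]

theorem nodup_listed [DecidableRel G.Adj] (r : Fin n) : (listed G r (n + 1) {r} ∅).Nodup := by
  have hcard : (Finset.univ \ ({r} ∪ ∅ : Finset (Fin n))).card < n + 1 :=
    Nat.lt_succ_of_le ((Finset.card_le_univ _).trans (Fintype.card_fin n).le)
  exact (found_spec (isChoice_choose (G := G) r) (n + 1) {r} ∅ (inv_singleton r)
    (not_redundant_singleton r) hcard).1.filter _

/-- A set listed at two roots would have both as its minimum. -/
theorem nodup_allListed [DecidableRel G.Adj] : (allListed G).Nodup := by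
  refine List.nodup_flatMap.2 ⟨fun r _ => nodup_listed r,
    (List.nodup_finRange n).imp fun {r r'} hne => ?_⟩
  intro E hE hE'
  obtain ⟨-, h1, h2⟩ := (mem_listed r E).1 hE
  obtain ⟨-, h3, h4⟩ := (mem_listed r' E).1 hE'
  exact hne (le_antisymm (h2 r' h3) (h4 r h1))

theorem mem_allListed [DecidableRel G.Adj] (E : Finset (Fin n)) :
    E ∈ allListed G ↔ IsMinimalCDS G E := by
  simp only [allListed, List.mem_flatMap, List.mem_finRange, true_and, mem_listed]
  refine ⟨fun ⟨_, h, _⟩ => h, fun h => ?_⟩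
  have hne : E.Nonempty := (isCDS_iff.1 h.1).2.1
  exact ⟨E.min' hne, h, E.min'_mem hne, fun i hi => E.min'_le i hi⟩

theorem run_enumerateC [DecidableRel G.Adj] (h : Env n G W s) :
    Run W enumerateC (6012 * (n + 1) ^ 7 * (leafBound n + 1)) s fun s' =>
      s'.out = s.out ++ (allListed G).flatMap charVector := by
  refine Run.mono (K := (6000 * (n + 1) ^ 6 * (leafBound n + 1) + 12) * (n + 1)) ?_ ?_
    (fun _ _ h => h)
  · refine Run.forN (n := n) (fun j s' => Env n G W s' ∧ s'.out = s.out ++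
      (((List.finRange n).take j).flatMap fun r => listed G r (n + 1) {r} ∅).flatMap charVector)
      h.bound_n (by decide) rfl rfl h.size ⟨h.set (by decide), by simp⟩ ?_ ?_
    · rintro j hj s' - hij ⟨h', ho⟩
      refine Run.mono (run_rootC h' (r := ⟨j, hj⟩) hij) le_rfl ?_
      rintro s'' - ⟨h'', ho'⟩
      refine ⟨h''.set (by decide), ?_⟩
      have hj' : (List.finRange n)[j]? = some ⟨j, hj⟩ := by
        rw [List.getElem?_eq_getElem (by simpa using hj)]
        simp
      rw [State.set_out, ho', ho, List.take_add_one, hj', List.append_assoc]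
      simp [List.flatMap_append]
    · rintro s' - ⟨-, ho⟩
      rw [ho, List.take_of_length_le (by simp), allListed]
  · have h1 : 1 ≤ (n + 1) ^ 6 * (leafBound n + 1) :=
      Nat.mul_pos (Nat.pow_pos (by omega)) (by omega)
    calc (6000 * (n + 1) ^ 6 * (leafBound n + 1) + 12) * (n + 1)
        ≤ (6000 * (n + 1) ^ 6 * (leafBound n + 1) +
          12 * ((n + 1) ^ 6 * (leafBound n + 1))) * (n + 1) := by gcongr; omega
      _ = 6012 * (n + 1) ^ 7 * (leafBound n + 1) := by ring

theorem env_inputState (hW : n * n + 20 * n + 100 ≤ W) : Env n G W (inputState G) := by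
  refine ⟨hW, by simp [inputState], fun i j => ?_, fun i => by simp [inputState]⟩
  have hiff : (∃ i' j' : Fin n, (i : ℕ) * n + j = i' * n + j' ∧ G.Adj i' j') ↔ G.Adj i j := by
    refine ⟨?_, fun h => ⟨i, j, rfl, h⟩⟩
    rintro ⟨i', j', heq, h⟩
    have hdm : ∀ a b : Fin n, ((a : ℕ) * n + b) / n = a ∧ ((a : ℕ) * n + b) % n = b := by
      intro a b
      have hn : 0 < n := a.pos
      rw [mul_comm, Nat.mul_add_div hn, Nat.mul_add_mod, Nat.div_eq_of_lt b.2,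
        Nat.mod_eq_of_lt b.2]
      simp
    have hi : i = i' := Fin.ext (by rw [← (hdm i j).1, heq, (hdm i' j').1])
    have hj : j = j' := Fin.ext (by rw [← (hdm i j).2, heq, (hdm i' j').2])
    rwa [hi, hj]
  by_cases h : G.Adj i j
  · rw [ind_true h]
    exact if_pos ⟨rfl, hiff.2 h⟩
  · rw [ind_false h]
    exact if_neg fun h' => h (hiff.1 h'.2)

end Enumerate

/-- A polynomial times a smaller exponential is bounded by the larger exponential. -/
theorem exists_bound {a b : ℝ} (ha : 0 < a) (hab : a < b) (k : ℕ) :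
    ∃ C : ℝ, ∀ n : ℕ, ((n : ℝ) + 1) ^ k * a ^ n ≤ C * b ^ n := by
  have hb : 0 < b := ha.trans hab
  have hr0 : 0 < a / b := div_pos ha hb
  have hr1 : |a / b| < 1 := by rwa [abs_of_pos hr0, div_lt_one hb]
  -- The sequence `m ^ k * (a / b) ^ m` tends to zero and is therefore bounded. Evaluating it at `n
  -- + 1` costs one extra factor `a / b`, which is divided out.
  obtain ⟨B, hB⟩ := (tendsto_pow_const_mul_const_pow_of_abs_lt_one k hr1).bddAbove_range
  refine ⟨B / (a / b), fun n => ?_⟩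
  have h := hB ⟨n + 1, rfl⟩
  simp only [Nat.cast_add, Nat.cast_one, pow_succ (a / b)] at h
  have h2 : ((n : ℝ) + 1) ^ k * (a / b) ^ n ≤ B / (a / b) := by
    rw [le_div_iff₀ hr0]
    linarith
  calc ((n : ℝ) + 1) ^ k * a ^ n = ((n : ℝ) + 1) ^ k * (a / b) ^ n * b ^ n := by
        rw [div_pow]
        field_simp
    _ ≤ B / (a / b) * b ^ n := by gcongr

theorem exists_time_bound : ∃ C : ℝ, ∀ n : ℕ,
    ((6012 * (n + 1) ^ 7 * (leafBound n + 1) : ℕ) : ℝ) ≤ C * 1.9896 ^ n := by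
  obtain ⟨C, hC⟩ := exists_bound (a := 1.9884) (b := 1.9896) (by norm_num) (by norm_num) 7
  refine ⟨12024 * C, fun n => ?_⟩
  have h1 : (leafBound n : ℝ) ≤ 1.9884 ^ n := Nat.floor_le (by positivity)
  have h2 : (1 : ℝ) ≤ 1.9884 ^ n := one_le_pow₀ (by norm_num)
  push_cast
  calc (6012 * ((n : ℝ) + 1) ^ 7 * (leafBound n + 1))
      ≤ 6012 * ((n : ℝ) + 1) ^ 7 * (1.9884 ^ n + 1.9884 ^ n) := by gcongr
    _ = 12024 * (((n : ℝ) + 1) ^ 7 * 1.9884 ^ n) := by ring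
    _ ≤ 12024 * (C * 1.9896 ^ n) := 
        mul_le_mul_of_nonneg_left (hC n) (by norm_num)
    _ = _ := by ring

theorem length_flatMap_charVector {n : ℕ} (L : List (Finset (Fin n))) :
    (L.flatMap charVector).length = n * L.length := by
  induction L with
  | nil => simp
  | cons D L ih =>
    rw [List.flatMap_cons, List.length_append, ih, List.length_cons, charVector,
      List.length_ofFn]
    ring

/-! ### Transport to arbitrary vertex types and counting -/

section Iso

variable {V V' : Type*} {G : SimpleGraph V} {H : SimpleGraph V'}

theorem isCDS_map (φ : G ≃g H) {D : Finset V} (h : IsCDS G D) :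
    IsCDS H (D.map φ.toEquiv.toEmbedding) := by
  constructor
  · intro w
    rcases h.1 (φ.symm w) with hw | ⟨u, hu, huw⟩
    · exact Or.inl (Finset.mem_map.2 ⟨_, hw, φ.apply_symm_apply w⟩)
    · refine Or.inr ⟨φ u, Finset.mem_map.2 ⟨u, hu, rfl⟩, ?_⟩
      rw [← φ.map_adj_iff] at huw
      rwa [φ.apply_symm_apply] at huw
  · refine h.2.map (SimpleGraph.induceHom φ.toHom fun v hv => ?_) ?_
    · exact Finset.mem_coe.2 (Finset.mem_map.2 ⟨v, hv, rfl⟩)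
    · rintro ⟨w, hw⟩
      obtain ⟨v, hv, rfl⟩ := Finset.mem_map.1 (Finset.mem_coe.1 hw)
      exact ⟨⟨v, hv⟩, rfl⟩

theorem isMinimalCDS_map (φ : G ≃g H) {D : Finset V} (h : IsMinimalCDS G D) :
    IsMinimalCDS H (D.map φ.toEquiv.toEmbedding) := by
  refine ⟨isCDS_map φ h.1, fun E hE hED => ?_⟩
  have hsub : E.map φ.symm.toEquiv.toEmbedding ≤ D := by
    intro v hv
    obtain ⟨w, hw, rfl⟩ := Finset.mem_map.1 hv
    obtain ⟨u, hu, rfl⟩ := Finset.mem_map.1 (hED hw)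
    have : φ.symm (φ u) = u := φ.symm_apply_apply u
    exact this.symm ▸ hu
  intro w hw
  obtain ⟨u, hu, rfl⟩ := Finset.mem_map.1 hw
  obtain ⟨w', hw', rfl⟩ := Finset.mem_map.1 (h.2 (isCDS_map φ.symm hE) hsub hu)
  have : φ (φ.symm w') = w' := φ.apply_symm_apply w'
  exact this.symm ▸ hw'

end Iso

theorem ncard_le_time {n W t : ℕ} {c : Cmd} {G : SimpleGraph (Fin n)} {s : State}
    (h : Exec W c (inputState G) t s) (ho : IsMinimalCDSEnumeration G s.out) :
    {D : Finset (Fin n) | IsMinimalCDS G D}.ncard ≤ t := by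
  classical
  obtain ⟨L, hnd, hmem, hout⟩ := ho
  have hset : {D : Finset (Fin n) | IsMinimalCDS G D} = (L.toFinset : Set (Finset (Fin n))) := by
    ext D
    simp [hmem]
  rw [hset, Set.ncard_coe_finset, List.toFinset_card_of_nodup hnd]
  have hlen := h.length_out_le
  rw [hout, length_flatMap_charVector] at hlen
  have h0 : (inputState G).out.length = 0 := rfl
  -- For `n = 0` characteristic vectors are empty and the output length says nothing; but a
  -- connected dominating set is nonempty, so there is none.
  rcases Nat.eq_zero_or_pos n with rfl | hn
  · have hL : L = [] := List.eq_nil_iff_forall_not_mem.2 fun D hD => by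
      obtain ⟨i, -⟩ := (isCDS_iff.1 ((hmem D).1 hD).1).2.1
      exact i.elim0
    simp [hL]
  · have := Nat.le_mul_of_pos_left L.length hn
    omega

end CDSEnum

theorem mainTheorem1 :
    (∃ (prog : WordRAM.Cmd) (C : ℝ) (space : Polynomial ℕ),
      ∀ (n : ℕ) (G : SimpleGraph (Fin n)),
        ∃ (time : ℕ) (final : WordRAM.State),
          WordRAM.Exec (space.eval n) prog (WordRAM.inputState G) time final ∧
          IsMinimalCDSEnumeration G final.out ∧
          (time : ℝ) ≤ C * (1.9896 : ℝ) ^ n) ∧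
    (∃ C : ℝ, ∀ (V : Type*) [Fintype V] (G : SimpleGraph V),
      ({D : Finset V | IsMinimalCDS G D}.ncard : ℝ) ≤ C * (1.9896 : ℝ) ^ Fintype.card V) := by
  classical
  obtain ⟨C, hC⟩ := CDSEnum.exists_time_bound
  have main : ∀ (n : ℕ) (G : SimpleGraph (Fin n)),
      ∃ (time : ℕ) (final : WordRAM.State),
        WordRAM.Exec (((Polynomial.X + Polynomial.C 10) ^ 2 : Polynomial ℕ).eval n)
          CDSEnum.enumerateC (WordRAM.inputState G) time final ∧
        IsMinimalCDSEnumeration G final.out ∧ (time : ℝ) ≤ C * (1.9896 : ℝ) ^ n := by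
    intro n G
    -- The space polynomial `(X + 10) ^ 2` evaluates to exactly the bound `n * n + 20 * n + 100`
    -- required by `Env`.
    obtain ⟨t, s, ht, hs, ho⟩ := CDSEnum.run_enumerateC (CDSEnum.env_inputState (G := G)
      (W := ((Polynomial.X + Polynomial.C 10) ^ 2 : Polynomial ℕ).eval n) (by
        simp only [Polynomial.eval_pow, Polynomial.eval_add, Polynomial.eval_X,
          Polynomial.eval_C]
        nlinarith))
    exact ⟨t, s, hs, ⟨CDSEnum.allListed G, CDSEnum.nodup_allListed, CDSEnum.mem_allListed, ho⟩,
      (Nat.cast_le.2 ht).trans (hC n)⟩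
  refine ⟨⟨_, C, _, main⟩, C, fun V _ G => ?_⟩
  let φ : G ≃g G.map (Fintype.equivFin V).toEmbedding := SimpleGraph.Iso.map _ G
  obtain ⟨t, s, hs, ho, ht⟩ := main _ (G.map (Fintype.equivFin V).toEmbedding)
  refine le_trans (Nat.cast_le.2 ?_) ht
  refine (Set.ncard_le_ncard_of_injOn (fun D => D.map φ.toEquiv.toEmbedding)
    (fun D hD => CDSEnum.isMinimalCDS_map φ hD) ?_ (Set.toFinite _)).trans
    (CDSEnum.ncard_le_time hs ho)
  exact (Finset.map_injective _).injOn
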